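/- Let $N$ be a closed (compact, without boundary, not necessarily connected) smooth manifold, equipped with a smooth positive measure $\mu$ (for instance $N=\partial M$ for a compact Riemannian manifold $M$ with boundary, with the Riemannian volume measure), and let $E\to N$ be a smooth complex vector bundle of finite rank with a smooth Hermitian metric (for instance the restriction to $\partial M$ of a Hermitian bundle on $M$). For $s\in\mathbb R$ let $L^2_s(N,E)$ be the Sobolev space of order $s$, that is the completion of the space $\Gamma^\infty(N;E)$ of smooth sections with respect to $$\|u\|_s=\Bigl(\sum_i\bigl\|\mathcal F^{-1}(1+|\xi|^2)^{s/2}\mathcal F(\chi_iu)\bigr\|^2_{L^2(\mathbb R^n)}\Bigr)^{1/2},$$ where $(\chi_i)$ is a smooth partition of unity subordinate to a finite cover of $N$ by charts over which $E$ is trivialized, and $\chi_iu$ is read in these coordinates; other choices give equivalent norms. For an operator $A$ on $\Gamma^\infty(N;E)$ let $\|A\|_{s,t}$ be its operator norm from $L^2_s(N,E)$ to $L^2_t(N,E)$. Let $c\in\mathbb R$, and let $\operatorname{Ell}_c^{1,\mathrm{sa}}(N,E)$ be the set of all first order elliptic differential operators $B$ with smooth coefficients on $\Gamma^\infty(N;E)$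 which are self-adjoint (that is, $\langle Bu,v\rangle=\langle u,Bv\rangle$ in $L^2(N,E;\mu)$ for all smooth sections $u,v$) and such that neither $c$ nor $-c$ belongs to the spectrum of the closure of $B$ in $L^2(N,E)$. Equip this set with the distance $\|B-B'\|_{1,0}$. Then for every $s\in\mathbb R$ with $|s|\le\tfrac12$ the following holds. For each $B\in\operatorname{Ell}_c^{1,\mathrm{sa}}(N,E)$ the spectral projection $1_{[c,\infty)}(B)$ of the closure of $B$ in $L^2(N,E)$ exists and restricts (if $s\ge0$), respectively extends continuously (if $s\le0$), to a bounded operator on $L^2_s(N,E)$, and the map $$\bigl(\operatorname{Ell}_c^{1,\mathrm{sa}}(N,E),\|\cdot\|_{1,0}\bigr)\longrightarrow\mathcal B\bigl(L^2_s(N,E)\bigr),\qquad B\mapsto 1_{[c,\infty)}(B),$$ is continuous, where $\mathcal B(L^2_s(N,E))$ carries the operator norm. -/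

import Mathlib

open Bundle MeasureTheory Set Filter Topology
open scoped Manifold ContDiff SchwartzMap ENNReal NNReal

set_option linter.unusedSectionVars false

noncomputable section

namespace SpectralCut

section Hilbert

variable (H : Type*) [NormedAddCommGroup H] [InnerProductSpace ℂ H] [CompleteSpace H]

/-- A projection-valued measure on the Borel sets of `ℝ`: orthogonal projections, of total mass the
identity, countably additive in the strong operator topology. (Values on non-measurable sets are
irrelevant.) -/
structure ProjectionValuedMeasure where
  /-- the projection attached to a set -/
  proj : Set ℝ → H →L[ℂ] H
  isStarProjection : ∀ S, MeasurableSet S → IsStarProjection (proj S)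
  proj_univ : proj univ = 1
  hasSum_iUnion : ∀ S : ℕ → Set ℝ, (∀ i, MeasurableSet (S i)) → Pairwise (Function.onFun Disjoint S) →
    ∀ x, HasSum (fun i => proj (S i) x) (proj (⋃ i, S i) x)

variable {H}

namespace ProjectionValuedMeasure

variable (P : ProjectionValuedMeasure H)

theorem norm_sq_eq {S : Set ℝ} (hS : MeasurableSet S) (x : H) :
    ‖P.proj S x‖ ^ 2 = RCLike.re (inner ℂ x (P.proj S x)) := by
  have h := P.isStarProjection S hS
  have h1 : inner ℂ (P.proj S x) (P.proj S x) = inner ℂ x (P.proj S x) := by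
    have h2 : P.proj S (P.proj S x) = P.proj S x := by
      have := congrArg (fun T : H →L[ℂ] H => T x) h.isIdempotentElem
      simpa using this
    have h3 := (ContinuousLinearMap.isSelfAdjoint_iff_isSymmetric.1 h.isSelfAdjoint) x (P.proj S x)
    simp only [ContinuousLinearMap.coe_coe] at h3
    rw [h3, h2]
  rw [← h1, inner_self_eq_norm_sq]

theorem proj_empty (x : H) : P.proj ∅ x = 0 := by
  have h := P.hasSum_iUnion (fun _ => ∅) (fun _ => MeasurableSet.empty)
    (fun _ _ _ => by simp [Function.onFun]) x
  have := h.summable.tendsto_atTop_zero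
  simpa using (tendsto_const_nhds_iff.1 this)

/-- The scalar measure `S ↦ ‖P(S) x‖² = ⟨x, P(S) x⟩` of a vector `x`. -/
def scalarMeasure (x : H) : Measure ℝ :=
  Measure.ofMeasurable (fun S _ => ENNReal.ofReal (‖P.proj S x‖ ^ 2))
    (by simp [P.proj_empty])
    (by
      intro S hS hd
      have h := (P.hasSum_iUnion S hS hd x).mapL (innerSL ℂ x)
      have h' := h.mapL RCLike.reCLM
      simp only [innerSL_apply_apply, RCLike.reCLM_apply] at h'
      have e : ∀ i, RCLike.re (inner ℂ x (P.proj (S i) x)) = ‖P.proj (S i) x‖ ^ 2 :=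
        fun i => (P.norm_sq_eq (hS i) x).symm
      rw [← P.norm_sq_eq (MeasurableSet.iUnion hS) x] at h'
      simp only [e] at h'
      rw [← h'.tsum_eq, ENNReal.ofReal_tsum_of_nonneg (fun i => by positivity) h'.summable])

end ProjectionValuedMeasure

/-- `P` is the spectral measure of `T`, that is `T = ∫ t dP(t)`: the domain of `T` consists of the
`x` with `∫ t² d⟨x, P x⟩ < ∞`, and `⟨x, T x⟩ = ∫ t d⟨x, P x⟩` on the domain. -/
def IsSpectralMeasure (T : H →ₗ.[ℂ] H) (P : ProjectionValuedMeasure H) : Prop :=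
  (∀ x, x ∈ T.domain ↔ ∫⁻ t, ENNReal.ofReal (t ^ 2) ∂(P.scalarMeasure x) < ⊤) ∧
    ∀ x : T.domain, inner ℂ (x : H) (T x) = ((∫ t, t ∂(P.scalarMeasure (x : H)) : ℝ) : ℂ)

/-- `Q = 1_S(T)`. -/
def IsSpectralProjection (T : H →ₗ.[ℂ] H) (S : Set ℝ) (Q : H →L[ℂ] H) : Prop :=
  ∃ P : ProjectionValuedMeasure H, IsSpectralMeasure T P ∧ P.proj S = Q

/-- The spectrum of a possibly unbounded operator: the complement of the set of those `z` for which
`T - z` has an everywhere defined bounded two-sided inverse `R`. -/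
def unboundedSpectrum (T : H →ₗ.[ℂ] H) : Set ℂ :=
  {z | ¬ ∃ R : H →L[ℂ] H, (∀ y, ∃ x : T.domain, (x : H) = R y ∧ T x - z • (x : H) = y) ∧
    ∀ x : T.domain, R (T x - z • (x : H)) = x}

end Hilbert

section Sections

variable (n : ℕ) {N : Type*} [TopologicalSpace N] [ChartedSpace (EuclideanSpace ℝ (Fin n)) N]
  (F : Type*) [NormedAddCommGroup F] [InnerProductSpace ℂ F]
  (E : N → Type*) [TopologicalSpace (TotalSpace F E)] [∀ x, NormedAddCommGroup (E x)]
  [∀ x, InnerProductSpace ℂ (E x)] [FiberBundle F E]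

theorem isLinear_real [VectorBundle ℂ F E] (e : Trivialization F (π F E)) [e.IsLinear ℂ] :
    e.IsLinear ℝ where
  linear := fun b hb =>
    { map_add := (Trivialization.linear ℂ e hb).map_add
      map_smul := fun c v => by
        have := (Trivialization.linear ℂ e hb).map_smul (c : ℂ) v
        simpa using this }

/-- A complex vector bundle is also a real vector bundle. -/
instance realVectorBundle [VectorBundle ℂ F E] : VectorBundle ℝ F E where
  trivialization_linear' e _ := isLinear_real F E e
  continuousOn_coordChange' e e' _ _ := by
    have h := continuousOn_coordChange ℂ e e'
    have h2 := (ContinuousLinearMap.restrictScalarsL ℂ F F ℝ ℝ).continuous.comp_continuousOn h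
    refine h2.congr fun b hb => ?_
    ext v
    change _ = Trivialization.coordChangeL ℂ e e' b v
    rw [Trivialization.coordChangeL_apply _ _ hb]
    have := isLinear_real F E e
    have := isLinear_real F E e'
    exact Trivialization.coordChangeL_apply (R := ℝ) e e' hb v

variable [IsManifold (𝓡 n) ∞ N] [VectorBundle ℂ F E] [ContMDiffVectorBundle ∞ F E (𝓡 n)]

/-- The complex vector space `Γ^∞(N; E)` of smooth sections. -/
abbrev SmoothSections : Type _ := ContMDiffSection (𝓡 n) F ∞ E

instance : SMul ℂ (SmoothSections n F E) where
  smul c u := ⟨c • ⇑u, fun x => by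
    have h := (contMDiffAt_section x).1 (u.contMDiff x)
    rw [contMDiffAt_section]
    have hc : ContMDiff 𝓘(ℝ, F) 𝓘(ℝ, F) ∞ (fun v : F => c • v) :=
      (contDiff_const_smul c).contMDiff
    refine ((hc _).comp x h).congr_of_eventuallyEq ?_
    filter_upwards [(trivializationAt F E x).open_baseSet.mem_nhds
      (FiberBundle.mem_baseSet_trivializationAt' x)] with y hy
    exact (Trivialization.linear ℂ (trivializationAt F E x) hy).map_smul c (u y)⟩

variable {n F E} in
@[simp]
theorem SmoothSections.coe_smul (c : ℂ) (u : SmoothSections n F E) : ⇑(c • u) = c • ⇑u := rfl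

instance : Module ℂ (SmoothSections n F E) :=
  Function.Injective.module ℂ (ContMDiffSection.coeAddHom (𝓡 n) F ∞ E)
    ContMDiffSection.coe_injective fun _ _ => rfl

/-- The Hermitian inner products on the fibres form a smooth Hermitian metric on the bundle `E`: the
inner product of any two smooth sections is a smooth function. -/
class IsSmoothHermitian : Prop where
  contMDiff_inner : ∀ u v : SmoothSections n F E,
    ContMDiff (𝓡 n) 𝓘(ℝ, ℂ) ∞ fun x => inner ℂ (u x) (v x)

/-- A section in the preferred chart at `p` and the preferred trivialization at `p`. Only its values
on `localDomain n F E p` are meaningful. -/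
def localRep (p : N) (u : ∀ x, E x) (y : EuclideanSpace ℝ (Fin n)) : F :=
  (trivializationAt F E p ⟨(chartAt (EuclideanSpace ℝ (Fin n)) p).symm y,
    u ((chartAt (EuclideanSpace ℝ (Fin n)) p).symm y)⟩).2

/-- The open subset of `ℝⁿ` on which sections are represented near `p`. -/
def localDomain (p : N) : Set (EuclideanSpace ℝ (Fin n)) :=
  (chartAt (EuclideanSpace ℝ (Fin n)) p).target ∩
    (chartAt (EuclideanSpace ℝ (Fin n)) p).symm ⁻¹' (trivializationAt F E p).baseSet

theorem isOpen_localDomain (p : N) : IsOpen (localDomain n F E p) :=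
  (chartAt (EuclideanSpace ℝ (Fin n)) p).isOpen_inter_preimage_symm
    (trivializationAt F E p).open_baseSet

theorem contDiffOn_localRep (p : N) (u : SmoothSections n F E) :
    ContDiffOn ℝ ∞ (localRep n F E p u) (localDomain n F E p) := by
  rw [← contMDiffOn_iff_contDiffOn]
  have h1 : ContMDiffOn (𝓡 n) 𝓘(ℝ, F) ∞
      (fun x => (trivializationAt F E p ⟨x, u x⟩).2) (trivializationAt F E p).baseSet :=
    ((trivializationAt F E p).contMDiffOn_section_baseSet_iff).1 u.contMDiff.contMDiffOn
  have h2 : ContMDiffOn (𝓡 n) (𝓡 n) ∞ (chartAt (EuclideanSpace ℝ (Fin n)) p).symm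
    (chartAt (EuclideanSpace ℝ (Fin n)) p).target := contMDiffOn_chart_symm
  exact h1.comp (h2.mono inter_subset_left) (fun y hy => hy.2)

/-- `a`, `b` are the coefficients, in the chart and the trivialization at `p`, of the
operator `A`, which there reads `∑ⱼ aⱼ ∂ⱼ + b`. -/
def HasCoefficients (A : SmoothSections n F E →ₗ[ℂ] SmoothSections n F E) (p : N)
    (a : Fin n → EuclideanSpace ℝ (Fin n) → F →L[ℂ] F)
    (b : EuclideanSpace ℝ (Fin n) → F →L[ℂ] F) : Prop :=
  (∀ j, ContDiffOn ℝ ∞ (a j) (localDomain n F E p)) ∧ ContDiffOn ℝ ∞ b (localDomain n F E p) ∧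
    ∀ (u : SmoothSections n F E), ∀ y ∈ localDomain n F E p,
      localRep n F E p (A u) y =
        ∑ j, a j y (fderiv ℝ (localRep n F E p u) y (EuclideanSpace.single j 1)) +
          b y (localRep n F E p u y)

/-- First order differential operators with smooth coefficients whose principal symbol
`ξ ↦ i ∑ⱼ ξⱼ aⱼ(y)` is invertible for every real `ξ ≠ 0`. -/
def IsFirstOrderElliptic (A : SmoothSections n F E →ₗ[ℂ] SmoothSections n F E) : Prop :=
  ∀ p : N, ∃ a b, HasCoefficients n F E A p a b ∧
    ∀ y ∈ localDomain n F E p, ∀ ξ : Fin n → ℝ, ξ ≠ 0 → IsUnit (∑ j, (ξ j : ℂ) • a j y)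

/-- Finitely many preferred charts and trivializations which cover `N`, with a subordinate smooth
partition of unity. -/
structure LocalizingCover where
  /-- the number of charts -/
  card : ℕ
  /-- the points at which the charts and trivializations are taken -/
  center : Fin card → N
  /-- the partition of unity -/
  cutoff : SmoothPartitionOfUnity (Fin card) (𝓡 n) N univ
  subordinate : cutoff.IsSubordinate fun i =>
    (chartAt (EuclideanSpace ℝ (Fin n)) (center i)).source ∩
      (trivializationAt F E (center i)).baseSet

variable {n F E}

namespace LocalizingCover

variable (K : LocalizingCover n F E)

/-- The `i`-th localized piece `χᵢ u` of a section `u`, in coordinates, extended by zero to `ℝⁿ`. -/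
def piece (i : Fin K.card) (u : ∀ x, E x) : EuclideanSpace ℝ (Fin n) → F :=
  (localDomain n F E (K.center i)).indicator fun y =>
    K.cutoff i ((chartAt (EuclideanSpace ℝ (Fin n)) (K.center i)).symm y) •
      localRep n F E (K.center i) u y

/-- The image of the support of the `i`-th cutoff function in the chart. -/
def pieceSupport (i : Fin K.card) : Set (EuclideanSpace ℝ (Fin n)) :=
  chartAt (EuclideanSpace ℝ (Fin n)) (K.center i) '' tsupport (K.cutoff i)

theorem isCompact_pieceSupport [CompactSpace N] (i : Fin K.card) : IsCompact (K.pieceSupport i) :=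
  (isClosed_tsupport _).isCompact.image_of_continuousOn
    ((chartAt (EuclideanSpace ℝ (Fin n)) (K.center i)).continuousOn.mono
      fun _ hx => (K.subordinate i hx).1)

theorem pieceSupport_subset (i : Fin K.card) :
    K.pieceSupport i ⊆ localDomain n F E (K.center i) := by
  rintro _ ⟨x, hx, rfl⟩
  have h := K.subordinate i hx
  refine ⟨(chartAt _ _).map_source h.1, ?_⟩
  rw [mem_preimage, (chartAt _ _).left_inv h.1]
  exact h.2

theorem piece_eq_zero (i : Fin K.card) (u : ∀ x, E x) {y : EuclideanSpace ℝ (Fin n)}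
    (hy : y ∉ K.pieceSupport i) : K.piece i u y = 0 := by
  classical
  rw [piece, indicator_apply]
  split_ifs with h
  · rw [image_eq_zero_of_notMem_tsupport (f := K.cutoff i)
      (fun hx => hy ⟨_, hx, (chartAt _ _).right_inv h.1⟩), zero_smul]
  · rfl

theorem hasCompactSupport_piece [CompactSpace N] (i : Fin K.card) (u : ∀ x, E x) :
    HasCompactSupport (K.piece i u) :=
  HasCompactSupport.intro (K.isCompact_pieceSupport i) fun _ hy => K.piece_eq_zero i u hy

theorem contDiff_piece [CompactSpace N] (i : Fin K.card) (u : SmoothSections n F E) :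
    ContDiff ℝ ∞ (K.piece i u) := by
  rw [contDiff_iff_contDiffAt]
  intro y
  by_cases hy : y ∈ localDomain n F E (K.center i)
  · have ho := (isOpen_localDomain n F E (K.center i)).mem_nhds hy
    have h1 : ContDiffOn ℝ ∞
        (fun y => K.cutoff i ((chartAt (EuclideanSpace ℝ (Fin n)) (K.center i)).symm y))
        (localDomain n F E (K.center i)) := by
      rw [← contMDiffOn_iff_contDiffOn]
      have h2 : ContMDiffOn (𝓡 n) (𝓡 n) ∞ (chartAt (EuclideanSpace ℝ (Fin n)) (K.center i)).symm
        (chartAt (EuclideanSpace ℝ (Fin n)) (K.center i)).target := contMDiffOn_chart_symm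
      exact (K.cutoff i).contMDiff.comp_contMDiffOn (h2.mono inter_subset_left)
    refine ((h1.smul (contDiffOn_localRep n F E _ u)).contDiffAt ho).congr_of_eventuallyEq ?_
    filter_upwards [ho] with z hz
    rw [piece, indicator_of_mem hz]
    rfl
  · have : K.piece i u =ᶠ[𝓝 y] fun _ => 0 := by
      filter_upwards [(K.isCompact_pieceSupport i).isClosed.isOpen_compl.mem_nhds
        (fun h => hy (K.pieceSupport_subset i h))] with z hz
      exact K.piece_eq_zero i u hz
    exact contDiffAt_const.congr_of_eventuallyEq this

theorem piece_add (i : Fin K.card) (u v : ∀ x, E x) :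
    K.piece i (u + v) = K.piece i u + K.piece i v := by
  classical
  funext y
  simp only [piece, indicator_apply, Pi.add_apply]
  split_ifs with h
  · rw [← smul_add]
    congr 1
    exact (Trivialization.linear ℂ (trivializationAt F E (K.center i)) h.2).map_add _ _
  · simp

theorem piece_smul (i : Fin K.card) (c : ℂ) (u : ∀ x, E x) :
    K.piece i (c • u) = c • K.piece i u := by
  classical
  funext y
  simp only [piece, indicator_apply, Pi.smul_apply]
  split_ifs with h
  · rw [smul_comm]
    congr 1
    exact (Trivialization.linear ℂ (trivializationAt F E (K.center i)) h.2).map_smul _ _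
  · simp

variable [CompactSpace N]

/-- `u ↦ χᵢ u` in coordinates, as a map into the Schwartz space. -/
def localize (i : Fin K.card) : SmoothSections n F E →ₗ[ℂ] 𝓢(EuclideanSpace ℝ (Fin n), F) where
  toFun u := (K.hasCompactSupport_piece i u).toSchwartzMap (K.contDiff_piece i u)
  map_add' u v := by
    ext y
    exact congrFun (K.piece_add i u v) y
  map_smul' c u := by
    ext y
    exact congrFun (K.piece_smul i c u) y

variable [FiniteDimensional ℂ F]

/-- The family of the `Λˢ(χᵢ u) ∈ L²(ℝⁿ; F)`, where `Λˢ` is the Bessel potential operator, the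
Fourier multiplier with symbol `(1 + |ξ|²)^(s/2)`. -/
def besselPieces (s : ℝ) : SmoothSections n F E →ₗ[ℂ]
    PiLp 2 fun _ : Fin K.card => Lp F 2 (volume : Measure (EuclideanSpace ℝ (Fin n))) :=
  (WithLp.linearEquiv 2 ℂ
    (Fin K.card → Lp F 2 (volume : Measure (EuclideanSpace ℝ (Fin n))))).symm.toLinearMap ∘ₗ
    LinearMap.pi fun i =>
      (SchwartzMap.toLpCLM ℂ F 2 (volume : Measure (EuclideanSpace ℝ (Fin n)))).toLinearMap ∘ₗ
        (SchwartzMap.fourierMultiplierCLM F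
          (fun ξ : EuclideanSpace ℝ (Fin n) => (((1 + ‖ξ‖ ^ 2) ^ (s / 2) : ℝ) : ℂ))).toLinearMap ∘ₗ
          K.localize i

/-- The Sobolev norm `‖u‖ₛ = (∑ᵢ ‖Λˢ(χᵢ u)‖²)^(1/2)` on smooth sections. -/
def sobolevNorm (s : ℝ) (u : SmoothSections n F E) : ℝ := ‖K.besselPieces s u‖

/-- `Γ^∞(N; E)` equipped with the norm `‖·‖ₛ`. -/
def SobolevPre (_K : LocalizingCover n F E) (_s : ℝ) : Type _ := SmoothSections n F E

instance (s : ℝ) : AddCommGroup (K.SobolevPre s) :=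
  inferInstanceAs (AddCommGroup (SmoothSections n F E))

instance (s : ℝ) : Module ℂ (K.SobolevPre s) :=
  inferInstanceAs (Module ℂ (SmoothSections n F E))

/-- `besselPieces` on the renamed space. -/
def preBesselPieces (s : ℝ) : K.SobolevPre s →ₗ[ℂ]
    PiLp 2 fun _ : Fin K.card => Lp F 2 (volume : Measure (EuclideanSpace ℝ (Fin n))) :=
  K.besselPieces s

instance (s : ℝ) : SeminormedAddCommGroup (K.SobolevPre s) :=
  SeminormedAddCommGroup.induced _ _ (K.preBesselPieces s)

instance (s : ℝ) : NormedSpace ℂ (K.SobolevPre s) :=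
  NormedSpace.induced ℂ _ _ (K.preBesselPieces s)

/-- The Sobolev space `L²ₛ(N; E)` of any real order `s`: the completion of `Γ^∞(N; E)` with respect
to `‖·‖ₛ`. -/
abbrev Sobolev (s : ℝ) : Type _ := UniformSpace.Completion (K.SobolevPre s)

/-- A smooth section as an element of `L²ₛ(N; E)`. -/
def toSobolev (s : ℝ) : SmoothSections n F E →ₗ[ℂ] K.Sobolev s :=
  (UniformSpace.Completion.toComplL (𝕜 := ℂ) (E := K.SobolevPre s)).toLinearMap

theorem norm_toSobolev (s : ℝ) (u : SmoothSections n F E) :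
    ‖K.toSobolev s u‖ = K.sobolevNorm s u :=
  UniformSpace.Completion.norm_coe (E := K.SobolevPre s) u

/-- The operator norm `‖A‖_{s,t}` of `A` from `L²ₛ` to `L²ₜ`, the least `C` with
`‖A u‖ₜ ≤ C ‖u‖ₛ` (and `∞` if there is none). -/
def opENorm (s t : ℝ) (A : SmoothSections n F E →ₗ[ℂ] SmoothSections n F E) : ℝ≥0∞ :=
  ⨅ (C : ℝ≥0) (_ : ∀ u, K.sobolevNorm t (A u) ≤ C * K.sobolevNorm s u), (C : ℝ≥0∞)

theorem opENorm_zero (s t : ℝ) : K.opENorm s t 0 = 0 := by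
  refine le_antisymm (iInf₂_le_of_le 0 ?_ (by simp)) bot_le
  intro u
  simp [sobolevNorm]

theorem opENorm_neg (s t : ℝ) (A : SmoothSections n F E →ₗ[ℂ] SmoothSections n F E) :
    K.opENorm s t (-A) = K.opENorm s t A := by
  simp [opENorm, sobolevNorm]

theorem opENorm_add_le (s t : ℝ) (A B : SmoothSections n F E →ₗ[ℂ] SmoothSections n F E) :
    K.opENorm s t (A + B) ≤ K.opENorm s t A + K.opENorm s t B := by
  unfold opENorm
  simp only [ENNReal.iInf_add, ENNReal.add_iInf]
  refine le_iInf₂ fun C hC => le_iInf₂ fun D hD => ?_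
  refine iInf₂_le_of_le (C + D) ?_ (by simp [add_comm])
  intro u
  have h : K.sobolevNorm t ((A + B) u) ≤ K.sobolevNorm t (A u) + K.sobolevNorm t (B u) := by
    simp only [sobolevNorm, LinearMap.add_apply, map_add]
    exact norm_add_le _ _
  have := hC u
  have := hD u
  push_cast
  linarith

end LocalizingCover

/-- A Borel measure with smooth positive density with respect to the Lebesgue measure in every
preferred chart, such as the volume measure of a Riemannian metric. -/
class IsSmoothDensity (n : ℕ) {N : Type*} [TopologicalSpace N]
    [ChartedSpace (EuclideanSpace ℝ (Fin n)) N] [MeasurableSpace N] (μ : Measure N) : Prop where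
  exists_density : ∀ p : N, ∃ ρ : EuclideanSpace ℝ (Fin n) → ℝ,
    ContDiffOn ℝ ∞ ρ (chartAt (EuclideanSpace ℝ (Fin n)) p).target ∧
    (∀ y ∈ (chartAt (EuclideanSpace ℝ (Fin n)) p).target, 0 < ρ y) ∧
    (μ.restrict (chartAt (EuclideanSpace ℝ (Fin n)) p).source).map
        (chartAt (EuclideanSpace ℝ (Fin n)) p) =
      (volume.restrict (chartAt (EuclideanSpace ℝ (Fin n)) p).target).withDensity
        fun y => ENNReal.ofReal (ρ y)

section L2

variable [MeasurableSpace N] [BorelSpace N] [CompactSpace N] [T2Space N]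
  (μ : Measure N)

theorem IsSmoothDensity.isFiniteMeasure [IsSmoothDensity n μ] : IsFiniteMeasure μ := by
  have h : ∀ p : N, μ.FiniteAtFilter (𝓝 p) := by
    intro p
    obtain ⟨ρ, hρ, -, hμ⟩ := IsSmoothDensity.exists_density (n := n) (μ := μ) p
    set φ := chartAt (EuclideanSpace ℝ (Fin n)) p with hφ
    have hp : p ∈ φ.source := mem_chart_source _ p
    obtain ⟨r, hr, hr'⟩ := Metric.nhds_basis_closedBall.mem_iff.1
      (φ.open_target.mem_nhds (φ.map_source hp))
    have hs : φ.source ∩ φ ⁻¹' (Metric.closedBall (φ p) r) ∈ 𝓝 p :=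
      inter_mem (φ.open_source.mem_nhds hp)
        ((φ.continuousAt hp).preimage_mem_nhds (Metric.closedBall_mem_nhds _ hr))
    refine ⟨_, hs, ?_⟩
    have hm : AEMeasurable φ (μ.restrict φ.source) :=
      φ.continuousOn.aemeasurable φ.open_source.measurableSet
    have h1 := Measure.map_apply_of_aemeasurable hm
      (Metric.isClosed_closedBall (x := φ p) (ε := r)).measurableSet
    rw [Measure.restrict_apply' φ.open_source.measurableSet, inter_comm] at h1
    rw [← h1, hμ, withDensity_apply _ Metric.isClosed_closedBall.measurableSet,
      Measure.restrict_restrict Metric.isClosed_closedBall.measurableSet,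
      inter_eq_left.2 hr']
    have hc : IsCompact (Metric.closedBall (φ p) r) := isCompact_closedBall _ _
    exact ((hρ.continuousOn.mono hr').integrableOn_compact hc).lintegral_lt_top
  have : IsLocallyFiniteMeasure μ := ⟨h⟩
  exact ⟨(isCompact_univ).measure_lt_top⟩

variable [IsSmoothHermitian n F E]

theorem continuous_inner_sections (u v : SmoothSections n F E) :
    Continuous fun x => inner ℂ (u x) (v x) :=
  (IsSmoothHermitian.contMDiff_inner u v).continuous

variable (n F E) in
/-- `Γ^∞(N; E)` equipped with the `L²` inner product. -/
def L2Pre (_μ : Measure N) : Type _ := SmoothSections n F E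

instance : AddCommGroup (L2Pre n F E μ) :=
  inferInstanceAs (AddCommGroup (SmoothSections n F E))

instance : Module ℂ (L2Pre n F E μ) :=
  inferInstanceAs (Module ℂ (SmoothSections n F E))

/-- The `L²` inner product `⟨u, v⟩ = ∫ ⟨u(x), v(x)⟩ dμ(x)` of smooth sections. -/
def l2Inner (u v : SmoothSections n F E) : ℂ :=
  ∫ x, inner ℂ (u x) (v x) ∂μ

variable [IsSmoothDensity n μ]

theorem integrable_inner_sections (u v : SmoothSections n F E) :
    Integrable (fun x => inner ℂ (u x) (v x)) μ := by
  have := IsSmoothDensity.isFiniteMeasure (n := n) μ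
  rw [← integrableOn_univ]
  exact (continuous_inner_sections u v).continuousOn.integrableOn_compact isCompact_univ

/-- The `L²` inner product as a (positive semidefinite) inner product. -/
instance l2Core : PreInnerProductSpace.Core ℂ (L2Pre n F E μ) where
  inner u v := l2Inner (n := n) (F := F) (E := E) μ u v
  conj_inner_symm u v := by
    change starRingEnd ℂ (∫ x, _ ∂μ) = ∫ x, _ ∂μ
    rw [← integral_conj]
    simp only [inner_conj_symm]
  re_inner_nonneg u := by
    change 0 ≤ RCLike.re (∫ x, _ ∂μ)
    rw [← integral_re (integrable_inner_sections μ u u)]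
    exact integral_nonneg fun x => inner_self_nonneg
  add_left u v w := by
    change (∫ x, _ ∂μ) = (∫ x, _ ∂μ) + ∫ x, _ ∂μ
    rw [← integral_add (integrable_inner_sections μ u w) (integrable_inner_sections μ v w)]
    exact integral_congr_ae (.of_forall fun x => inner_add_left _ _ _)
  smul_left u v c := by
    change (∫ x, _ ∂μ) = _ * ∫ x, _ ∂μ
    rw [← integral_const_mul]
    exact integral_congr_ae (.of_forall fun x => inner_smul_left _ _ _)

instance : SeminormedAddCommGroup (L2Pre n F E μ) :=
  InnerProductSpace.Core.toSeminormedAddCommGroup (𝕜 := ℂ)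

instance : InnerProductSpace ℂ (L2Pre n F E μ) :=
  InnerProductSpace.ofCore (l2Core μ)

variable (n F E) in
/-- The Hilbert space `L²(N; E)`, as the completion of the space of smooth sections. -/
abbrev L2 : Type _ := UniformSpace.Completion (L2Pre n F E μ)

/-- A smooth section as an element of `L²(N; E)`. -/
def toL2 : SmoothSections n F E →ₗ[ℂ] L2 n F E μ :=
  (UniformSpace.Completion.toComplL (𝕜 := ℂ) (E := L2Pre n F E μ)).toLinearMap

theorem inner_toL2 (u v : SmoothSections n F E) :
    inner ℂ (toL2 μ u) (toL2 μ v) = ∫ x, inner ℂ (u x) (v x) ∂μ :=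
  UniformSpace.Completion.inner_coe (E := L2Pre n F E μ) u v

/-- The closure in `L²(N; E)` of an operator on smooth sections: the operator whose graph is the
closure of the set of the pairs `(u, A u)`. -/
def l2Closure (A : SmoothSections n F E →ₗ[ℂ] SmoothSections n F E) :
    L2 n F E μ →ₗ.[ℂ] L2 n F E μ :=
  (LinearMap.range ((toL2 μ).prod (toL2 μ ∘ₗ A))).topologicalClosure.toLinearPMap

variable [FiniteDimensional ℂ F]

/-- `x ∈ L²ₛ` and `y ∈ L²` are the same (generalized) section: they are the limits, in the two
spaces, of one sequence of smooth sections. For `s ≥ 0` this is the graph of the inclusion of `L²ₛ`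
into `L²`, for `s ≤ 0` the transposed graph of the inclusion of `L²` into `L²ₛ`. -/
def SameSection (K : LocalizingCover n F E) {s : ℝ} (x : K.Sobolev s) (y : L2 n F E μ) : Prop :=
  (x, y) ∈ closure (range fun u : SmoothSections n F E => (K.toSobolev s u, toL2 μ u))

/-- The bounded operator `R` on `L²ₛ` is the restriction (`s ≥ 0`), respectively the continuous
extension (`s ≤ 0`), of the bounded operator `Q` on `L²`. -/
def Induces (K : LocalizingCover n F E) {s : ℝ} (Q : L2 n F E μ →L[ℂ] L2 n F E μ)
    (R : K.Sobolev s →L[ℂ] K.Sobolev s) : Prop :=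
  ∀ x y, SameSection μ K x y → SameSection μ K (R x) (Q y)

/-- The set of the (formally) self-adjoint first order elliptic differential operators `B` on
`Γ^∞(N; E)` such that `c` and `-c` are not in the spectrum of `B` in `L²(N; E)`. -/
structure EllSA (K : LocalizingCover n F E) (c : ℝ) where
  /-- the differential operator -/
  op : SmoothSections n F E →ₗ[ℂ] SmoothSections n F E
  elliptic : IsFirstOrderElliptic n F E op
  selfAdjoint : ∀ u v, l2Inner μ (op u) v = l2Inner μ u (op v)
  notMem_spectrum : (c : ℂ) ∉ unboundedSpectrum (l2Closure μ op)
  neg_notMem_spectrum : (-c : ℂ) ∉ unboundedSpectrum (l2Closure μ op)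

/-- The set of operators is topologized by the distance `‖B - B'‖_{1,0}`. -/
instance (K : LocalizingCover n F E) (c : ℝ) : PseudoEMetricSpace (EllSA μ K c) where
  edist B B' := K.opENorm 1 0 (B.op - B'.op)
  edist_self B := by
    rw [sub_self, K.opENorm_zero]
  edist_comm B B' := by
    rw [← K.opENorm_neg, neg_sub]
  edist_triangle B B' B'' := by
    rw [← sub_add_sub_cancel B.op B'.op B''.op]
    exact K.opENorm_add_le _ _ _ _

end L2

end Sections

end SpectralCut

end

/-!
Let `A = B - c` and `R = A⁻¹`, a bounded injective self-adjoint operator on `L²`. The spectral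
measure of `B` is the image of that of `R` under `t ↦ c + t⁻¹` (`isSpectralMeasure_map`), hence
`1_{[c, ∞)}(B)` is the positive spectral projection `posProj` of `R` (`exists_inverse_sub_smul`).
The proof compares these projections in the scale of norms `‖|R|⁻ˢ x‖` (`scaleSq`), where only the
abstract operator `R` matters, and transfers the result to the Sobolev spaces.

*The Sobolev norms.* For `|s| < 1` the norm of `L²ₛ` is equivalent to the norm of order `s` in the
scale of `R` (`LocalizingCover.exists_scaleSq_equiv`). At the endpoint `1` this is the elliptic
estimate (`IsFirstOrderElliptic.exists_besselNorm_one_cut_le`), which is obtained by freezing the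
coefficients and an absorption argument; at the endpoint `-1` it follows by duality and from the
fact that `A` is of first order. Both scales are weighted `L²`-scales, one over the spectrum of `R`
and one over the frequencies `ξ`. The intermediate norms are integrals over the `K`-functionals of
the endpoints, so that the estimates at the endpoints interpolate (`scaleSq_le_besselSq`,
`besselSq_le_scaleSq`, `lintegral_rpow_le_of_kFunctional_le`).

*The projections.* Suppose that `‖(B' - B) u‖ ≤ ε ‖(B - c) u‖` for all smooth sections `u`. Then
`A' = (1 + V) A` with `‖V‖ ≤ ε`, and `R - R' = V* R'`. Write `S = sgn R`, `S' = sgn R'`,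
`D = R - R'`, `X = S - S'`. Since `R = S |R|` and `S² = 1`,
`|R| X + X |R'| = D - S D S'`.
Let `W` be the operator with `|R|^{1/2} X = W |R'|^{1/2}`. It solves the Sylvester equation
`|R| W + W |R'| = |R|^{1/2} G |R'|^{1/2}` with an operator `G` of norm at most `2 ε`. The
Corach–Porta–Recht inequality gives `‖W‖ ≤ ‖G‖ / 2 ≤ ε` (`norm_sqrtAbsOp_signOp_sub_le`). This
bounds `X` in the norm of order `-1/2`. Since `X` is self-adjoint, the estimate of order `1/2`
follows by duality, and those in between by interpolation (`scaleSq_posProj_sub_le`).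

*Transfer.* The operator `R` lifts to a bounded map `Θ : L² → L²ₛ` with `Θ (A u) = u` for smooth
`u`, and the operator on `L²ₛ` induced by the projection `P` of `L²` is `u ↦ Θ (P (A u))`. The
estimate for the projections gives that for the induced operators (`norm_induced_sub_le`), and the
elliptic estimate turns closeness of `B'` to `B` in `‖·‖_{1,0}` into the relative bound above.
-/

noncomputable section

namespace SpectralCut

/-! ### Spectral projections of a bounded self-adjoint operator -/

section BoundedSpectralTheorem

variable {H : Type*} [NormedAddCommGroup H] [InnerProductSpace ℂ H] [CompleteSpace H]

theorem norm_sq_apply_of_isSelfAdjoint {T : H →L[ℂ] H} (hT : IsSelfAdjoint T) (x : H) :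
    ‖T x‖ ^ 2 = RCLike.re (inner ℂ x ((T * T) x)) := by
  have h := (ContinuousLinearMap.isSelfAdjoint_iff_isSymmetric.1 hT) x (T x)
  simp only [ContinuousLinearMap.coe_coe] at h
  rw [mul_apply_eq_comp, ← h, inner_self_eq_norm_sq]

variable {R : H →L[ℂ] H} (hR : IsSelfAdjoint R)

theorem isSelfAdjoint_cfcHom (g : C(spectrum ℝ R, ℝ)) : IsSelfAdjoint (cfcHom hR g) :=
  cfcHom_predicate hR g

/-- Riesz–Markov applied to the positive functional `f ↦ ⟨x, f(R) x⟩`. -/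
theorem exists_measure_cfcHom (x : H) : ∃ ν : Measure (spectrum ℝ R), IsFiniteMeasure ν ∧
    ∀ f : C(spectrum ℝ R, ℝ), ∫ t, f t ∂ν = RCLike.re (inner ℂ x (cfcHom hR f x)) := by
  have hcpt : CompactSpace (spectrum ℝ R) := inferInstance
  let L : CompactlySupportedContinuousMap (spectrum ℝ R) ℝ →ₗ[ℝ] ℝ :=
    { toFun := fun f => RCLike.re (inner ℂ x (cfcHom hR f.toContinuousMap x))
      map_add' := fun f g => by
        have : (f + g).toContinuousMap = f.toContinuousMap + g.toContinuousMap := rfl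
        rw [this, map_add, _root_.add_apply, inner_add_right, map_add]
      map_smul' := fun c f => by
        have : (c • f).toContinuousMap = c • f.toContinuousMap := rfl
        rw [this, map_smul, _root_.smul_apply, inner_smul_right_eq_smul]
        simp }
  let Λ : CompactlySupportedContinuousMap (spectrum ℝ R) ℝ →ₚ[ℝ] ℝ := PositiveLinearMap.mk₀ L (by
    intro f hf
    have h1 : 0 ≤ cfcHom hR f.toContinuousMap := (cfcHom_nonneg_iff hR).2 hf
    have h2 := (ContinuousLinearMap.nonneg_iff_isPositive _).1 h1
    exact h2.re_inner_nonneg_right x)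
  have : LocallyCompactSpace (spectrum ℝ R) := inferInstance
  refine ⟨RealRMK.rieszMeasure Λ, ?_, fun f => ?_⟩
  · refine ⟨(isCompact_univ).measure_lt_top⟩
  · exact RealRMK.integral_rieszMeasure Λ
      (CompactlySupportedContinuousMap.continuousMapEquiv f)

/-- The spectral measure of the vector `x` on the spectrum of the bounded self-adjoint operator
`R`. -/
def specMeasure (x : H) : Measure (spectrum ℝ R) := (exists_measure_cfcHom hR x).choose

instance (x : H) : IsFiniteMeasure (specMeasure hR x) := (exists_measure_cfcHom hR x).choose_spec.1

theorem integral_specMeasure (x : H) (f : C(spectrum ℝ R, ℝ)) :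
    ∫ t, f t ∂(specMeasure hR x) = RCLike.re (inner ℂ x (cfcHom hR f x)) :=
  (exists_measure_cfcHom hR x).choose_spec.2 f

theorem norm_sq_cfcHom (x : H) (f : C(spectrum ℝ R, ℝ)) :
    ‖cfcHom hR f x‖ ^ 2 = ∫ t, f t ^ 2 ∂(specMeasure hR x) := by
  rw [norm_sq_apply_of_isSelfAdjoint (isSelfAdjoint_cfcHom hR f), ← map_mul,
    ← integral_specMeasure]
  simp [sq]

theorem norm_cfcHom_sub (x : H) (f g : C(spectrum ℝ R, ℝ)) :
    ‖cfcHom hR f x - cfcHom hR g x‖ =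
      ‖ContinuousMap.toLp (E := ℝ) 2 (specMeasure hR x) ℝ f -
        ContinuousMap.toLp (E := ℝ) 2 (specMeasure hR x) ℝ g‖ := by
  rw [← sq_eq_sq₀ (norm_nonneg _) (norm_nonneg _), ← _root_.sub_apply, ← map_sub,
    norm_sq_cfcHom, ← map_sub, ← real_inner_self_eq_norm_sq, L2.inner_def]
  refine integral_congr_ae ?_
  filter_upwards [ContinuousMap.coeFn_toLp (p := 2) (𝕜 := ℝ) (specMeasure hR x) (f - g)] with t ht
  rw [ht, real_inner_self_eq_norm_sq, Real.norm_eq_abs, sq_abs]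

/-- The isometry `g ↦ g(R) x` from the continuous functions, with the norm of `L²(ν)` for the
spectral measure `ν` of `x`, extends to `L²(ν)`; the vector `y` is the image of `h`. -/
theorem exists_vec_of_Lp (x : H) (h : Lp ℝ 2 (specMeasure hR x)) : ∃ y : H,
    ∀ g : C(spectrum ℝ R, ℝ), ‖cfcHom hR g x - y‖ =
      ‖ContinuousMap.toLp (E := ℝ) 2 (specMeasure hR x) ℝ g - h‖ := by
  have hd := ContinuousMap.toLp_denseRange ℝ (specMeasure hR x) ℝ (p := 2) (by simp)
  obtain ⟨u, hu, hlim⟩ := mem_closure_iff_seq_limit.1 (hd h)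
  choose g hg using hu
  have hc : CauchySeq fun k => cfcHom hR (g k) x := by
    have := hlim.cauchySeq
    rw [Metric.cauchySeq_iff] at this ⊢
    intro ε hε
    obtain ⟨N, hN⟩ := this ε hε
    refine ⟨N, fun m hm n hn => ?_⟩
    rw [dist_eq_norm, norm_cfcHom_sub, hg, hg, ← dist_eq_norm]
    exact hN m hm n hn
  obtain ⟨y, hy⟩ := cauchySeq_tendsto_of_complete hc
  refine ⟨y, fun f => ?_⟩
  refine tendsto_nhds_unique ((tendsto_const_nhds.sub hy).norm) ?_
  simp only [norm_cfcHom_sub, hg]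
  exact (tendsto_const_nhds.sub hlim).norm

/-- The vector `1_S(R) x`, characterized by its distances to the vectors `g(R) x`. -/
theorem exists_projVec (x : H) {S : Set (spectrum ℝ R)} (hS : MeasurableSet S) : ∃ y : H,
    ∀ g : C(spectrum ℝ R, ℝ), ‖cfcHom hR g x - y‖ ^ 2 =
      ∫ t, (g t - S.indicator 1 t) ^ 2 ∂(specMeasure hR x) := by
  obtain ⟨y, hy⟩ := exists_vec_of_Lp hR x
    (indicatorConstLp 2 hS (measure_ne_top (specMeasure hR x) S) (1 : ℝ))
  refine ⟨y, fun g => ?_⟩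
  rw [hy, ← real_inner_self_eq_norm_sq, L2.inner_def]
  refine integral_congr_ae ?_
  filter_upwards [ContinuousMap.coeFn_toLp (p := 2) (𝕜 := ℝ) (specMeasure hR x) g,
    indicatorConstLp_coeFn (p := 2) (hs := hS) (hμs := measure_ne_top (specMeasure hR x) S)
      (c := (1 : ℝ)), Lp.coeFn_sub (ContinuousMap.toLp (E := ℝ) 2 (specMeasure hR x) ℝ g)
      (indicatorConstLp 2 hS (measure_ne_top (specMeasure hR x) S) (1 : ℝ))] with t h1 h2 h3
  rw [h3, Pi.sub_apply, h1, h2, real_inner_self_eq_norm_sq, Real.norm_eq_abs, sq_abs]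
  rfl

theorem exists_continuous_approx {X : Type*} [TopologicalSpace X] [CompactSpace X]
    [TopologicalSpace.MetrizableSpace X] [MeasurableSpace X] [BorelSpace X] (ν : Measure X)
    [IsFiniteMeasure ν] {S : Set X} (hS : MeasurableSet S) {ε : ℝ} (hε : 0 < ε) :
    ∃ g : C(X, ℝ), ∫ t, (g t - S.indicator 1 t) ^ 2 ∂ν ≤ ε := by
  let := TopologicalSpace.metrizableSpaceMetric X
  have hm : MemLp (S.indicator (1 : X → ℝ)) (ENNReal.ofReal 2) ν :=
    (memLp_indicator_const _ hS (1 : ℝ) (Or.inr (measure_ne_top ν S)))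
  obtain ⟨g, hg, -⟩ := hm.exists_boundedContinuous_integral_rpow_sub_le (by norm_num) hε
  refine ⟨g.toContinuousMap, le_trans (le_of_eq ?_) hg⟩
  refine integral_congr_ae (.of_forall fun t => ?_)
  simp only [Real.rpow_two, Real.norm_eq_abs, sq_abs]
  change (g t - _) ^ 2 = _
  ring

theorem integrable_sub_indicator_sq {X : Type*} [TopologicalSpace X] [CompactSpace X]
    [MeasurableSpace X] [BorelSpace X] (ν : Measure X)
    [IsFiniteMeasure ν] {S : Set X} (hS : MeasurableSet S) (g : C(X, ℝ)) :
    Integrable (fun t => (g t - S.indicator 1 t) ^ 2) ν := by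
  have h1 : MemLp (S.indicator (1 : X → ℝ)) 2 ν :=
    (memLp_indicator_const _ hS (1 : ℝ) (Or.inr (measure_ne_top ν S)))
  have h2 : MemLp g 2 ν := MemLp.of_bound g.continuous.aestronglyMeasurable ‖g‖
    (.of_forall fun t => g.norm_coe_le_norm t)
  exact (h2.sub h1).integrable_sq

/-- The vector `1_S(R) x`. -/
def projVec (S : Set (spectrum ℝ R)) (x : H) : H :=
  open Classical in
  if hS : MeasurableSet S then (exists_projVec hR x hS).choose else 0

theorem norm_sq_sub_projVec {S : Set (spectrum ℝ R)} (hS : MeasurableSet S) (x : H)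
    (g : C(spectrum ℝ R, ℝ)) : ‖cfcHom hR g x - projVec hR S x‖ ^ 2 =
      ∫ t, (g t - S.indicator 1 t) ^ 2 ∂(specMeasure hR x) := by
  rw [projVec, dif_pos hS]
  exact (exists_projVec hR x hS).choose_spec g

/-- Continuous functions `g_k` of `R` that converge to `1_S(R)` on finitely many vectors
simultaneously. -/
theorem exists_tendsto_projVec {S : Set (spectrum ℝ R)} (hS : MeasurableSet S) (T : Finset H) :
    ∃ g : ℕ → C(spectrum ℝ R, ℝ), ∀ x ∈ T,
      Tendsto (fun k => cfcHom hR (g k) x) atTop (𝓝 (projVec hR S x)) := by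
  classical
  have h : ∀ k : ℕ, ∃ g : C(spectrum ℝ R, ℝ), ∀ x ∈ T,
      ‖cfcHom hR g x - projVec hR S x‖ ^ 2 ≤ 1 / ((k : ℝ) + 1) := by
    intro k
    obtain ⟨g, hg⟩ := exists_continuous_approx (∑ x ∈ T, specMeasure hR x) hS
      (ε := 1 / ((k : ℝ) + 1)) (by positivity)
    refine ⟨g, fun x hx => ?_⟩
    rw [norm_sq_sub_projVec hR hS]
    refine le_trans ?_ hg
    refine integral_mono_measure ?_ (.of_forall fun _ => sq_nonneg _)
      (integrable_sub_indicator_sq _ hS g)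
    rw [← Finset.add_sum_erase T _ hx]
    exact Measure.le_add_right le_rfl
  choose g hg using h
  refine ⟨g, fun x hx => ?_⟩
  rw [tendsto_iff_norm_sub_tendsto_zero]
  have h0 : Tendsto (fun k => ‖cfcHom hR (g k) x - projVec hR S x‖ ^ 2) atTop (𝓝 0) :=
    squeeze_zero (fun _ => sq_nonneg _) (fun k => hg k x hx)
      tendsto_one_div_add_atTop_nhds_zero_nat
  have := h0.sqrt
  simpa using this

theorem norm_projVec_sq {S : Set (spectrum ℝ R)} (hS : MeasurableSet S) (x : H) :
    ‖projVec hR S x‖ ^ 2 = (specMeasure hR x).real S := by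
  have h := norm_sq_sub_projVec hR hS x 0
  simp only [map_zero, _root_.zero_apply, zero_sub, norm_neg,
    ContinuousMap.zero_apply] at h
  rw [h, ← integral_indicator_one hS]
  refine integral_congr_ae (.of_forall fun t => ?_)
  by_cases ht : t ∈ S <;> simp [ht]

theorem specMeasure_univ (x : H) : (specMeasure hR x).real univ = ‖x‖ ^ 2 := by
  have h := integral_specMeasure hR x 1
  rw [map_one] at h
  rw [one_apply_eq_self, inner_self_eq_norm_sq] at h
  rw [← h]
  simp

/-- The spectral projection `1_S(R)` of a bounded self-adjoint operator. -/
def boundedProj (S : Set (spectrum ℝ R)) : H →L[ℂ] H :=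
  open Classical in
  if hS : MeasurableSet S then
  LinearMap.mkContinuous
    { toFun := projVec hR S
      map_add' := fun x y => by
        classical obtain ⟨g, hg⟩ := exists_tendsto_projVec hR hS {x, y, x + y}
        refine tendsto_nhds_unique (hg (x + y) (by simp)) ?_
        simpa only [map_add] using (hg x (by simp)).add (hg y (by simp))
      map_smul' := fun c x => by
        classical obtain ⟨g, hg⟩ := exists_tendsto_projVec hR hS {x, c • x}
        refine tendsto_nhds_unique (hg (c • x) (by simp)) ?_
        simpa only [map_smul, RingHom.id_apply] using (hg x (by simp)).const_smul c } 1
    (fun x => by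
      rw [one_mul]
      refine le_of_sq_le_sq ?_ (norm_nonneg x)
      change ‖projVec hR S x‖ ^ 2 ≤ _
      rw [norm_projVec_sq hR hS, ← specMeasure_univ hR]
      exact measureReal_mono (subset_univ _))
  else 0

theorem boundedProj_apply {S : Set (spectrum ℝ R)} (hS : MeasurableSet S) (x : H) :
    boundedProj hR S x = projVec hR S x := by
  rw [boundedProj, dif_pos hS]
  rfl

theorem boundedProj_isSelfAdjoint {S : Set (spectrum ℝ R)} (hS : MeasurableSet S) :
    IsSelfAdjoint (boundedProj hR S) := by
  rw [ContinuousLinearMap.isSelfAdjoint_iff_isSymmetric]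
  intro x y
  classical obtain ⟨g, hg⟩ := exists_tendsto_projVec hR hS {x, y}
  simp only [ContinuousLinearMap.coe_coe, boundedProj_apply hR hS]
  refine tendsto_nhds_unique ((hg x (by simp)).inner tendsto_const_nhds) ?_
  have : (fun k => inner ℂ (cfcHom hR (g k) x) y) = fun k => inner ℂ x (cfcHom hR (g k) y) := by
    funext k
    exact (ContinuousLinearMap.isSelfAdjoint_iff_isSymmetric.1 (isSelfAdjoint_cfcHom hR (g k))) x y
  rw [this]
  exact tendsto_const_nhds.inner (hg y (by simp))

theorem re_inner_boundedProj {S : Set (spectrum ℝ R)} (hS : MeasurableSet S) (x : H) :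
    RCLike.re (inner ℂ x (boundedProj hR S x)) = (specMeasure hR x).real S := by
  classical obtain ⟨g, hg⟩ := exists_tendsto_projVec hR hS {x}
  have h2 := norm_projVec_sq hR hS x
  -- compare with `re ⟨x, y⟩ = (‖x‖² + ‖y‖² - ‖x - y‖²) / 2`
  have h := norm_sq_sub_projVec hR hS x 1
  rw [map_one, one_apply_eq_self, @norm_sub_sq ℂ] at h
  have h3 : ∫ t, ((1 : C(spectrum ℝ R, ℝ)) t - S.indicator 1 t) ^ 2 ∂(specMeasure hR x)
      = (specMeasure hR x).real univ - (specMeasure hR x).real S := by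
    rw [← measureReal_compl hS, ← integral_indicator_one hS.compl]
    refine integral_congr_ae (.of_forall fun t => ?_)
    by_cases ht : t ∈ S <;> simp [ht]
  rw [h3, h2, specMeasure_univ] at h
  rw [boundedProj_apply hR hS]
  linarith

theorem boundedProj_isStarProjection {S : Set (spectrum ℝ R)} (hS : MeasurableSet S) :
    IsStarProjection (boundedProj hR S) := by
  refine ⟨?_, boundedProj_isSelfAdjoint hR hS⟩
  have hsa := boundedProj_isSelfAdjoint hR hS
  have hsym := ContinuousLinearMap.isSelfAdjoint_iff_isSymmetric.1 hsa
  have key : boundedProj hR S * boundedProj hR S - boundedProj hR S = 0 := by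
    have hs : IsSelfAdjoint (boundedProj hR S * boundedProj hR S - boundedProj hR S) := by
      refine IsSelfAdjoint.sub ?_ hsa
      simpa only [sq] using hsa.pow 2
    rw [← ContinuousLinearMap.coe_inj, ContinuousLinearMap.toLinearMap_zero,
      ← (ContinuousLinearMap.isSelfAdjoint_iff_isSymmetric.1 hs).inner_map_self_eq_zero]
    intro x
    have h1 : RCLike.re (inner ℂ ((boundedProj hR S * boundedProj hR S - boundedProj hR S) x) x)
        = 0 := by
      rw [← inner_conj_symm, RCLike.conj_re, _root_.sub_apply, inner_sub_right,
        map_sub, ← norm_sq_apply_of_isSelfAdjoint hsa, re_inner_boundedProj hR hS,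
        boundedProj_apply hR hS, norm_projVec_sq hR hS, sub_self]
    have h2 := (ContinuousLinearMap.isSelfAdjoint_iff_isSymmetric.1 hs).coe_re_inner_apply_self x
    rw [ContinuousLinearMap.coe_coe] at h2 ⊢
    rw [← h2]
    exact_mod_cast congrArg _ h1
  exact sub_eq_zero.1 key

theorem commute_boundedProj {S : Set (spectrum ℝ R)} {T : H →L[ℂ] H} (hT : Commute T R) :
    Commute T (boundedProj hR S) := by
  by_cases hS : MeasurableSet S
  swap
  · rw [boundedProj, dif_neg hS]
    exact Commute.zero_right _
  have hc : ∀ g : C(spectrum ℝ R, ℝ), Commute T (cfcHom hR g) := by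
    intro g
    rw [cfcHom_eq_cfc_extend 0 hR]
    exact (hT.symm.cfc_real _).symm
  ext x
  classical obtain ⟨g, hg⟩ := exists_tendsto_projVec hR hS {x, T x}
  simp only [mul_apply_eq_comp, boundedProj_apply hR hS]
  refine tendsto_nhds_unique ((T.continuous.tendsto _).comp (hg x (by simp))) ?_
  refine (hg (T x) (by simp)).congr fun k => ?_
  exact (congrArg (fun L : H →L[ℂ] H => L x) (hc (g k)).eq).symm

end BoundedSpectralTheorem

/-! ### Projection-valued measures -/

namespace ProjectionValuedMeasure

variable {H : Type*} [NormedAddCommGroup H] [InnerProductSpace ℂ H] [CompleteSpace H]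
variable (P : ProjectionValuedMeasure H)

theorem scalarMeasure_apply {S : Set ℝ} (hS : MeasurableSet S) (x : H) :
    P.scalarMeasure x S = ENNReal.ofReal (‖P.proj S x‖ ^ 2) :=
  Measure.ofMeasurable_apply S hS

theorem scalarMeasure_univ (x : H) : P.scalarMeasure x univ = ENNReal.ofReal (‖x‖ ^ 2) := by
  rw [P.scalarMeasure_apply MeasurableSet.univ, P.proj_univ, one_apply_eq_self]

instance (x : H) : IsFiniteMeasure (P.scalarMeasure x) :=
  ⟨by rw [P.scalarMeasure_univ]; exact ENNReal.ofReal_lt_top⟩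

theorem scalarMeasure_real {S : Set ℝ} (hS : MeasurableSet S) (x : H) :
    (P.scalarMeasure x).real S = ‖P.proj S x‖ ^ 2 := by
  rw [Measure.real, P.scalarMeasure_apply hS, ENNReal.toReal_ofReal (by positivity)]

theorem proj_proj_self {S : Set ℝ} (hS : MeasurableSet S) (x : H) :
    P.proj S (P.proj S x) = P.proj S x := by
  simpa using congrArg (fun T : H →L[ℂ] H => T x) (P.isStarProjection S hS).isIdempotentElem

theorem proj_union {S T : Set ℝ} (hS : MeasurableSet S) (hT : MeasurableSet T)
    (hd : Disjoint S T) (x : H) : P.proj (S ∪ T) x = P.proj S x + P.proj T x := by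
  have h := P.hasSum_iUnion (fun i => if i = 0 then S else if i = 1 then T else ∅)
    (fun i => by split_ifs <;> simp [hS, hT])
    (fun i j hij => by
      simp only [Function.onFun]
      split_ifs <;> simp_all [disjoint_comm]) x
  have hU : (⋃ i : ℕ, if i = 0 then S else if i = 1 then T else ∅) = S ∪ T := by
    ext t
    simp only [mem_iUnion, mem_union]
    constructor
    · rintro ⟨i, hi⟩
      split_ifs at hi <;> simp_all
    · rintro (h | h)
      · exact ⟨0, by simpa using h⟩
      · exact ⟨1, by simpa using h⟩
  rw [hU] at h
  refine h.unique ?_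
  have h2 := hasSum_sum_of_ne_finset_zero (L := .unconditional ℕ) (f := fun i : ℕ => P.proj
    (if i = 0 then S else if i = 1 then T else ∅) x) (s := {0, 1}) (fun b hb => by
      simp only [Finset.mem_insert, Finset.mem_singleton, not_or] at hb
      simp only [if_neg hb.1, if_neg hb.2, P.proj_empty])
  simpa using h2

theorem proj_proj_of_disjoint {S T : Set ℝ} (hS : MeasurableSet S) (hT : MeasurableSet T)
    (hd : Disjoint S T) (x : H) : P.proj S (P.proj T x) = 0 := by
  -- `‖P(S) y‖² + ‖P(T) y‖² = ‖P(S ∪ T) y‖² ≤ ‖y‖²` for `y = P(T) x`, where `P(T) y = y`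
  set y := P.proj T x with hy
  have h1 : P.scalarMeasure y (S ∪ T) = P.scalarMeasure y S + P.scalarMeasure y T :=
    measure_union hd hT
  have h2 : P.scalarMeasure y (S ∪ T) ≤ P.scalarMeasure y univ := measure_mono (subset_univ _)
  have h3 : P.scalarMeasure y T = P.scalarMeasure y univ := by
    rw [P.scalarMeasure_univ, P.scalarMeasure_apply hT, hy, P.proj_proj_self hT]
  rw [h1, h3] at h2
  have h4 : P.scalarMeasure y S = 0 := by
    have hf := measure_ne_top (P.scalarMeasure y) univ
    have : P.scalarMeasure y S + P.scalarMeasure y univ ≤ 0 + P.scalarMeasure y univ := by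
      simpa using h2
    exact le_antisymm ((ENNReal.add_le_add_iff_right hf).1 this) bot_le
  rw [P.scalarMeasure_apply hS, ENNReal.ofReal_eq_zero] at h4
  exact norm_eq_zero.1 (pow_eq_zero_iff two_ne_zero |>.1 (le_antisymm h4 (sq_nonneg _)))

theorem proj_proj {S T : Set ℝ} (hS : MeasurableSet S) (hT : MeasurableSet T) (x : H) :
    P.proj S (P.proj T x) = P.proj (S ∩ T) x := by
  have h1 := P.proj_union (hT.inter hS) (hT.diff hS) disjoint_inf_sdiff x
  have h2 := P.proj_union (hS.inter hT) (hS.diff hT) disjoint_inf_sdiff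
    (P.proj (T ∩ S) x)
  rw [inter_union_sdiff] at h1 h2
  rw [h1, map_add, P.proj_proj_of_disjoint hS (hT.diff hS) disjoint_sdiff_right, add_zero, h2,
    P.proj_proj_of_disjoint (hS.diff hT) (hT.inter hS)
      (disjoint_sdiff_left.mono_right inter_subset_left), add_zero, inter_comm T S,
    P.proj_proj_self (hS.inter hT)]

theorem scalarMeasure_proj {S : Set ℝ} (hS : MeasurableSet S) (x : H) :
    P.scalarMeasure (P.proj S x) = (P.scalarMeasure x).restrict S := by
  ext T hT
  rw [Measure.restrict_apply hT, P.scalarMeasure_apply hT, P.scalarMeasure_apply (hT.inter hS),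
    P.proj_proj hT hS]

theorem scalarMeasure_add_le (x y : H) :
    P.scalarMeasure (x + y) ≤ (2 : ℝ≥0∞) • (P.scalarMeasure x + P.scalarMeasure y) := by
  refine Measure.le_iff.2 fun S hS => ?_
  rw [Measure.smul_apply, Measure.add_apply, P.scalarMeasure_apply hS, P.scalarMeasure_apply hS,
    P.scalarMeasure_apply hS, ← ENNReal.ofReal_add (by positivity) (by positivity), smul_eq_mul,
    ← ENNReal.ofReal_ofNat, ← ENNReal.ofReal_mul (by norm_num), map_add]
  refine ENNReal.ofReal_le_ofReal ?_
  have := norm_add_le (P.proj S x) (P.proj S y)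
  have h := norm_nonneg (P.proj S x + P.proj S y)
  nlinarith [sq_nonneg (‖P.proj S x‖ - ‖P.proj S y‖)]

/-- The image of a projection-valued measure under a measurable function `φ`: the spectral measure
of `φ(T)` if `P` is that of `T`. -/
def map (φ : ℝ → ℝ) (hφ : Measurable φ) : ProjectionValuedMeasure H where
  proj S := P.proj (φ ⁻¹' S)
  isStarProjection S hS := P.isStarProjection _ (hφ hS)
  proj_univ := P.proj_univ
  hasSum_iUnion S hS hd x := by
    rw [preimage_iUnion]
    exact P.hasSum_iUnion _ (fun i => hφ (hS i)) (fun i j hij => (hd hij).preimage φ) x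

theorem scalarMeasure_map (φ : ℝ → ℝ) (hφ : Measurable φ) (x : H) :
    (P.map φ hφ).scalarMeasure x = (P.scalarMeasure x).map φ := by
  ext S hS
  rw [Measure.map_apply hφ hS, scalarMeasure_apply _ hS, P.scalarMeasure_apply (hφ hS)]
  rfl

end ProjectionValuedMeasure

section BoundedSpectralTheorem

variable {H : Type*} [NormedAddCommGroup H] [InnerProductSpace ℂ H] [CompleteSpace H]
variable {R : H →L[ℂ] H} (hR : IsSelfAdjoint R)

theorem projVec_union {S T : Set (spectrum ℝ R)} (hS : MeasurableSet S) (hT : MeasurableSet T)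
    (hd : Disjoint S T) (x : H) : projVec hR (S ∪ T) x = projVec hR S x + projVec hR T x := by
  have key : ∀ ε : ℝ, 0 < ε → ‖projVec hR (S ∪ T) x - (projVec hR S x + projVec hR T x)‖ ^ 2
      ≤ 18 * ε := by
    intro ε hε
    obtain ⟨g, hg⟩ := exists_continuous_approx (specMeasure hR x) hS hε
    obtain ⟨h, hh⟩ := exists_continuous_approx (specMeasure hR x) hT hε
    have e1 := norm_sq_sub_projVec hR hS x g
    have e2 := norm_sq_sub_projVec hR hT x h
    have e3 := norm_sq_sub_projVec hR (hS.union hT) x (g + h)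
    have i1 := integrable_sub_indicator_sq (specMeasure hR x) hS g
    have i2 := integrable_sub_indicator_sq (specMeasure hR x) hT h
    have e4 : ∫ t, ((g + h) t - (S ∪ T).indicator 1 t) ^ 2 ∂(specMeasure hR x) ≤
        2 * ε + 2 * ε := by
      calc _ ≤ ∫ t, (2 * (g t - S.indicator 1 t) ^ 2 + 2 * (h t - T.indicator 1 t) ^ 2)
            ∂(specMeasure hR x) := by
            refine integral_mono (integrable_sub_indicator_sq _ (hS.union hT) _)
              ((i1.const_mul 2).add (i2.const_mul 2)) fun t => ?_
            simp only [indicator_union_of_disjoint hd, ContinuousMap.add_apply]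
            nlinarith [sq_nonneg ((g t - S.indicator 1 t) - (h t - T.indicator 1 t))]
        _ = _ := by
            rw [integral_add (i1.const_mul 2) (i2.const_mul 2), integral_const_mul,
              integral_const_mul]
        _ ≤ _ := by gcongr
    have tri : ‖projVec hR (S ∪ T) x - (projVec hR S x + projVec hR T x)‖ ≤
        ‖cfcHom hR (g + h) x - projVec hR (S ∪ T) x‖ + (‖cfcHom hR g x - projVec hR S x‖ +
          ‖cfcHom hR h x - projVec hR T x‖) := by
      have : projVec hR (S ∪ T) x - (projVec hR S x + projVec hR T x) =
          -(cfcHom hR (g + h) x - projVec hR (S ∪ T) x) + ((cfcHom hR g x - projVec hR S x) +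
          (cfcHom hR h x - projVec hR T x)) := by
        rw [map_add, _root_.add_apply]; abel
      rw [this]
      refine (norm_add_le _ _).trans ?_
      rw [norm_neg]
      gcongr
      exact norm_add_le _ _
    set a := ‖cfcHom hR (g + h) x - projVec hR (S ∪ T) x‖
    set b := ‖cfcHom hR g x - projVec hR S x‖
    set c := ‖cfcHom hR h x - projVec hR T x‖
    have h5 := pow_le_pow_left₀ (norm_nonneg _) tri 2
    have h6 : (a + (b + c)) ^ 2 ≤ 3 * (a ^ 2 + b ^ 2 + c ^ 2) := by
      linarith [sq_nonneg (b - c), sq_nonneg (a - b), sq_nonneg (a - c)]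
    linarith
  have h0 : ‖projVec hR (S ∪ T) x - (projVec hR S x + projVec hR T x)‖ ^ 2 ≤ 0 := by
    refine le_of_forall_pos_le_add fun ε hε => ?_
    have := key (ε / 18) (by positivity)
    linarith
  exact sub_eq_zero.1 (norm_eq_zero.1 (pow_eq_zero_iff two_ne_zero |>.1
    (le_antisymm h0 (sq_nonneg _))))

theorem hasSum_projVec (S : ℕ → Set (spectrum ℝ R)) (hS : ∀ i, MeasurableSet (S i))
    (hd : Pairwise (Function.onFun Disjoint S)) (x : H) :
    HasSum (fun i => projVec hR (S i) x) (projVec hR (⋃ i, S i) x) := by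
  classical
  have h0 : ∀ F : Finset ℕ, projVec hR (⋃ i ∈ F, S i) x = ∑ i ∈ F, projVec hR (S i) x := by
    intro F
    induction F using Finset.induction_on with
    | empty =>
      have := norm_projVec_sq hR MeasurableSet.empty x
      simp only [measureReal_empty] at this
      simpa using this
    | insert a F ha ih =>
      rw [Finset.set_biUnion_insert, projVec_union hR (hS a)
        (F.measurableSet_biUnion fun i _ => hS i), ih, Finset.sum_insert ha]
      rw [disjoint_iUnion₂_right]
      exact fun i hi => hd (fun h => ha (h ▸ hi))
  have hm : ∀ F : Finset ℕ, ‖∑ i ∈ F, projVec hR (S i) x - projVec hR (⋃ i, S i) x‖ ^ 2 =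
      (specMeasure hR x).real (⋃ i, S i) - ∑ i ∈ F, (specMeasure hR x).real (S i) := by
    intro F
    have hF : MeasurableSet (⋃ i ∈ F, S i) := F.measurableSet_biUnion fun i _ => hS i
    have hsub : (⋃ i ∈ F, S i) ⊆ ⋃ i, S i := iUnion₂_subset_iUnion _ _
    have hU := MeasurableSet.iUnion hS
    have e := projVec_union hR hF (hU.diff hF) disjoint_sdiff_right x
    rw [union_sdiff_cancel hsub, h0] at e
    rw [e, sub_add_cancel_left, norm_neg, norm_projVec_sq hR (hU.diff hF),
      measureReal_sdiff hsub hF, measureReal_biUnion_finset (fun i _ j _ hij => hd hij)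
        (fun i _ => hS i)]
  have hs : HasSum (fun i => (specMeasure hR x).real (S i))
      ((specMeasure hR x).real (⋃ i, S i)) := by
    have h1 := measure_iUnion (μ := specMeasure hR x) hd hS
    have h2 : (∑' i, specMeasure hR x (S i)) ≠ ⊤ := h1 ▸ measure_ne_top _ _
    rw [Measure.real, h1, ENNReal.tsum_toReal_eq (fun i => measure_ne_top _ _)]
    exact (ENNReal.summable_toReal h2).hasSum
  rw [HasSum, SummationFilter.unconditional_filter] at hs ⊢
  rw [tendsto_iff_norm_sub_tendsto_zero]
  have h3 : Tendsto (fun F : Finset ℕ =>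
      ‖∑ i ∈ F, projVec hR (S i) x - projVec hR (⋃ i, S i) x‖ ^ 2) atTop (𝓝 0) := by
    simp only [hm]
    have := (tendsto_const_nhds (x := (specMeasure hR x).real (⋃ i, S i))).sub hs
    simpa using this
  simpa using h3.sqrt

/-- The projection-valued measure of a bounded self-adjoint operator. -/
def spectralPVM : ProjectionValuedMeasure H where
  proj S := boundedProj hR (Subtype.val ⁻¹' S)
  isStarProjection S hS := boundedProj_isStarProjection hR (measurable_subtype_coe hS)
  proj_univ := by
    ext x
    have h := norm_sq_sub_projVec hR MeasurableSet.univ x 1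
    have h1 : (univ : Set (spectrum ℝ R)).indicator (1 : spectrum ℝ R → ℝ) = 1 := indicator_univ 1
    rw [map_one, one_apply_eq_self, h1] at h
    simp only [ContinuousMap.one_apply, Pi.one_apply, sub_self] at h
    rw [preimage_univ, boundedProj_apply hR MeasurableSet.univ, one_apply_eq_self]
    refine (sub_eq_zero.1 (norm_eq_zero.1 (pow_eq_zero_iff two_ne_zero |>.1 (h.trans ?_)))).symm
    simp
  hasSum_iUnion S hS hd x := by
    rw [preimage_iUnion]
    have h := hasSum_projVec hR (fun i => (Subtype.val ⁻¹' S i : Set (spectrum ℝ R)))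
      (fun i => measurable_subtype_coe (hS i)) (fun i j hij => (hd hij).preimage _) x
    have e : ∀ i, boundedProj hR (Subtype.val ⁻¹' S i) x =
        projVec hR (Subtype.val ⁻¹' S i) x :=
      fun i => boundedProj_apply hR (measurable_subtype_coe (hS i)) x
    simp only [e]
    rw [boundedProj_apply hR (MeasurableSet.iUnion fun i => measurable_subtype_coe (hS i))]
    exact h

theorem scalarMeasure_spectralPVM (x : H) :
    (spectralPVM hR).scalarMeasure x = (specMeasure hR x).map Subtype.val := by
  ext S hS
  have hS' : MeasurableSet (Subtype.val ⁻¹' S : Set (spectrum ℝ R)) := measurable_subtype_coe hS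
  rw [Measure.map_apply measurable_subtype_coe hS, ProjectionValuedMeasure.scalarMeasure_apply _ hS]
  change ENNReal.ofReal (‖boundedProj hR _ x‖ ^ 2) = _
  rw [boundedProj_apply hR hS', norm_projVec_sq hR hS', ofReal_measureReal]

theorem commute_spectralPVM {T : H →L[ℂ] H} (hT : Commute T R) (S : Set ℝ) :
    Commute T ((spectralPVM hR).proj S) :=
  commute_boundedProj hR hT

theorem re_inner_cfc {f : ℝ → ℝ} (hf : Continuous f) (x : H) :
    RCLike.re (inner ℂ x (cfc f R x)) = ∫ t, f t ∂((spectralPVM hR).scalarMeasure x) := by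
  rw [scalarMeasure_spectralPVM, integral_map measurable_subtype_coe.aemeasurable
    hf.aestronglyMeasurable, cfc_apply f R hR hf.continuousOn, ← integral_specMeasure]
  rfl

theorem lintegral_scalarMeasure_sq {f : ℝ → ℝ} (hf : Continuous f) (x : H) :
    ENNReal.ofReal (‖cfc f R x‖ ^ 2) =
      ∫⁻ t, ENNReal.ofReal (f t ^ 2) ∂((spectralPVM hR).scalarMeasure x) := by
  rw [scalarMeasure_spectralPVM, lintegral_map (by fun_prop) measurable_subtype_coe,
    cfc_apply f R hR hf.continuousOn, norm_sq_cfcHom, ofReal_integral_eq_lintegral_ofReal]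
  · rfl
  · set g : C(spectrum ℝ R, ℝ) := ⟨_, hf.continuousOn.domRestrict⟩
    exact (MemLp.of_bound g.continuous.aestronglyMeasurable ‖g‖
      (.of_forall fun t => g.norm_coe_le_norm t)).integrable_sq
  · exact .of_forall fun _ => sq_nonneg _

theorem scalarMeasure_cfc {f : ℝ → ℝ} (hf : Continuous f) (x : H) :
    (spectralPVM hR).scalarMeasure (cfc f R x) =
      ((spectralPVM hR).scalarMeasure x).withDensity fun t => ENNReal.ofReal (f t ^ 2) := by
  ext S hS
  have hc : Commute (cfc f R) ((spectralPVM hR).proj S) :=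
    commute_spectralPVM hR ((Commute.refl R).cfc_real f) S
  have h := congrArg (fun L : H →L[ℂ] H => L x) hc.eq
  simp only [mul_apply_eq_comp] at h
  rw [withDensity_apply _ hS, ProjectionValuedMeasure.scalarMeasure_apply _ hS, ← h,
    lintegral_scalarMeasure_sq hR hf, ProjectionValuedMeasure.scalarMeasure_proj _ hS]

end BoundedSpectralTheorem

/-! ### Self-adjoint operators with a bounded inverse -/

section Resolvent

variable {H : Type*} [NormedAddCommGroup H] [InnerProductSpace ℂ H] [CompleteSpace H]
variable {R : H →L[ℂ] H} (hR : IsSelfAdjoint R)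

theorem scalarMeasure_apply_self (z : H) :
    (spectralPVM hR).scalarMeasure (R z) =
      ((spectralPVM hR).scalarMeasure z).withDensity fun t => ENNReal.ofReal (t ^ 2) := by
  have := scalarMeasure_cfc hR continuous_id z
  rwa [cfc_id ℝ R] at this

theorem scalarMeasure_singleton_zero (hinj : Function.Injective R) (x : H) :
    (spectralPVM hR).scalarMeasure x {0} = 0 := by
  rw [ProjectionValuedMeasure.scalarMeasure_apply _ (measurableSet_singleton 0)]
  have h : R ((spectralPVM hR).proj {0} x) = 0 := by
    have h1 := (spectralPVM hR).scalarMeasure_univ (R ((spectralPVM hR).proj {0} x))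
    rw [scalarMeasure_apply_self, withDensity_apply _ MeasurableSet.univ, Measure.restrict_univ,
      ProjectionValuedMeasure.scalarMeasure_proj _ (measurableSet_singleton 0),
      Measure.restrict_singleton, lintegral_smul_measure, lintegral_dirac] at h1
    have h2 : ENNReal.ofReal (‖R ((spectralPVM hR).proj {0} x)‖ ^ 2) = 0 := by
      rw [← h1]
      simp
    have h3 := le_antisymm (ENNReal.ofReal_eq_zero.1 h2) (sq_nonneg _)
    exact norm_eq_zero.1 (pow_eq_zero_iff two_ne_zero |>.1 h3)
  rw [hinj (h.trans (map_zero R).symm)]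
  simp

theorem ae_ne_zero (hinj : Function.Injective R) (x : H) :
    ∀ᵐ t ∂((spectralPVM hR).scalarMeasure x), t ≠ 0 := by
  rw [ae_iff]
  simpa using scalarMeasure_singleton_zero hR hinj x

/-- A vector with `∫ t⁻² d⟨x, P x⟩ < ∞` is in the range of `R`. -/
theorem exists_eq_apply_of_lintegral_lt_top (hinj : Function.Injective R) (x : H)
    (hx : ∫⁻ t, ENNReal.ofReal (t⁻¹ ^ 2) ∂((spectralPVM hR).scalarMeasure x) < ⊤) :
    ∃ z, R z = x := by
  set ν := (spectralPVM hR).scalarMeasure x with hν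
  -- regularized inverses `t / (t² + 1/(k+1))`
  set e : ℕ → ℝ := fun k => 1 / ((k : ℝ) + 1) with he
  have hepos : ∀ k, 0 < e k := fun k => by positivity
  have het : Tendsto e atTop (𝓝 0) := tendsto_one_div_add_atTop_nhds_zero_nat
  set g : ℕ → ℝ → ℝ := fun k t => t / (t ^ 2 + e k) with hg
  have hgc : ∀ k, Continuous (g k) := fun k => by
    refine Continuous.div continuous_id (by fun_prop) fun t => ?_
    have := hepos k
    positivity
  have hden : ∀ k t, 0 < t ^ 2 + e k := fun k t => by
    have := hepos k
    positivity
  have h1 : ∀ k t, (g k t - t⁻¹) ^ 2 ≤ t⁻¹ ^ 2 := by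
    intro k t
    rcases eq_or_ne t 0 with rfl | ht
    · simp [hg]
    have e1 : g k t - t⁻¹ = -(e k / (t ^ 2 + e k)) * t⁻¹ := by
      have := (hden k t).ne'
      simp only [hg]
      field_simp
      ring
    rw [e1, mul_pow, neg_sq]
    refine mul_le_of_le_one_left (sq_nonneg _) ?_
    have h0 : 0 ≤ e k / (t ^ 2 + e k) := div_nonneg (hepos k).le (hden k t).le
    have h2 : e k / (t ^ 2 + e k) ≤ 1 := by
      rw [div_le_one (hden k t)]
      nlinarith [sq_nonneg t]
    exact pow_le_one₀ h0 h2
  have h2 : ∀ t, Tendsto (fun k => g k t) atTop (𝓝 t⁻¹) := by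
    intro t
    rcases eq_or_ne t 0 with rfl | ht
    · simp [hg]
    have : t⁻¹ = t / (t ^ 2 + 0) := by field_simp; ring
    rw [this]
    exact tendsto_const_nhds.div (tendsto_const_nhds.add het) (by positivity)
  have h3 : Tendsto (fun k => ∫⁻ t, ENNReal.ofReal ((g k t - t⁻¹) ^ 2) ∂ν) atTop (𝓝 0) := by
    have := tendsto_lintegral_of_dominated_convergence (μ := ν)
      (F := fun k t => ENNReal.ofReal ((g k t - t⁻¹) ^ 2)) (f := fun _ => 0)
      (fun t => ENNReal.ofReal (t⁻¹ ^ 2))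
      (fun k => by
        have := (hgc k).measurable
        fun_prop) (fun k => .of_forall fun t => ENNReal.ofReal_le_ofReal (h1 k t)) hx.ne
      (.of_forall fun t => by
        have h4 := ((h2 t).sub_const t⁻¹).pow 2
        have := (ENNReal.continuous_ofReal.tendsto _).comp h4
        simpa [Function.comp_def] using this)
    simpa using this
  have h4 : ∀ k l, ENNReal.ofReal (‖cfc (g k) R x - cfc (g l) R x‖ ^ 2) ≤
      2 * (∫⁻ t, ENNReal.ofReal ((g k t - t⁻¹) ^ 2) ∂ν +
        ∫⁻ t, ENNReal.ofReal ((g l t - t⁻¹) ^ 2) ∂ν) := by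
    intro k l
    rw [← _root_.sub_apply, ← cfc_sub (g k) (g l) R ((hgc k).continuousOn) ((hgc l).continuousOn),
      lintegral_scalarMeasure_sq hR (f := fun t => g k t - g l t) ((hgc k).sub (hgc l)),
      ← lintegral_add_left (by
        have := (hgc k).measurable
        fun_prop), ← lintegral_const_mul _ (by
        have := (hgc k).measurable
        have := (hgc l).measurable
        fun_prop)]
    refine lintegral_mono fun t => ?_
    rw [← ENNReal.ofReal_add (sq_nonneg _) (sq_nonneg _), ← ENNReal.ofReal_ofNat,
      ← ENNReal.ofReal_mul (by norm_num)]
    refine ENNReal.ofReal_le_ofReal ?_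
    nlinarith [sq_nonneg ((g k t - t⁻¹) + (g l t - t⁻¹))]
  have hc : CauchySeq fun k => cfc (g k) R x := by
    rw [Metric.cauchySeq_iff]
    intro ε hε
    have hε' : (0 : ℝ≥0∞) < ENNReal.ofReal (ε ^ 2 / 8) := ENNReal.ofReal_pos.2 (by positivity)
    obtain ⟨N, hN⟩ := eventually_atTop.1 (h3.eventually (Iio_mem_nhds hε'))
    refine ⟨N, fun m hm n hn => ?_⟩
    rw [dist_eq_norm]
    have h5 := (h4 m n).trans (mul_le_mul_right (add_le_add (hN m hm).le (hN n hn).le) 2)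
    rw [← ENNReal.ofReal_add (by positivity) (by positivity), ← ENNReal.ofReal_ofNat,
      ← ENNReal.ofReal_mul (by norm_num), ENNReal.ofReal_le_ofReal_iff (by positivity)] at h5
    refine lt_of_pow_lt_pow_left₀ 2 hε.le (lt_of_le_of_lt h5 ?_)
    have : 0 < ε ^ 2 := by positivity
    linarith
  obtain ⟨z, hz⟩ := cauchySeq_tendsto_of_complete hc
  refine ⟨z, tendsto_nhds_unique ((R.continuous.tendsto z).comp hz) ?_⟩
  have h6 : ∀ k, R (cfc (g k) R x) - x = cfc (fun t => t * g k t - 1) R x := by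
    intro k
    have hc1 : ContinuousOn (fun t => t * g k t) (spectrum ℝ R) :=
      (continuous_id.mul (hgc k)).continuousOn
    rw [cfc_sub (fun t => t * g k t) (fun _ => 1) R hc1 continuousOn_const,
      cfc_mul (fun t => t) (g k) R continuousOn_id (hgc k).continuousOn, cfc_const_one ℝ R,
      cfc_id' ℝ R]
    rfl
  rw [tendsto_iff_norm_sub_tendsto_zero]
  have h7 : Tendsto (fun k => ∫⁻ t, ENNReal.ofReal ((t * g k t - 1) ^ 2) ∂ν) atTop (𝓝 0) := by
    have := tendsto_lintegral_of_dominated_convergence (μ := ν)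
      (F := fun k t => ENNReal.ofReal ((t * g k t - 1) ^ 2)) (f := fun _ => 0)
      (fun t => 1)
      (fun k => by
        have := (hgc k).measurable
        fun_prop) (fun k => .of_forall fun t => by
          rw [← ENNReal.ofReal_one]
          refine ENNReal.ofReal_le_ofReal ?_
          have h0 : 0 ≤ t * g k t := by
            simp only [hg]
            rw [← mul_div_assoc]
            exact div_nonneg (by nlinarith [sq_nonneg t]) (hden k t).le
          have h2 : t * g k t ≤ 1 := by
            simp only [hg]
            rw [← mul_div_assoc, div_le_one (hden k t)]
            nlinarith [hepos k]
          nlinarith) (by simp)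
      ((ae_ne_zero hR hinj x).mono fun t ht => by
        have h4 := (((h2 t).const_mul t).sub_const 1).pow 2
        have := (ENNReal.continuous_ofReal.tendsto _).comp h4
        simpa [mul_inv_cancel₀ ht, Function.comp_def] using this)
    simpa using this
  have h8 : ∀ k, ‖R (cfc (g k) R x) - x‖ = Real.sqrt
      (∫⁻ t, ENNReal.ofReal ((t * g k t - 1) ^ 2) ∂ν).toReal := by
    intro k
    rw [← lintegral_scalarMeasure_sq hR (f := fun t => t * g k t - 1)
        ((continuous_id.mul (hgc k)).sub continuous_const),
      ENNReal.toReal_ofReal (sq_nonneg _), Real.sqrt_sq (norm_nonneg _), h6]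
  have h9 := ((ENNReal.tendsto_toReal ENNReal.zero_ne_top).comp h7).sqrt
  simp only [Function.comp_def, ENNReal.toReal_zero, Real.sqrt_zero] at h9
  simpa only [Function.comp_def, h8] using h9

theorem measurable_add_inv (c : ℝ) : Measurable fun t : ℝ => c + t⁻¹ := by fun_prop

theorem inner_apply_self_eq_integral (z : H) :
    inner ℂ (R z) z = ((∫ t, t ∂((spectralPVM hR).scalarMeasure z) : ℝ) : ℂ) := by
  have h := re_inner_cfc hR continuous_id z
  rw [cfc_id ℝ R] at h
  have h2 := (ContinuousLinearMap.isSelfAdjoint_iff_isSymmetric.1 hR).coe_re_inner_apply_self z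
  rw [ContinuousLinearMap.coe_coe] at h2
  rw [← h2, ← inner_conj_symm, RCLike.conj_re, h]
  rfl

theorem integrable_scalarMeasure {f : ℝ → ℝ} (hf : Continuous f) (x : H) :
    Integrable f ((spectralPVM hR).scalarMeasure x) := by
  rw [scalarMeasure_spectralPVM, integrable_map_measure hf.aestronglyMeasurable
    measurable_subtype_coe.aemeasurable]
  set g : C(spectrum ℝ R, ℝ) := ⟨_, hf.continuousOn.domRestrict⟩
  exact Integrable.of_bound g.continuous.aestronglyMeasurable ‖g‖
    (.of_forall fun t => g.norm_coe_le_norm t)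

/-- If `R = (T - c)⁻¹`, the spectral measure of `T` is the image of that of `R` under
`t ↦ c + t⁻¹`. The junk value at `t = 0` does not matter since `{0}` is a null set. -/
theorem isSpectralMeasure_map (hinj : Function.Injective R) {T : H →ₗ.[ℂ] H} {c : ℝ}
    (hdom : ∀ x, x ∈ T.domain ↔ ∃ z, R z = x)
    (hT : ∀ (x : T.domain) (z : H), R z = x → T x = z + (c : ℂ) • R z) :
    IsSpectralMeasure T ((spectralPVM hR).map _ (measurable_add_inv c)) := by
  constructor
  · intro x
    rw [hdom, ProjectionValuedMeasure.scalarMeasure_map, lintegral_map (by fun_prop)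
      (measurable_add_inv c)]
    constructor
    · rintro ⟨z, rfl⟩
      rw [scalarMeasure_apply_self, lintegral_withDensity_eq_lintegral_mul _ (by fun_prop)
        (by fun_prop)]
      refine lt_of_le_of_lt (lintegral_mono (g := fun t => ENNReal.ofReal ((c * t + 1) ^ 2)) ?_) ?_
      · intro t
        simp only [Pi.mul_apply]
        rw [← ENNReal.ofReal_mul (sq_nonneg _)]
        refine ENNReal.ofReal_le_ofReal ?_
        rcases eq_or_ne t 0 with rfl | ht
        · simp
        · refine le_of_eq ?_
          field_simp
      · have hc : Continuous fun t : ℝ => c * t + 1 := by fun_prop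
        rw [← lintegral_scalarMeasure_sq hR hc z]
        exact ENNReal.ofReal_lt_top
    · intro h
      refine exists_eq_apply_of_lintegral_lt_top hR hinj x (lt_of_le_of_lt
        (lintegral_mono (g := fun t => 2 * (ENNReal.ofReal ((c + t⁻¹) ^ 2) +
          ENNReal.ofReal (c ^ 2))) ?_) ?_)
      · intro t
        simp only
        rw [← ENNReal.ofReal_add (sq_nonneg _) (sq_nonneg _), ← ENNReal.ofReal_ofNat,
          ← ENNReal.ofReal_mul (by norm_num)]
        refine ENNReal.ofReal_le_ofReal ?_
        nlinarith [sq_nonneg (t⁻¹ + 2 * c)]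
      · rw [lintegral_const_mul _ (by fun_prop), lintegral_add_right _ measurable_const,
          lintegral_const]
        refine ENNReal.mul_lt_top (by simp) (ENNReal.add_lt_top.2 ⟨h, ?_⟩)
        exact ENNReal.mul_lt_top ENNReal.ofReal_lt_top (measure_lt_top _ _)
  · intro x
    obtain ⟨z, hz⟩ := (hdom x).1 x.2
    rw [hT x z hz, ← hz, inner_add_right, inner_smul_right,
      ProjectionValuedMeasure.scalarMeasure_map, integral_map (by fun_prop) (by fun_prop),
      scalarMeasure_apply_self, integral_withDensity_eq_integral_toReal_smul (by fun_prop)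
        (.of_forall fun t => ENNReal.ofReal_lt_top)]
    have e : ∀ t : ℝ, (ENNReal.ofReal (t ^ 2)).toReal • (c + t⁻¹) = c * t ^ 2 + t := by
      intro t
      rw [ENNReal.toReal_ofReal (sq_nonneg t), smul_eq_mul]
      rcases eq_or_ne t 0 with rfl | ht
      · simp
      · field_simp
    simp only [e]
    rw [integral_add (f := fun t => c * t ^ 2) (g := fun t => t)
      (integrable_scalarMeasure hR (by fun_prop) z)
      (integrable_scalarMeasure hR continuous_id z), integral_const_mul,
      inner_apply_self_eq_integral hR, inner_self_eq_norm_sq_to_K]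
    have h2 : ‖R z‖ ^ 2 = ∫ t, t ^ 2 ∂((spectralPVM hR).scalarMeasure z) := by
      rw [norm_sq_apply_of_isSelfAdjoint hR, ← re_inner_cfc hR (by fun_prop)]
      rw [cfc_pow_id R 2, sq]
    rw [← h2]
    push_cast
    rw [add_comm]
    rfl

/-- The spectral projection of `R` for `[0, ∞)`. If `R = (T - c)⁻¹`, it is `1_{[c,∞)}(T)`. -/
def posProj : H →L[ℂ] H := (spectralPVM hR).proj (Ici 0)

theorem isSpectralProjection_posProj (hinj : Function.Injective R) {T : H →ₗ.[ℂ] H} {c : ℝ}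
    (hdom : ∀ x, x ∈ T.domain ↔ ∃ z, R z = x)
    (hT : ∀ (x : T.domain) (z : H), R z = x → T x = z + (c : ℂ) • R z) :
    IsSpectralProjection T (Ici c) (posProj hR) := by
  refine ⟨_, isSpectralMeasure_map hR hinj hdom hT, ?_⟩
  change (spectralPVM hR).proj _ = _
  congr 1
  ext t
  simp

/-- The resolvent of a symmetric operator at a real point outside its spectrum. -/
theorem exists_resolvent {T : H →ₗ.[ℂ] H} {c : ℝ}
    (hsym : ∀ x y : T.domain, inner ℂ (T x) (y : H) = inner ℂ (x : H) (T y))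
    (hc : (c : ℂ) ∉ unboundedSpectrum T) : ∃ R : H →L[ℂ] H, IsSelfAdjoint R ∧
      Function.Injective R ∧ (∀ x, x ∈ T.domain ↔ ∃ z, R z = x) ∧
      ∀ (x : T.domain) (z : H), R z = x → T x = z + (c : ℂ) • R z := by
  simp only [unboundedSpectrum, mem_ofPred_eq, not_not] at hc
  obtain ⟨R, h1, h2⟩ := hc
  refine ⟨R, ?_, ?_, ?_, ?_⟩
  · rw [ContinuousLinearMap.isSelfAdjoint_iff_isSymmetric]
    intro y z
    obtain ⟨a, ha, ha'⟩ := h1 y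
    obtain ⟨b, hb, hb'⟩ := h1 z
    simp only [ContinuousLinearMap.coe_coe]
    rw [← ha, ← hb, ← ha', ← hb', inner_sub_left, inner_sub_right, hsym, inner_smul_left,
      inner_smul_right, Complex.conj_ofReal]
  · rw [injective_iff_map_eq_zero]
    intro y hy
    obtain ⟨a, ha, ha'⟩ := h1 y
    have : a = 0 := Subtype.ext (ha.trans hy)
    rw [← ha', this]
    simp
  · intro x
    constructor
    · intro hx
      exact ⟨_, h2 ⟨x, hx⟩⟩
    · rintro ⟨z, rfl⟩
      obtain ⟨a, ha, -⟩ := h1 z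
      rw [← ha]
      exact a.2
  · intro x z hz
    obtain ⟨a, ha, ha'⟩ := h1 z
    have : a = x := Subtype.ext (ha.trans hz)
    rw [← this, ← ha, ← ha']
    simp

end Resolvent

/-! ### The Sylvester equation and the sign of a self-adjoint operator -/

section Sylvester

variable {H : Type*} [NormedAddCommGroup H] [InnerProductSpace ℂ H] [CompleteSpace H]

/-- A form of the Corach–Porta–Recht inequality `2 ‖Y‖ ≤ ‖m Y m'⁻¹ + m⁻¹ Y m'‖`: it is tested on an
almost maximizing pair of singular vectors of `Y`. -/
theorem norm_le_half_of_sylvester_of_lower_bound {m m' Y G E : H →L[ℂ] H} (hm : IsSelfAdjoint m)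
    (hm' : IsSelfAdjoint m') (hE : ∀ x, ‖E x‖ ≤ ‖x‖) (hYE : ∀ x, Y (E x) = Y x) {δ : ℝ}
    (hδ : 0 < δ) (hlow : ∀ x, δ * ‖E x‖ ≤ ‖m' (E x)‖)
    (heq : m * m * Y + Y * (m' * m') = m * G * m') : ‖Y‖ ≤ ‖G‖ / 2 := by
  by_contra hcon
  push Not at hcon
  set l := ‖Y‖ with hl
  have hlpos : 0 < l := lt_of_le_of_lt (by positivity) hcon
  have hsm := ContinuousLinearMap.isSelfAdjoint_iff_isSymmetric.1 hm
  have hsm' := ContinuousLinearMap.isSelfAdjoint_iff_isSymmetric.1 hm'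
  -- the estimate for an almost maximizing vector
  have key : ∀ η : ℝ, 0 < η → η < l →
      (l - ‖G‖ / 2) * (δ * ((l - η) / l)) ^ 2 ≤ ‖m'‖ ^ 2 * Real.sqrt (2 * l * η) := by
    intro η hη hηl
    obtain ⟨x0, hx0, hx0'⟩ : ∃ x0 : H, ‖x0‖ ≤ 1 ∧ l - η < ‖Y x0‖ := by
      obtain ⟨x, hx, hx'⟩ := ContinuousLinearMap.exists_lt_apply_of_lt_opNorm Y
        (r := l - η) (by rw [← hl]; linarith)
      exact ⟨x, hx.le, hx'⟩
    set x' := E x0 with hx'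
    have hx'1 : ‖x'‖ ≤ 1 := (hE x0).trans hx0
    have hYx' : l - η < ‖Y x'‖ := by rwa [hx', hYE]
    set x : H := (l : ℂ)⁻¹ • Y x' with hx
    have hYx : Y x' = (l : ℂ) • x := by
      rw [hx, smul_smul, mul_inv_cancel₀ (by exact_mod_cast hlpos.ne'), one_smul]
    set Ya := ContinuousLinearMap.adjoint Y with hYa
    have hYan : ‖Ya‖ = l := by rw [hYa, LinearIsometryEquiv.norm_map]
    have hr : ‖Ya x - (l : ℂ) • x'‖ ≤ Real.sqrt (2 * l * η) := by
      refine Real.le_sqrt_of_sq_le ?_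
      have hxl : ‖x‖ = ‖Y x'‖ / l := by
        rw [hx, norm_smul, norm_inv, Complex.norm_real, Real.norm_of_nonneg hlpos.le]
        field_simp
      have e1 : RCLike.re (inner ℂ (Ya x) ((l : ℂ) • x')) = ‖Y x'‖ ^ 2 := by
        rw [hYa, ContinuousLinearMap.adjoint_inner_left, map_smul, hx, inner_smul_left,
          inner_smul_right, inner_self_eq_norm_sq_to_K]
        have : (starRingEnd ℂ) (l : ℂ)⁻¹ = (l : ℂ)⁻¹ := by
          rw [map_inv₀, Complex.conj_ofReal]
        have hl0 : (l : ℂ) ≠ 0 := by exact_mod_cast hlpos.ne'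
        rw [this]
        have h3 : (l : ℂ)⁻¹ * ((l : ℂ) * (‖Y x'‖ : ℂ) ^ 2)
          = ((‖Y x'‖ ^ 2 : ℝ) : ℂ) := by
          push_cast
          field_simp
        exact (congrArg Complex.re h3).trans (Complex.ofReal_re _)
      have h1 : ‖Ya x‖ ≤ ‖Y x'‖ := by
        refine (Ya.le_opNorm x).trans ?_
        rw [hYan, hxl]
        field_simp
        exact le_rfl
      have h2 : ‖(l : ℂ) • x'‖ ≤ l := by
        rw [norm_smul, Complex.norm_real, Real.norm_of_nonneg hlpos.le]
        nlinarith
      rw [@norm_sub_sq ℂ, e1]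
      have h1' := pow_le_pow_left₀ (norm_nonneg _) h1 2
      have h2' := pow_le_pow_left₀ (norm_nonneg _) h2 2
      nlinarith
    have hYx'2 : ‖Y x'‖ ≤ l * ‖x'‖ := Y.le_opNorm x'
    have hx'low : (l - η) / l ≤ ‖x'‖ := by
      rw [div_le_iff₀ hlpos]
      linarith
    have hlow' : δ * ((l - η) / l) ≤ ‖m' x'‖ :=
      (mul_le_mul_of_nonneg_left hx'low hδ.le).trans (hlow x0)
    -- pair the equation with `x'` and `x`
    have e := congrArg (fun T : H →L[ℂ] H => RCLike.re (inner ℂ (T x') x)) heq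
    simp only [_root_.add_apply, mul_apply_eq_comp, inner_add_left, map_add] at e
    have t1 : RCLike.re (inner ℂ (m (m (Y x'))) x) = l * ‖m x‖ ^ 2 := by
      have := hsm (m (Y x')) x
      simp only [ContinuousLinearMap.coe_coe] at this
      rw [this, hYx, map_smul, inner_smul_left, Complex.conj_ofReal, inner_self_eq_norm_sq_to_K]
      have h3 : (l : ℂ) * (‖m x‖ : ℂ) ^ 2 = ((l * ‖m x‖ ^ 2 : ℝ) : ℂ) := by push_cast; rfl
      exact (congrArg Complex.re h3).trans (Complex.ofReal_re _)
    have t2 : l * ‖m' x'‖ ^ 2 - ‖m'‖ ^ 2 * Real.sqrt (2 * l * η) ≤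
        RCLike.re (inner ℂ (Y (m' (m' x'))) x) := by
      have h4 : inner ℂ (Y (m' (m' x'))) x = inner ℂ (m' (m' x')) (Ya x - (l : ℂ) • x') +
          inner ℂ (m' (m' x')) ((l : ℂ) • x') := by
        rw [← inner_add_right, sub_add_cancel, hYa, ContinuousLinearMap.adjoint_inner_right]
      have h5 : RCLike.re (inner ℂ (m' (m' x')) ((l : ℂ) • x')) = l * ‖m' x'‖ ^ 2 := by
        have := hsm' (m' x') x'
        simp only [ContinuousLinearMap.coe_coe] at this
        rw [inner_smul_right, this, inner_self_eq_norm_sq_to_K]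
        have h3 : (l : ℂ) * (‖m' x'‖ : ℂ) ^ 2 = ((l * ‖m' x'‖ ^ 2 : ℝ) : ℂ) := by push_cast; rfl
        exact (congrArg Complex.re h3).trans (Complex.ofReal_re _)
      have h6 : ‖m' (m' x')‖ ≤ ‖m'‖ ^ 2 := by
        calc _ ≤ ‖m'‖ * ‖m' x'‖ := m'.le_opNorm _
          _ ≤ ‖m'‖ * (‖m'‖ * 1) := by
              gcongr
              exact (m'.le_opNorm _).trans (by gcongr)
          _ = _ := by ring
      have h7 := (abs_le.1 (RCLike.abs_re_le_norm (inner ℂ (m' (m' x')) (Ya x - (l : ℂ) • x')))).1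
      have h8 := norm_inner_le_norm (𝕜 := ℂ) (m' (m' x')) (Ya x - (l : ℂ) • x')
      have h9 := mul_le_mul h6 hr (norm_nonneg _) (by positivity)
      rw [h4, map_add, h5]
      linarith
    have t3 : RCLike.re (inner ℂ (m (G (m' x'))) x) ≤ ‖G‖ / 2 * (‖m x‖ ^ 2 + ‖m' x'‖ ^ 2) := by
      have := hsm (G (m' x')) x
      simp only [ContinuousLinearMap.coe_coe] at this
      rw [this]
      refine (RCLike.re_le_norm _).trans ((norm_inner_le_norm _ _).trans ?_)
      have h3 := mul_le_mul_of_nonneg_right (G.le_opNorm (m' x')) (norm_nonneg (m x))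
      refine h3.trans ?_
      nlinarith [mul_nonneg (norm_nonneg G) (sq_nonneg (‖m x‖ - ‖m' x'‖))]
    have hfin : (l - ‖G‖ / 2) * ‖m' x'‖ ^ 2 ≤ ‖m'‖ ^ 2 * Real.sqrt (2 * l * η) := by
      have h3 : 0 ≤ (l - ‖G‖ / 2) * ‖m x‖ ^ 2 := mul_nonneg (by linarith) (sq_nonneg _)
      rw [t1] at e
      linarith
    refine le_trans ?_ hfin
    have h0 : 0 ≤ δ * ((l - η) / l) := mul_nonneg hδ.le (div_nonneg (by linarith) hlpos.le)
    exact mul_le_mul_of_nonneg_left (pow_le_pow_left₀ h0 hlow' 2) (by linarith)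
  -- let `η → 0`
  have hlim1 : Tendsto (fun η : ℝ => (l - ‖G‖ / 2) * (δ * ((l - η) / l)) ^ 2) (𝓝[>] 0)
      (𝓝 ((l - ‖G‖ / 2) * (δ * ((l - 0) / l)) ^ 2)) := by
    refine tendsto_nhdsWithin_of_tendsto_nhds ?_
    exact Continuous.tendsto (by fun_prop) 0
  have hlim2 : Tendsto (fun η : ℝ => ‖m'‖ ^ 2 * Real.sqrt (2 * l * η)) (𝓝[>] 0)
      (𝓝 (‖m'‖ ^ 2 * Real.sqrt (2 * l * 0))) := by
    refine tendsto_nhdsWithin_of_tendsto_nhds ?_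
    exact Continuous.tendsto (by fun_prop) 0
  have h := le_of_tendsto_of_tendsto hlim1 hlim2 (by
    filter_upwards [Ioo_mem_nhdsGT hlpos] with η hη
    exact key η hη.1 hη.2)
  rw [mul_zero, Real.sqrt_zero, mul_zero, sub_zero, div_self hlpos.ne', mul_one] at h
  have : 0 < (l - ‖G‖ / 2) * δ ^ 2 := mul_pos (by linarith) (by positivity)
  linarith

/-- If `‖A x‖ ≤ C ‖B x‖` and `B` has dense range, then `A` factors through `B`. -/
theorem exists_factor_of_norm_le {A B : H →L[ℂ] H} (hB : DenseRange B) {C : ℝ} (hC : 0 ≤ C)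
    (h : ∀ x, ‖A x‖ ≤ C * ‖B x‖) : ∃ W : H →L[ℂ] H, ‖W‖ ≤ C ∧ ∀ x, W (B x) = A x := by
  refine ⟨A.toLinearMap.extendOfNorm B.toLinearMap, ?_, fun x => ?_⟩
  · exact LinearMap.opNorm_extendOfNorm_le hB hC h
  · exact LinearMap.extendOfNorm_eq (f := A.toLinearMap) (e := B.toLinearMap) hB ⟨C, h⟩ x

theorem denseRange_of_isSelfAdjoint {T : H →L[ℂ] H} (hT : IsSelfAdjoint T)
    (hinj : Function.Injective T) : DenseRange T := by
  have h1 : (LinearMap.range T.toLinearMap).topologicalClosure = ⊤ := by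
    rw [Submodule.topologicalClosure_eq_top_iff, eq_bot_iff]
    intro y hy
    rw [Submodule.mem_orthogonal] at hy
    have h2 := (ContinuousLinearMap.isSelfAdjoint_iff_isSymmetric.1 hT)
    have h3 : T y = 0 := by
      have := hy (T (T y)) ⟨T y, rfl⟩
      have h4 := h2 (T y) y
      simp only [ContinuousLinearMap.coe_coe] at h4
      rw [h4] at this
      exact inner_self_eq_zero.1 this
    exact hinj (h3.trans (map_zero T).symm)
  intro y
  have : y ∈ (LinearMap.range T.toLinearMap).topologicalClosure := h1 ▸ Submodule.mem_top
  exact this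

end Sylvester

section Sign

variable {H : Type*} [NormedAddCommGroup H] [InnerProductSpace ℂ H] [CompleteSpace H]
variable {R : H →L[ℂ] H} (hR : IsSelfAdjoint R)

/-- On the range of the spectral projection of `S`, only the values of a function on `S` matter. -/
theorem cfc_apply_proj_eq {f g : ℝ → ℝ} (hf : Continuous f) (hg : Continuous g) {S : Set ℝ}
    (hS : MeasurableSet S) (hfg : ∀ t ∈ S, f t = g t) (x : H) :
    cfc f R ((spectralPVM hR).proj S x) = cfc g R ((spectralPVM hR).proj S x) := by
  rw [← sub_eq_zero, ← _root_.sub_apply, ← cfc_sub f g R hf.continuousOn hg.continuousOn]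
  have h := lintegral_scalarMeasure_sq hR (f := fun t => f t - g t) (hf.sub hg)
    ((spectralPVM hR).proj S x)
  rw [ProjectionValuedMeasure.scalarMeasure_proj _ hS, setLIntegral_congr_fun hS
    (g := fun _ => 0) (fun t ht => by simp [hfg t ht]), lintegral_zero,
    ENNReal.ofReal_eq_zero] at h
  exact norm_eq_zero.1 (pow_eq_zero_iff two_ne_zero |>.1 (le_antisymm h (sq_nonneg _)))

/-- The modulus `|R|`. -/
def absOp (R : H →L[ℂ] H) : H →L[ℂ] H := cfc (fun t : ℝ => |t|) R

/-- The square root `|R|^{1/2}`. -/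
def sqrtAbsOp (R : H →L[ℂ] H) : H →L[ℂ] H := cfc (fun t : ℝ => Real.sqrt |t|) R

/-- The sign of `R`, with the value `1` at `0`. -/
def signOp : H →L[ℂ] H := (2 : ℂ) • posProj hR - 1

theorem isSelfAdjoint_absOp : IsSelfAdjoint (absOp R) := cfc_predicate _ R

theorem isSelfAdjoint_sqrtAbsOp : IsSelfAdjoint (sqrtAbsOp R) := cfc_predicate _ R

theorem sqrtAbsOp_mul_self (_hR : IsSelfAdjoint R) : sqrtAbsOp R * sqrtAbsOp R = absOp R := by
  rw [sqrtAbsOp, ← cfc_mul _ _ R (by fun_prop) (by fun_prop), absOp]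
  congr 1
  funext t
  exact Real.mul_self_sqrt (abs_nonneg t)

theorem isStarProjection_posProj : IsStarProjection (posProj hR) :=
  (spectralPVM hR).isStarProjection _ measurableSet_Ici

theorem isSelfAdjoint_signOp : IsSelfAdjoint (signOp hR) := by
  refine IsSelfAdjoint.sub ?_ (IsSelfAdjoint.one _)
  have h : IsSelfAdjoint (2 : ℂ) := by
    rw [isSelfAdjoint_iff]
    simp
  exact h.smul (isStarProjection_posProj hR).isSelfAdjoint

theorem signOp_mul_self : signOp hR * signOp hR = 1 := by
  have h : posProj hR * posProj hR = posProj hR := (isStarProjection_posProj hR).isIdempotentElem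
  simp only [signOp, sub_mul, mul_sub, smul_mul_assoc, mul_smul_comm, h, one_mul, mul_one]
  module

theorem norm_signOp_apply (x : H) : ‖signOp hR x‖ = ‖x‖ := by
  rw [← sq_eq_sq₀ (norm_nonneg _) (norm_nonneg _), norm_sq_apply_of_isSelfAdjoint
    (isSelfAdjoint_signOp hR), signOp_mul_self, one_apply_eq_self, inner_self_eq_norm_sq]

theorem commute_signOp {T : H →L[ℂ] H} (hT : Commute T R) : Commute T (signOp hR) :=
  ((commute_spectralPVM hR hT _).smul_right _).sub_right (Commute.one_right T)

/-- The polar decomposition `R (sgn R) = |R|`. -/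
theorem apply_signOp (x : H) : R (signOp hR x) = absOp R x := by
  have hid : ∀ y, cfc (fun t : ℝ => t) R y = R y := fun y => by rw [cfc_id' ℝ R]
  have h1 := cfc_apply_proj_eq hR (f := fun t => t) (g := fun t => |t|) continuous_id continuous_abs
    (S := Ici 0) measurableSet_Ici (fun t ht => (abs_of_nonneg ht).symm) x
  have h2 := cfc_apply_proj_eq hR (f := fun t => -t) (g := fun t => |t|) continuous_neg
    continuous_abs (S := Iio 0) measurableSet_Iio (fun t ht => (abs_of_neg ht).symm) x
  have h3 := (spectralPVM hR).proj_union (S := Ici 0) (T := Iio 0) measurableSet_Ici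
    measurableSet_Iio (by rw [disjoint_comm]; exact Iio_disjoint_Ici le_rfl) x
  rw [union_comm, Iio_union_Ici, ProjectionValuedMeasure.proj_univ, one_apply_eq_self] at h3
  rw [cfc_neg (fun t : ℝ => t) R] at h2
  rw [_root_.neg_apply, hid] at h2
  rw [hid] at h1
  have h4 : signOp hR x = (spectralPVM hR).proj (Ici 0) x - (spectralPVM hR).proj (Iio 0) x := by
    rw [signOp, posProj, _root_.sub_apply, _root_.smul_apply, one_apply_eq_self]
    nth_rw 2 [h3]
    module
  rw [h4, map_sub, sub_eq_add_neg, h1, h2, ← map_add, ← h3]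
  rfl

theorem signOp_apply_absOp (x : H) : signOp hR (absOp R x) = R x := by
  rw [← apply_signOp hR]
  have h := congrArg (fun T : H →L[ℂ] H => T (signOp hR x)) (commute_signOp hR (Commute.refl R)).eq
  simp only [mul_apply_eq_comp] at h
  rw [← h]
  have h2 := congrArg (fun T : H →L[ℂ] H => T x) (signOp_mul_self hR)
  simp only [mul_apply_eq_comp, one_apply_eq_self] at h2
  rw [h2]

theorem injective_sqrtAbsOp (hR : IsSelfAdjoint R) (hinj : Function.Injective R) :
    Function.Injective (sqrtAbsOp R) := by
  rw [injective_iff_map_eq_zero]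
  intro x hx
  have h1 : absOp R x = 0 := by
    rw [← sqrtAbsOp_mul_self hR, mul_apply_eq_comp, hx, map_zero]
  have h2 := signOp_apply_absOp hR x
  rw [h1, map_zero] at h2
  exact hinj (h2.symm.trans (map_zero R).symm)

theorem denseRange_sqrtAbsOp (hR : IsSelfAdjoint R) (hinj : Function.Injective R) :
    DenseRange (sqrtAbsOp R) :=
  denseRange_of_isSelfAdjoint isSelfAdjoint_sqrtAbsOp (injective_sqrtAbsOp hR hinj)

theorem norm_absOp_apply (hR : IsSelfAdjoint R) (x : H) : ‖absOp R x‖ = ‖R x‖ := by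
  rw [← signOp_apply_absOp hR, norm_signOp_apply]

theorem commute_sqrtAbsOp (_hR : IsSelfAdjoint R) : Commute (sqrtAbsOp R) R :=
  (Commute.refl R).cfc_real _

theorem norm_sqrtAbsOp_sq (hR : IsSelfAdjoint R) (x : H) :
    ‖sqrtAbsOp R x‖ ^ 2 = RCLike.re (inner ℂ x (absOp R x)) := by
  rw [norm_sq_apply_of_isSelfAdjoint isSelfAdjoint_sqrtAbsOp, sqrtAbsOp_mul_self hR]

theorem absOp_nonneg : 0 ≤ absOp R := cfc_nonneg fun t _ => abs_nonneg t

theorem mul_self_le_of_norm_le (hR : IsSelfAdjoint R) {R' : H →L[ℂ] H} (hR' : IsSelfAdjoint R')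
    (h : ∀ x, ‖R' x‖ ≤ ‖R x‖) : R' * R' ≤ R * R := by
  rw [ContinuousLinearMap.le_def, ContinuousLinearMap.isPositive_def']
  refine ⟨?_, fun y => ?_⟩
  · refine IsSelfAdjoint.sub ?_ ?_
    · simpa only [sq] using hR.pow 2
    · simpa only [sq] using hR'.pow 2
  · rw [ContinuousLinearMap.reApplyInnerSelf_apply, ← inner_conj_symm, RCLike.conj_re,
      _root_.sub_apply, inner_sub_right, map_sub, ← norm_sq_apply_of_isSelfAdjoint hR',
      ← norm_sq_apply_of_isSelfAdjoint hR]
    have := pow_le_pow_left₀ (norm_nonneg _) (h y) 2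
    linarith

theorem le_of_mul_self_le {S T : H →L[ℂ] H} (hS : 0 ≤ S) (hT : 0 ≤ T) (h : S * S ≤ T * T) :
    S ≤ T := by
  have h2 := CFC.sqrt_le_sqrt (S * S) (T * T) h
  rwa [CFC.sqrt_mul_self S hS, CFC.sqrt_mul_self T hT] at h2

open scoped ComplexOrder in
/-- Operator monotonicity of the square root: `‖R' x‖ ≤ C ‖R x‖` implies
`‖|R'|^{1/2} x‖² ≤ C ‖|R|^{1/2} x‖²`. -/
theorem norm_sqrtAbsOp_sq_le (hR : IsSelfAdjoint R) {R' : H →L[ℂ] H} (hR' : IsSelfAdjoint R')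
    {C : ℝ} (hC : 0 ≤ C) (h : ∀ x, ‖R' x‖ ≤ C * ‖R x‖) (x : H) :
    ‖sqrtAbsOp R' x‖ ^ 2 ≤ C * ‖sqrtAbsOp R x‖ ^ 2 := by
  rw [norm_sqrtAbsOp_sq hR, norm_sqrtAbsOp_sq hR']
  have hC' : (0 : ℂ) ≤ (C : ℂ) := by exact_mod_cast hC
  have hpos : 0 ≤ (C : ℂ) • absOp R := by
    rw [ContinuousLinearMap.nonneg_iff_isPositive]
    exact ((ContinuousLinearMap.nonneg_iff_isPositive (absOp R)).1 absOp_nonneg).smul_of_nonneg hC'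
  have hle : absOp R' * absOp R' ≤ ((C : ℂ) • absOp R) * ((C : ℂ) • absOp R) := by
    refine mul_self_le_of_norm_le (IsSelfAdjoint.of_nonneg hpos) isSelfAdjoint_absOp fun y => ?_
    rw [norm_absOp_apply hR', _root_.smul_apply, norm_smul, Complex.norm_real,
      Real.norm_of_nonneg hC, norm_absOp_apply hR]
    exact h y
  have h2 : absOp R' ≤ (C : ℂ) • absOp R := le_of_mul_self_le absOp_nonneg hpos hle
  have h3 := ((ContinuousLinearMap.le_def _ _).1 h2).re_inner_nonneg_right x
  rw [_root_.sub_apply, inner_sub_right, map_sub, _root_.smul_apply, inner_smul_right] at h3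
  have h4 : RCLike.re ((C : ℂ) * inner ℂ x (absOp R x)) =
      C * RCLike.re (inner ℂ x (absOp R x)) := Complex.re_ofReal_mul _ _
  linarith

/-- The spectral projections of `R` away from `0` exhaust the space if `R` is injective. -/
theorem tendsto_proj_compl_ball (hinj : Function.Injective R) (x : H) :
    Tendsto (fun k : ℕ => (spectralPVM hR).proj {t | 1 / ((k : ℝ) + 1) ≤ |t|} x) atTop (𝓝 x) := by
  set P := spectralPVM hR
  have hm : ∀ k : ℕ, MeasurableSet {t : ℝ | |t| < 1 / ((k : ℝ) + 1)} := fun k =>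
    measurableSet_lt (by fun_prop) measurable_const
  have hm' : ∀ k : ℕ, MeasurableSet {t : ℝ | 1 / ((k : ℝ) + 1) ≤ |t|} := fun k =>
    measurableSet_le measurable_const (by fun_prop)
  have h1 : ∀ k : ℕ, x - P.proj {t | 1 / ((k : ℝ) + 1) ≤ |t|} x =
      P.proj {t | |t| < 1 / ((k : ℝ) + 1)} x := by
    intro k
    have h := P.proj_union (hm k) (hm' k) (by
      rw [disjoint_left]
      intro t ht ht'
      simp only [mem_ofPred_eq] at ht ht'
      linarith) x
    have hu : {t : ℝ | |t| < 1 / ((k : ℝ) + 1)} ∪ {t : ℝ | 1 / ((k : ℝ) + 1) ≤ |t|} = univ := by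
      ext t
      simp [lt_or_ge]
    rw [hu, P.proj_univ, one_apply_eq_self] at h
    nth_rw 1 [h]
    abel
  have h2 : Tendsto (fun k : ℕ => P.scalarMeasure x {t | |t| < 1 / ((k : ℝ) + 1)}) atTop (𝓝 0) := by
    have h := tendsto_measure_iInter_atTop (μ := P.scalarMeasure x)
      (s := fun k : ℕ => {t : ℝ | |t| < 1 / ((k : ℝ) + 1)}) (fun k => (hm k).nullMeasurableSet)
      (fun k l hkl t ht => lt_of_lt_of_le (b := 1 / ((l : ℝ) + 1)) ht (by gcongr))
      ⟨0, measure_ne_top _ _⟩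
    have h0 : ⋂ k : ℕ, {t : ℝ | |t| < 1 / ((k : ℝ) + 1)} = {0} := by
      ext t
      simp only [mem_iInter, mem_ofPred_eq, mem_singleton_iff]
      constructor
      · intro ht
        have := ge_of_tendsto' (tendsto_one_div_add_atTop_nhds_zero_nat (𝕜 := ℝ))
          (fun k => (ht k).le)
        exact abs_eq_zero.1 (le_antisymm this (abs_nonneg t))
      · rintro rfl k
        rw [abs_zero]
        positivity
    rwa [h0, scalarMeasure_singleton_zero hR hinj] at h
  rw [tendsto_iff_norm_sub_tendsto_zero]
  have h3 := ((ENNReal.tendsto_toReal ENNReal.zero_ne_top).comp h2).sqrt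
  simp only [Function.comp_def, ENNReal.toReal_zero, Real.sqrt_zero] at h3
  refine h3.congr fun k => ?_
  rw [P.scalarMeasure_apply (hm k), ENNReal.toReal_ofReal (sq_nonneg _),
    Real.sqrt_sq (norm_nonneg _), ← h1, norm_sub_rev]

/-- The Sylvester equation `m² W + W m'² = m G m'` for `m = |R|^{1/2}`, `m' = |R'|^{1/2}`. -/
theorem norm_le_half_of_sylvester {R R' : H →L[ℂ] H} (hR' : IsSelfAdjoint R')
    (hinj' : Function.Injective R') {W G : H →L[ℂ] H}
    (heq : sqrtAbsOp R * sqrtAbsOp R * W + W * (sqrtAbsOp R' * sqrtAbsOp R') =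
      sqrtAbsOp R * G * sqrtAbsOp R') : ‖W‖ ≤ ‖G‖ / 2 := by
  set P := spectralPVM hR'
  have hm' : ∀ k : ℕ, MeasurableSet {t : ℝ | 1 / ((k : ℝ) + 1) ≤ |t|} := fun k =>
    measurableSet_le measurable_const (by fun_prop)
  have hE : ∀ k : ℕ, ∀ x, ‖P.proj {t | 1 / ((k : ℝ) + 1) ≤ |t|} x‖ ≤ ‖x‖ := by
    intro k x
    refine le_of_sq_le_sq ?_ (norm_nonneg x)
    rw [← P.scalarMeasure_real (hm' k)]
    have h1 := P.scalarMeasure_real MeasurableSet.univ x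
    rw [P.proj_univ, one_apply_eq_self] at h1
    rw [← h1]
    exact measureReal_mono (subset_univ _)
  have key : ∀ k : ℕ, ‖W * P.proj {t | 1 / ((k : ℝ) + 1) ≤ |t|}‖ ≤ ‖G‖ / 2 := by
    intro k
    set E := P.proj {t | 1 / ((k : ℝ) + 1) ≤ |t|} with hEdef
    have hδ : (0 : ℝ) < 1 / ((k : ℝ) + 1) := by positivity
    have hG : ‖G * E‖ ≤ ‖G‖ := by
      refine ContinuousLinearMap.opNorm_le_bound _ (norm_nonneg G) fun x => ?_
      exact (G.le_opNorm _).trans (mul_le_mul_of_nonneg_left (hE k x) (norm_nonneg G))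
    have hcomm : Commute (sqrtAbsOp R') E :=
      commute_spectralPVM hR' (commute_sqrtAbsOp hR') _
    refine le_trans (norm_le_half_of_sylvester_of_lower_bound (m := sqrtAbsOp R)
      (m' := sqrtAbsOp R') (G := G * E) (E := E) isSelfAdjoint_sqrtAbsOp isSelfAdjoint_sqrtAbsOp
      (hE k) (fun x => ?_) (Real.sqrt_pos.2 hδ) (fun x => ?_) ?_) (by linarith)
    · rw [mul_apply_eq_comp, mul_apply_eq_comp, hEdef, P.proj_proj_self (hm' k)]
    · refine le_of_sq_le_sq ?_ (norm_nonneg _)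
      rw [mul_pow, Real.sq_sqrt hδ.le]
      have h1 := lintegral_scalarMeasure_sq hR' (f := fun t => Real.sqrt |t|) (by fun_prop) (E x)
      rw [P.scalarMeasure_proj (hm' k)] at h1
      have h2 : ENNReal.ofReal (1 / ((k : ℝ) + 1) * ‖E x‖ ^ 2) ≤
          ENNReal.ofReal (‖sqrtAbsOp R' (E x)‖ ^ 2) := by
        rw [sqrtAbsOp, h1, ENNReal.ofReal_mul hδ.le, ← P.scalarMeasure_apply (hm' k),
          ← setLIntegral_const]
        refine setLIntegral_mono' (hm' k) fun t ht => ENNReal.ofReal_le_ofReal ?_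
        rw [Real.sq_sqrt (abs_nonneg t)]
        exact ht
      exact (ENNReal.ofReal_le_ofReal_iff (sq_nonneg _)).1 h2
    · calc _ = (sqrtAbsOp R * sqrtAbsOp R * W + W * (sqrtAbsOp R' * sqrtAbsOp R')) * E := by
            rw [add_mul, mul_assoc W, mul_assoc W, ((hcomm.mul_left hcomm)).eq, mul_assoc _ W]
        _ = _ := by
            rw [heq, mul_assoc, hcomm.eq]
            simp only [mul_assoc]
  refine ContinuousLinearMap.opNorm_le_bound _ (by positivity) fun x => ?_
  have hlim := ((W.continuous.tendsto _).comp (tendsto_proj_compl_ball hR' hinj' x)).norm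
  refine le_of_tendsto' hlim fun k => ?_
  exact ((W * P.proj {t | 1 / ((k : ℝ) + 1) ≤ |t|}).le_opNorm x).trans
    (mul_le_mul_of_nonneg_right (key k) (norm_nonneg x))

/-- The difference of the signs of two operators whose inverses `R`, `R'` are close, in the norm of
order `-1/2`. The operator `W` with `|R|^{1/2} (sgn R - sgn R') = W |R'|^{1/2}` solves a Sylvester
equation. -/
theorem norm_sqrtAbsOp_signOp_sub_le {R' : H →L[ℂ] H}
    (hR' : IsSelfAdjoint R') (hinj' : Function.Injective R') {ε K : ℝ} (hε : 0 ≤ ε) (hK : 0 ≤ K)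
    (h : ∀ x, ‖R x - R' x‖ ≤ ε * ‖R' x‖) (h1 : ∀ x, ‖R x‖ ≤ K * ‖R' x‖)
    (x : H) :
    ‖sqrtAbsOp R (signOp hR x - signOp hR' x)‖ ≤ ε * ‖sqrtAbsOp R' x‖ := by
  set m := sqrtAbsOp R with hm
  set m' := sqrtAbsOp R' with hm'
  set S := signOp hR with hS
  set S' := signOp hR' with hS'
  have hcS : ∀ y, m (S y) = S (m y) := fun y =>
    congrArg (fun T : H →L[ℂ] H => T y) (commute_signOp hR (commute_sqrtAbsOp hR)).eq
  have hcS' : ∀ y, m' (S' y) = S' (m' y) := fun y =>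
    congrArg (fun T : H →L[ℂ] H => T y) (commute_signOp hR' (commute_sqrtAbsOp hR')).eq
  have hmm' : ∀ y, ‖m y‖ ≤ Real.sqrt K * ‖m' y‖ := by
    intro y
    have := norm_sqrtAbsOp_sq_le hR' hR hK h1 y
    rw [← Real.sqrt_sq (norm_nonneg (m y)), ← Real.sqrt_sq (norm_nonneg (m' y)),
      ← Real.sqrt_mul hK]
    exact Real.sqrt_le_sqrt this
  have hdm' : DenseRange m' := denseRange_sqrtAbsOp hR' hinj'
  -- the operator `W`
  obtain ⟨W, -, hW⟩ := exists_factor_of_norm_le (A := m * (S - S')) (B := m')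
    (C := 2 * Real.sqrt K) hdm' (by positivity) (fun y => by
      rw [mul_apply_eq_comp, _root_.sub_apply, map_sub]
      refine (norm_sub_le _ _).trans ?_
      have e1 : ‖m (S y)‖ ≤ Real.sqrt K * ‖m' y‖ := by
        rw [hcS, hS, norm_signOp_apply]
        exact hmm' y
      have e2 : ‖m (S' y)‖ ≤ Real.sqrt K * ‖m' y‖ := by
        refine (hmm' _).trans ?_
        rw [hcS', hS', norm_signOp_apply]
      linarith)
  -- the right-hand side `Δ = (R - R') - S (R - R') S' = G |R'|`
  have hdM' : DenseRange (absOp R') := by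
    rw [← sqrtAbsOp_mul_self hR']
    exact hdm'.comp hdm' m'.continuous
  obtain ⟨G, hG, hGeq⟩ := exists_factor_of_norm_le (A := (R - R') - S * (R - R') * S')
    (B := absOp R') (C := 2 * ε) hdM' (by positivity) (fun y => by
      rw [_root_.sub_apply]
      refine (norm_sub_le _ _).trans ?_
      have e1 : ‖(R - R') y‖ ≤ ε * ‖absOp R' y‖ := by
        rw [norm_absOp_apply hR']
        exact h y
      have e2 : ‖(S * (R - R') * S') y‖ ≤ ε * ‖absOp R' y‖ := by
        rw [mul_apply_eq_comp, mul_apply_eq_comp, hS, norm_signOp_apply, _root_.sub_apply]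
        refine (h _).trans ?_
        rw [hS', apply_signOp]
      linarith)
  have hΔ : ∀ y, absOp R ((S - S') y) + (S - S') (absOp R' y) =
      ((R - R') - S * (R - R') * S') y := by
    intro y
    have hSS : ∀ z, S (S z) = z := fun z =>
      congrArg (fun T : H →L[ℂ] H => T z) (signOp_mul_self hR)
    have hSS' : ∀ z, S' (S' z) = z := fun z =>
      congrArg (fun T : H →L[ℂ] H => T z) (signOp_mul_self hR')
    have a1 : ∀ z, absOp R z = S (R z) := fun z => by
      rw [← signOp_apply_absOp hR, ← hS, hSS]
    have a2 : ∀ z, absOp R' z = R' (S' z) := fun z => (apply_signOp hR' z).symm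
    have a3 : absOp R (S y) = R y := by
      rw [← apply_signOp hR, ← hS, hSS]
    have a4 : S' (absOp R' y) = R' y := signOp_apply_absOp hR' y
    simp only [_root_.sub_apply, mul_apply_eq_comp, map_sub]
    rw [a3, a4, a1, a2]
    abel
  have heq : m * m * W + W * (m' * m') = m * G * m' := by
    have hfun : ∀ y, (m * m * W + W * (m' * m')) (m' y) = (m * G * m') (m' y) := by
      intro y
      have hmM : ∀ z, m (m z) = absOp R z := fun z =>
        congrArg (fun T : H →L[ℂ] H => T z) (sqrtAbsOp_mul_self hR)
      have hmM' : ∀ z, m' (m' z) = absOp R' z := fun z =>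
        congrArg (fun T : H →L[ℂ] H => T z) (sqrtAbsOp_mul_self hR')
      simp only [_root_.add_apply, mul_apply_eq_comp] at hW ⊢
      rw [hW, hW, hmM', hGeq, ← hΔ, map_add, hmM]
      congr 1
      rw [← hmM, ← hmM]
    ext y
    exact congrFun (hdm'.equalizer (m * m * W + W * (m' * m')).continuous (m * G * m').continuous
      (funext hfun)) y
  have hWn := norm_le_half_of_sylvester hR' hinj' heq
  have := hW x
  simp only [mul_apply_eq_comp, _root_.sub_apply] at this
  rw [← this]
  exact (W.le_opNorm _).trans (mul_le_mul_of_nonneg_right (by linarith) (norm_nonneg _))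

end Sign

/-! ### The scale of norms of a self-adjoint operator, and interpolation -/

section Interpolation

/-- For a single weight `w`, the powers `wˢ` are integrals of `min (λ / w, w)` over `λ > 0`: this
function of `λ` changes its slope at `λ = w²`. -/
theorem lintegral_rpow_mul_min {s : ℝ} (hs : |s| < 1) {w : ℝ} (hw : 0 < w) :
    ∫⁻ l in Ioi (0 : ℝ), ENNReal.ofReal (l ^ ((s - 1) / 2 - 1)) * ENNReal.ofReal (min (l / w) w) =
      ENNReal.ofReal (1 / ((s - 1) / 2 + 1) + 1 / (-((s - 1) / 2))) * ENNReal.ofReal (w ^ s) := by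
  obtain ⟨hs1, hs2⟩ := abs_lt.1 hs
  set a := (s - 1) / 2 with ha
  have ha0 : a < 0 := by rw [ha]; linarith
  have ha1 : -1 < a := by rw [ha]; linarith
  have hw2 : (0 : ℝ) < w ^ 2 := by positivity
  have hsplit : Ioi (0 : ℝ) = Ioc 0 (w ^ 2) ∪ Ioi (w ^ 2) := (Ioc_union_Ioi_eq_Ioi hw2.le).symm
  rw [hsplit, lintegral_union measurableSet_Ioi (by
    rw [disjoint_left]
    intro t ht ht'
    exact absurd ht.2 (not_le.2 ht'))]
  have hsa : w ^ s = w ^ (2 * (a + 1)) / w := by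
    rw [eq_div_iff hw.ne', ← Real.rpow_add_one hw.ne']
    congr 1
    rw [ha]; ring
  have hsb : w ^ s = w * w ^ (2 * a) := by
    rw [mul_comm, ← Real.rpow_add_one hw.ne']
    congr 1
    rw [ha]; ring
  have h1 : ∫⁻ l in Ioc (0 : ℝ) (w ^ 2), ENNReal.ofReal (l ^ (a - 1)) *
      ENNReal.ofReal (min (l / w) w) = ENNReal.ofReal (1 / (a + 1) * w ^ s) := by
    have e : ∀ l ∈ Ioc (0 : ℝ) (w ^ 2), ENNReal.ofReal (l ^ (a - 1)) *
        ENNReal.ofReal (min (l / w) w) = ENNReal.ofReal (l ^ a / w) := by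
      intro l hl
      rw [← ENNReal.ofReal_mul (Real.rpow_nonneg hl.1.le _), min_eq_left (by
        rw [div_le_iff₀ hw, ← sq]; exact hl.2), ← mul_div_assoc, Real.rpow_sub_one hl.1.ne',
        div_mul_cancel₀ _ hl.1.ne']
    have hint : IntegrableOn (fun l : ℝ => l ^ a / w) (Ioc 0 (w ^ 2)) := by
      have := (intervalIntegral.intervalIntegrable_rpow' (a := 0) (b := w ^ 2) ha1).1
      exact this.div_const w
    rw [setLIntegral_congr_fun measurableSet_Ioc e, ← ofReal_integral_eq_lintegral_ofReal hint
      ((ae_restrict_iff' measurableSet_Ioc).2 (.of_forall fun l hl =>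
        div_nonneg (Real.rpow_nonneg hl.1.le _) hw.le))]
    congr 1
    rw [integral_div, ← intervalIntegral.integral_of_le hw2.le, integral_rpow (Or.inl ha1),
      Real.zero_rpow (by linarith), sub_zero, hsa, ← Real.rpow_natCast, ← Real.rpow_mul hw.le]
    push_cast
    field_simp
  have h2 : ∫⁻ l in Ioi (w ^ 2), ENNReal.ofReal (l ^ (a - 1)) *
      ENNReal.ofReal (min (l / w) w) = ENNReal.ofReal (1 / (-a) * w ^ s) := by
    have e : ∀ l ∈ Ioi (w ^ 2), ENNReal.ofReal (l ^ (a - 1)) *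
        ENNReal.ofReal (min (l / w) w) = ENNReal.ofReal (l ^ (a - 1) * w) := by
      intro l hl
      have hl0 : 0 < l := hw2.trans hl
      rw [← ENNReal.ofReal_mul (Real.rpow_nonneg hl0.le _), min_eq_right (by
        rw [le_div_iff₀ hw, ← sq]; exact le_of_lt hl)]
    have hint : IntegrableOn (fun l : ℝ => l ^ (a - 1) * w) (Ioi (w ^ 2)) :=
      (integrableOn_Ioi_rpow_of_lt (by linarith) hw2).mul_const w
    rw [setLIntegral_congr_fun measurableSet_Ioi e, ← ofReal_integral_eq_lintegral_ofReal hint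
      ((ae_restrict_iff' measurableSet_Ioi).2 (.of_forall fun l hl =>
        mul_nonneg (Real.rpow_nonneg (hw2.trans hl).le _) hw.le))]
    congr 1
    rw [integral_mul_const, integral_Ioi_rpow_of_lt (by linarith) hw2, sub_add_cancel, hsb,
      ← Real.rpow_natCast, ← Real.rpow_mul hw.le]
    push_cast
    field_simp
  have hws : 0 ≤ w ^ s := Real.rpow_nonneg hw.le s
  rw [h1, h2, ← ENNReal.ofReal_mul (add_nonneg (by
    rw [one_div]; exact inv_nonneg.2 (by linarith)) (by
      rw [one_div]; exact inv_nonneg.2 (by linarith))),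
    ← ENNReal.ofReal_add, add_mul]
  · exact mul_nonneg (by rw [one_div]; exact inv_nonneg.2 (by linarith)) hws
  · exact mul_nonneg (by rw [one_div]; exact inv_nonneg.2 (by linarith)) hws

/-- Up to a constant, `∫ wˢ dν` is a weighted integral over `λ > 0` of the (squared) `K`-functional
`∫ min(λ/w, w) dν` between the norms with weights `w⁻¹` and `w`. -/
theorem lintegral_rpow_eq_lintegral_kFunctional {Ω : Type*} [MeasurableSpace Ω] (ν : Measure Ω)
    [SFinite ν] {w : Ω → ℝ} (hw : Measurable w) (hpos : ∀ᵐ t ∂ν, 0 < w t) {s : ℝ} (hs : |s| < 1) :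
    ENNReal.ofReal (1 / ((s - 1) / 2 + 1) + 1 / (-((s - 1) / 2))) *
        ∫⁻ t, ENNReal.ofReal (w t ^ s) ∂ν =
      ∫⁻ l in Ioi (0 : ℝ), ENNReal.ofReal (l ^ ((s - 1) / 2 - 1)) *
        ∫⁻ t, ENNReal.ofReal (min (l / w t) (w t)) ∂ν := by
  have h1 : ∀ l : ℝ, ENNReal.ofReal (l ^ ((s - 1) / 2 - 1)) *
      ∫⁻ t, ENNReal.ofReal (min (l / w t) (w t)) ∂ν = ∫⁻ t, ENNReal.ofReal (l ^ ((s - 1) / 2 - 1)) *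
        ENNReal.ofReal (min (l / w t) (w t)) ∂ν := fun l =>
    (lintegral_const_mul _ (by fun_prop)).symm
  simp only [h1]
  rw [lintegral_lintegral_swap (by fun_prop), ← lintegral_const_mul _ (by fun_prop)]
  refine lintegral_congr_ae ?_
  filter_upwards [hpos] with t ht
  exact (lintegral_rpow_mul_min hs ht).symm

/-- Interpolation: a bound of `K`-functionals gives a bound of the intermediate norms. -/
theorem lintegral_rpow_le_of_kFunctional_le {Ω Ω' : Type*} [MeasurableSpace Ω] [MeasurableSpace Ω']
    (ν : Measure Ω) (ν' : Measure Ω') [SFinite ν] [SFinite ν'] {w : Ω → ℝ} {w' : Ω' → ℝ}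
    (hw : Measurable w) (hw' : Measurable w') (hpos : ∀ᵐ t ∂ν, 0 < w t)
    (hpos' : ∀ᵐ t ∂ν', 0 < w' t) {s : ℝ} (hs : |s| < 1) {C : ℝ≥0∞} (hC : C ≠ ⊤)
    (hK : ∀ l : ℝ, 0 < l → ∫⁻ t, ENNReal.ofReal (min (l / w t) (w t)) ∂ν ≤
      C * ∫⁻ t, ENNReal.ofReal (min (l / w' t) (w' t)) ∂ν') :
    ∫⁻ t, ENNReal.ofReal (w t ^ s) ∂ν ≤ C * ∫⁻ t, ENNReal.ofReal (w' t ^ s) ∂ν' := by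
  obtain ⟨hs1, hs2⟩ := abs_lt.1 hs
  have hc : ENNReal.ofReal (1 / ((s - 1) / 2 + 1) + 1 / (-((s - 1) / 2))) ≠ 0 := by
    rw [ne_eq, ENNReal.ofReal_eq_zero, not_le]
    exact add_pos (one_div_pos.2 (by linarith)) (one_div_pos.2 (by linarith))
  rw [← ENNReal.mul_le_mul_iff_right hc ENNReal.ofReal_ne_top, mul_left_comm,
    lintegral_rpow_eq_lintegral_kFunctional ν hw hpos hs,
    lintegral_rpow_eq_lintegral_kFunctional ν' hw' hpos' hs, ← lintegral_const_mul' _ _ hC]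
  refine setLIntegral_mono' measurableSet_Ioi fun l hl => ?_
  rw [mul_left_comm]
  exact mul_le_mul_right (hK l hl) _

end Interpolation

section Scale

variable {H : Type*} [NormedAddCommGroup H] [InnerProductSpace ℂ H] [CompleteSpace H]
variable {R : H →L[ℂ] H} (hR : IsSelfAdjoint R)

/-- The square of the norm of order `s` in the scale of the (unbounded) operator `|R|⁻¹`, that is
`‖|R|⁻ˢ x‖²`, with the value `∞` if `x` is not in the domain. -/
def scaleSq (s : ℝ) (x : H) : ℝ≥0∞ :=
  ∫⁻ t, ENNReal.ofReal (|t|⁻¹ ^ (2 * s)) ∂((spectralPVM hR).scalarMeasure x)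

theorem scaleSq_zero (x : H) : scaleSq hR 0 x = ENNReal.ofReal (‖x‖ ^ 2) := by
  simp [scaleSq, ← (spectralPVM hR).scalarMeasure_univ x]

theorem scaleSq_proj_le (s : ℝ) {S : Set ℝ} (hS : MeasurableSet S) (x : H) :
    scaleSq hR s ((spectralPVM hR).proj S x) ≤ scaleSq hR s x := by
  rw [scaleSq, ProjectionValuedMeasure.scalarMeasure_proj _ hS]
  exact setLIntegral_le_lintegral _ _

theorem scaleSq_apply (hinj : Function.Injective R) (s : ℝ) (x : H) :
    scaleSq hR s (R x) = scaleSq hR (s - 1) x := by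
  rw [scaleSq, scalarMeasure_apply_self, lintegral_withDensity_eq_lintegral_mul _ (by fun_prop)
    (by fun_prop), scaleSq]
  refine lintegral_congr_ae ?_
  filter_upwards [ae_ne_zero hR hinj x] with t ht
  have ht' : 0 < |t| := abs_pos.2 ht
  rw [Pi.mul_apply, ← ENNReal.ofReal_mul (sq_nonneg _)]
  congr 1
  rw [mul_sub, Real.rpow_sub (by positivity), mul_one, Real.rpow_ofNat, inv_pow, div_inv_eq_mul,
    sq_abs, mul_comm]

theorem scaleSq_sqrtAbsOp (hinj : Function.Injective R) (s : ℝ) (x : H) :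
    scaleSq hR s (sqrtAbsOp R x) = scaleSq hR (s - 1 / 2) x := by
  rw [scaleSq, sqrtAbsOp, scalarMeasure_cfc hR (by fun_prop),
    lintegral_withDensity_eq_lintegral_mul _ (by fun_prop) (by fun_prop), scaleSq]
  refine lintegral_congr_ae ?_
  filter_upwards [ae_ne_zero hR hinj x] with t ht
  have ht' : 0 < |t| := abs_pos.2 ht
  rw [Pi.mul_apply, ← ENNReal.ofReal_mul (sq_nonneg _)]
  congr 1
  rw [mul_sub, Real.rpow_sub (by positivity), Real.sq_sqrt ht'.le, mul_one_div_cancel two_ne_zero,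
    Real.rpow_one, div_inv_eq_mul, mul_comm]

theorem scaleSq_neg_half (hinj : Function.Injective R) (x : H) :
    scaleSq hR (-(1 / 2)) x = ENNReal.ofReal (‖sqrtAbsOp R x‖ ^ 2) := by
  rw [← scaleSq_zero hR, scaleSq_sqrtAbsOp hR hinj, zero_sub]

theorem scaleSq_neg_one (hinj : Function.Injective R) (x : H) :
    scaleSq hR (-1) x = ENNReal.ofReal (‖R x‖ ^ 2) := by
  rw [← scaleSq_zero hR, scaleSq_apply hR hinj, zero_sub]

theorem ae_abs_inv_pos (hinj : Function.Injective R) (x : H) :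
    ∀ᵐ t ∂((spectralPVM hR).scalarMeasure x), 0 < |t|⁻¹ :=
  (ae_ne_zero hR hinj x).mono fun _ ht => inv_pos.2 (abs_pos.2 ht)

/-- The `K`-functional between the norms of orders `-r` and `r` is at most its value on a
decomposition. -/
theorem kFunctional_add_le {r : ℝ} (l : ℝ) (a b : H) :
    ∫⁻ t, ENNReal.ofReal (min (l / |t|⁻¹ ^ (2 * r)) (|t|⁻¹ ^ (2 * r)))
        ∂((spectralPVM hR).scalarMeasure (a + b)) ≤
      2 * (ENNReal.ofReal l * scaleSq hR (-r) a + scaleSq hR r b) := by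
  refine (lintegral_mono' ((spectralPVM hR).scalarMeasure_add_le a b) le_rfl).trans ?_
  rw [lintegral_smul_measure, lintegral_add_measure]
  refine mul_le_mul_right (add_le_add ?_ ?_) _
  · rw [scaleSq, ← lintegral_const_mul _ (by fun_prop)]
    refine lintegral_mono fun t => ?_
    have h0 : 0 ≤ |t|⁻¹ := by positivity
    rw [← ENNReal.ofReal_mul' (by positivity), mul_neg, Real.rpow_neg h0, ← div_eq_mul_inv]
    exact ENNReal.ofReal_le_ofReal (min_le_left _ _)
  · exact lintegral_mono fun t => ENNReal.ofReal_le_ofReal (min_le_right _ _)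

/-- The spectral cutoff realizes the `K`-functional. -/
theorem kFunctional_eq_cutoff {r l : ℝ} (hl : 0 < l) (x : H) :
    ENNReal.ofReal l * scaleSq hR (-r) ((spectralPVM hR).proj {t | |t|⁻¹ ^ (2 * r) ≤
        l / |t|⁻¹ ^ (2 * r)}ᶜ x) +
      scaleSq hR r ((spectralPVM hR).proj {t | |t|⁻¹ ^ (2 * r) ≤ l / |t|⁻¹ ^ (2 * r)} x) =
    ∫⁻ t, ENNReal.ofReal (min (l / |t|⁻¹ ^ (2 * r)) (|t|⁻¹ ^ (2 * r)))
        ∂((spectralPVM hR).scalarMeasure x) := by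
  have hS : MeasurableSet {t : ℝ | |t|⁻¹ ^ (2 * r) ≤ l / |t|⁻¹ ^ (2 * r)} :=
    measurableSet_le (by fun_prop) (by fun_prop)
  rw [scaleSq, scaleSq, ProjectionValuedMeasure.scalarMeasure_proj _ hS,
    ProjectionValuedMeasure.scalarMeasure_proj _ hS.compl, ← lintegral_const_mul _ (by fun_prop),
    ← lintegral_add_compl (μ := (spectralPVM hR).scalarMeasure x)
      (fun t => ENNReal.ofReal (min (l / |t|⁻¹ ^ (2 * r)) (|t|⁻¹ ^ (2 * r)))) hS, add_comm]
  congr 1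
  · refine setLIntegral_congr_fun hS fun t ht => ?_
    simp only [min_eq_right (show |t|⁻¹ ^ (2 * r) ≤ l / |t|⁻¹ ^ (2 * r) from ht)]
  · refine setLIntegral_congr_fun hS.compl fun t ht => ?_
    have ht' : l / |t|⁻¹ ^ (2 * r) ≤ |t|⁻¹ ^ (2 * r) := le_of_not_ge ht
    have h0 : 0 ≤ |t|⁻¹ := by positivity
    simp only [min_eq_left ht']
    rw [← ENNReal.ofReal_mul hl.le, mul_neg, Real.rpow_neg h0, ← div_eq_mul_inv]

theorem proj_compl_add_proj {S : Set ℝ} (hS : MeasurableSet S) (x : H) :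
    (spectralPVM hR).proj Sᶜ x + (spectralPVM hR).proj S x = x := by
  rw [← (spectralPVM hR).proj_union hS.compl hS disjoint_compl_left, compl_union_self,
    (spectralPVM hR).proj_univ, one_apply_eq_self]

/-- Interpolation between the norms of orders `-1/2` and `1/2` in the scale of `|R|⁻¹`. -/
theorem scaleSq_apply_le_of_half (hinj : Function.Injective R) {X : H →L[ℂ] H} {C : ℝ≥0∞}
    (hC : C ≠ ⊤) (h1 : ∀ x, scaleSq hR (-(1 / 2)) (X x) ≤ C * scaleSq hR (-(1 / 2)) x)
    (h2 : ∀ x, scaleSq hR (1 / 2) (X x) ≤ C * scaleSq hR (1 / 2) x) {s : ℝ} (hs : |s| ≤ 1 / 2)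
    (x : H) : scaleSq hR s (X x) ≤ 2 * C * scaleSq hR s x := by
  have hle : ∀ a : ℝ≥0∞, C * a ≤ 2 * C * a := fun a => by
    rw [mul_assoc, two_mul]
    exact le_self_add
  rcases hs.lt_or_eq with hs' | hs'
  · have h := lintegral_rpow_le_of_kFunctional_le ((spectralPVM hR).scalarMeasure (X x))
      ((spectralPVM hR).scalarMeasure x) (w := fun t => |t|⁻¹) (w' := fun t => |t|⁻¹)
      (by fun_prop) (by fun_prop) (ae_abs_inv_pos hR hinj _) (ae_abs_inv_pos hR hinj _)
      (s := 2 * s) (by rw [abs_mul, abs_two]; linarith) (C := 2 * C)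
      (ENNReal.mul_ne_top (by simp) hC) (fun l hl => by
        have hS : MeasurableSet {t : ℝ | |t|⁻¹ ^ (2 * (1 / 2) : ℝ) ≤
            l / |t|⁻¹ ^ (2 * (1 / 2) : ℝ)} :=
          measurableSet_le (by fun_prop) (by fun_prop)
        have e := kFunctional_eq_cutoff hR (r := 1 / 2) hl x
        have e2 := kFunctional_add_le hR (r := 1 / 2) l (X ((spectralPVM hR).proj
            {t : ℝ | |t|⁻¹ ^ (2 * (1 / 2) : ℝ) ≤ l / |t|⁻¹ ^ (2 * (1 / 2) : ℝ)}ᶜ x))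
          (X ((spectralPVM hR).proj
            {t : ℝ | |t|⁻¹ ^ (2 * (1 / 2) : ℝ) ≤ l / |t|⁻¹ ^ (2 * (1 / 2) : ℝ)} x))
        rw [← map_add, proj_compl_add_proj hR hS] at e2
        simp only [mul_one_div_cancel (two_ne_zero' ℝ), Real.rpow_one] at e e2
        rw [← e]
        refine e2.trans ?_
        refine (mul_le_mul_right (add_le_add (mul_le_mul_right (h1 _) _) (h2 _)) _).trans
          (le_of_eq ?_)
        ring)
    exact h
  · rcases eq_or_eq_neg_of_abs_eq hs' with rfl | rfl
    · exact (h2 x).trans (hle _)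
    · exact (h1 x).trans (hle _)

/-- The pairing of vectors of orders `1/2` and `-1/2` is bounded by their norms. -/
theorem norm_inner_le_of_scaleSq_half_le (hinj : Function.Injective R) {y : H} {A : ℝ}
    (hA : 0 ≤ A) (hy : scaleSq hR (1 / 2) y ≤ ENNReal.ofReal (A ^ 2)) (x : H) :
    ‖inner ℂ y x‖ ≤ A * ‖sqrtAbsOp R x‖ := by
  set P := spectralPVM hR
  have hm' : ∀ k : ℕ, MeasurableSet {t : ℝ | 1 / ((k : ℝ) + 1) ≤ |t|} := fun k =>
    measurableSet_le measurable_const (by fun_prop)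
  refine le_of_tendsto' ((tendsto_proj_compl_ball hR hinj y).inner tendsto_const_nhds).norm
    fun k => ?_
  set yk := P.proj {t : ℝ | 1 / ((k : ℝ) + 1) ≤ |t|} y with hyk
  have hk : (0 : ℝ) < 1 / ((k : ℝ) + 1) := by positivity
  set g : ℝ → ℝ := fun t => 1 / Real.sqrt (max |t| (1 / ((k : ℝ) + 1))) with hg
  have hgc : Continuous g := by
    refine continuous_const.div (by fun_prop) fun t => ?_
    exact (Real.sqrt_pos.2 (lt_max_of_lt_right hk)).ne'
  have hmz : sqrtAbsOp R (cfc g R yk) = yk := by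
    have h1 : sqrtAbsOp R (cfc g R yk) = cfc (fun t => Real.sqrt |t| * g t) R yk := by
      rw [cfc_mul _ g R (by fun_prop) hgc.continuousOn]
      rfl
    have h2 : cfc (fun _ : ℝ => (1 : ℝ)) R yk = yk := by
      rw [cfc_const_one ℝ R, one_apply_eq_self]
    rw [h1]
    refine (cfc_apply_proj_eq hR (f := fun t => Real.sqrt |t| * g t) (g := fun _ => 1)
      (Continuous.mul (by fun_prop) hgc) continuous_const (hm' k)
      (fun t ht => ?_) y).trans h2
    have ht' : 1 / ((k : ℝ) + 1) ≤ |t| := ht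
    simp only [hg, max_eq_left ht']
    exact mul_one_div_cancel (Real.sqrt_pos.2 (hk.trans_le ht')).ne'
  have hz : ‖cfc g R yk‖ ≤ A := by
    refine le_of_sq_le_sq ?_ hA
    rw [← ENNReal.ofReal_le_ofReal_iff (sq_nonneg A)]
    refine le_trans ?_ hy
    rw [lintegral_scalarMeasure_sq hR hgc, P.scalarMeasure_proj (hm' k), scaleSq]
    refine (setLIntegral_mono' (hm' k) fun t ht => ?_).trans (setLIntegral_le_lintegral _ _)
    have ht' : 1 / ((k : ℝ) + 1) ≤ |t| := ht
    simp only [hg, max_eq_left ht']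
    rw [mul_one_div_cancel (two_ne_zero' ℝ), Real.rpow_one, div_pow, Real.sq_sqrt (abs_nonneg t)]
    simp
  have hsym := (ContinuousLinearMap.isSelfAdjoint_iff_isSymmetric.1
    (isSelfAdjoint_sqrtAbsOp (R := R))) (cfc g R yk) x
  simp only [ContinuousLinearMap.coe_coe] at hsym
  rw [hmz] at hsym
  rw [hsym]
  exact (norm_inner_le_norm _ _).trans (mul_le_mul_of_nonneg_right hz (norm_nonneg _))

/-- The norm of order `1/2` is attained in the duality with the norm of order `-1/2`: the pairing is
tested on vectors `g(R) y`, with bounded `g` increasing to `t ↦ |t|⁻¹`. -/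
theorem scaleSq_half_le_of_norm_inner_le (hinj : Function.Injective R) {y : H} {A : ℝ}
    (h : ∀ x, ‖inner ℂ y x‖ ≤ A * ‖sqrtAbsOp R x‖) :
    scaleSq hR (1 / 2) y ≤ ENNReal.ofReal (A ^ 2) := by
  set ν := (spectralPVM hR).scalarMeasure y with hν
  set g : ℕ → ℝ → ℝ := fun k t => (max |t| (1 / ((k : ℝ) + 1)))⁻¹ with hg
  have hk : ∀ k : ℕ, (0 : ℝ) < 1 / ((k : ℝ) + 1) := fun k => by positivity
  have hpos : ∀ (k : ℕ) (t : ℝ), 0 < max |t| (1 / ((k : ℝ) + 1)) := fun k t =>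
    lt_max_of_lt_right (hk k)
  have hgc : ∀ k, Continuous (g k) := fun k =>
    Continuous.inv₀ (by fun_prop) fun t => (hpos k t).ne'
  have hbound : ∀ k, ∫⁻ t, ENNReal.ofReal (g k t) ∂ν ≤ ENNReal.ofReal (A ^ 2) := by
    intro k
    have hi : ∫⁻ t, ENNReal.ofReal (g k t) ∂ν =
        ENNReal.ofReal (RCLike.re (inner ℂ y (cfc (g k) R y))) := by
      rw [re_inner_cfc hR (hgc k), ofReal_integral_eq_lintegral_ofReal
        (integrable_scalarMeasure hR (hgc k) y)
        (.of_forall fun t => inv_nonneg.2 (hpos k t).le)]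
    have h1 : ENNReal.ofReal (‖sqrtAbsOp R (cfc (g k) R y)‖ ^ 2) ≤
        ∫⁻ t, ENNReal.ofReal (g k t) ∂ν := by
      have e : sqrtAbsOp R (cfc (g k) R y) = cfc (fun t => Real.sqrt |t| * g k t) R y := by
        rw [cfc_mul _ (g k) R (by fun_prop) (hgc k).continuousOn]
        rfl
      rw [e, lintegral_scalarMeasure_sq hR (f := fun t => Real.sqrt |t| * g k t)
        (Continuous.mul (by fun_prop) (hgc k))]
      refine lintegral_mono fun t => ENNReal.ofReal_le_ofReal ?_
      rw [mul_pow, Real.sq_sqrt (abs_nonneg t), sq, ← mul_assoc]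
      refine mul_le_of_le_one_left (inv_nonneg.2 (hpos k t).le) ?_
      rw [← div_eq_mul_inv, div_le_one (hpos k t)]
      exact le_max_left _ _
    rw [hi] at h1 ⊢
    set a := RCLike.re (inner ℂ y (cfc (g k) R y)) with ha
    have h2 : a ≤ A * ‖sqrtAbsOp R (cfc (g k) R y)‖ := (RCLike.re_le_norm _).trans (h _)
    rcases le_or_gt a 0 with ha0 | ha0
    · rw [ENNReal.ofReal_of_nonpos ha0]
      exact bot_le
    have h3 : ‖sqrtAbsOp R (cfc (g k) R y)‖ ^ 2 ≤ a := (ENNReal.ofReal_le_ofReal_iff ha0.le).1 h1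
    refine ENNReal.ofReal_le_ofReal ?_
    have h4 : a ^ 2 ≤ A ^ 2 * a := by
      calc a ^ 2 ≤ (A * ‖sqrtAbsOp R (cfc (g k) R y)‖) ^ 2 := pow_le_pow_left₀ ha0.le h2 2
        _ = A ^ 2 * ‖sqrtAbsOp R (cfc (g k) R y)‖ ^ 2 := by ring
        _ ≤ _ := by gcongr
    nlinarith
  have hlim : Tendsto (fun k => ∫⁻ t, ENNReal.ofReal (g k t) ∂ν) atTop
      (𝓝 (∫⁻ t, ENNReal.ofReal (|t|⁻¹ ^ (2 * (1 / 2) : ℝ)) ∂ν)) := by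
    refine lintegral_tendsto_of_tendsto_of_monotone (fun k => ?_) ?_ ?_
    · exact (ENNReal.measurable_ofReal.comp (hgc k).measurable).aemeasurable
    · refine .of_forall fun t k l hkl => ENNReal.ofReal_le_ofReal ?_
      refine inv_anti₀ (hpos l t) (max_le_max le_rfl ?_)
      gcongr
    · filter_upwards [ae_ne_zero hR hinj y] with t ht
      refine (ENNReal.continuous_ofReal.tendsto _).comp ?_
      rw [mul_one_div_cancel (two_ne_zero' ℝ), Real.rpow_one]
      have h5 : Tendsto (fun k : ℕ => max |t| (1 / ((k : ℝ) + 1))) atTop (𝓝 (max |t| 0)) :=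
        tendsto_const_nhds.max tendsto_one_div_add_atTop_nhds_zero_nat
      rw [max_eq_left (abs_nonneg t)] at h5
      exact h5.inv₀ (abs_pos.2 ht).ne'
  exact le_of_tendsto' hlim hbound

/-- A bound of a self-adjoint operator in the norm of order `-1/2` gives by duality the same bound
in the norm of order `1/2`. -/
theorem scaleSq_half_apply_le (hinj : Function.Injective R) {X : H →L[ℂ] H} (hX : IsSelfAdjoint X)
    {κ : ℝ} (hκ : 0 < κ) (h : ∀ x, ‖sqrtAbsOp R (X x)‖ ≤ κ * ‖sqrtAbsOp R x‖) (y : H) :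
    scaleSq hR (1 / 2) (X y) ≤ ENNReal.ofReal (κ ^ 2) * scaleSq hR (1 / 2) y := by
  rcases eq_or_ne (scaleSq hR (1 / 2) y) ⊤ with hy | hy
  · rw [hy, ENNReal.mul_top]
    · exact le_top
    · rw [ne_eq, ENNReal.ofReal_eq_zero, not_le]
      positivity
  set A := Real.sqrt (scaleSq hR (1 / 2) y).toReal with hA
  have hA2 : scaleSq hR (1 / 2) y = ENNReal.ofReal (A ^ 2) := by
    rw [hA, Real.sq_sqrt ENNReal.toReal_nonneg, ENNReal.ofReal_toReal hy]
  rw [hA2, ← ENNReal.ofReal_mul (sq_nonneg _), ← mul_pow]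
  refine scaleSq_half_le_of_norm_inner_le hR hinj fun x => ?_
  have h1 := (ContinuousLinearMap.isSelfAdjoint_iff_isSymmetric.1 hX) y x
  simp only [ContinuousLinearMap.coe_coe] at h1
  rw [h1]
  refine (norm_inner_le_of_scaleSq_half_le hR hinj (Real.sqrt_nonneg _) hA2.le (X x)).trans ?_
  calc A * ‖sqrtAbsOp R (X x)‖ ≤ A * (κ * ‖sqrtAbsOp R x‖) :=
        mul_le_mul_of_nonneg_left (h x) (Real.sqrt_nonneg _)
    _ = _ := by ring

/-- The main estimate: the positive spectral projections of operators with close inverses `R`, `R'`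
are close in all norms of order `s`, `|s| ≤ 1/2`. -/
theorem scaleSq_posProj_sub_le (hinj : Function.Injective R) {R' : H →L[ℂ] H}
    (hR' : IsSelfAdjoint R') (hinj' : Function.Injective R') {ε : ℝ} (hε : 0 < ε)
    (h : ∀ x, ‖R x - R' x‖ ≤ ε * ‖R' x‖) (h1 : ∀ x, ‖R x‖ ≤ 2 * ‖R' x‖)
    (h2 : ∀ x, ‖R' x‖ ≤ 2 * ‖R x‖) {s : ℝ} (hs : |s| ≤ 1 / 2) (x : H) :
    scaleSq hR s (posProj hR x - posProj hR' x) ≤ ENNReal.ofReal (ε ^ 2) * scaleSq hR s x := by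
  have hX : ∀ y, posProj hR y - posProj hR' y =
      (((1 / 2 : ℝ) : ℂ) • (signOp hR - signOp hR')) y := by
    intro y
    simp only [signOp, _root_.smul_apply, _root_.sub_apply, one_apply_eq_self]
    push_cast
    module
  set X : H →L[ℂ] H := ((1 / 2 : ℝ) : ℂ) • (signOp hR - signOp hR') with hXdef
  have hXsa : IsSelfAdjoint X := by
    refine IsSelfAdjoint.smul ?_ ((isSelfAdjoint_signOp hR).sub (isSelfAdjoint_signOp hR'))
    rw [isSelfAdjoint_iff]
    exact Complex.conj_ofReal _
  have hb : ∀ y, ‖sqrtAbsOp R (X y)‖ ≤ (Real.sqrt 2 / 2 * ε) * ‖sqrtAbsOp R y‖ := by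
    intro y
    have e1 := norm_sqrtAbsOp_signOp_sub_le hR hR' hinj' hε.le (by norm_num) h h1 y
    have e2 := norm_sqrtAbsOp_sq_le hR hR' (C := 2) (by norm_num) h2 y
    have e3 : ‖sqrtAbsOp R' y‖ ≤ Real.sqrt 2 * ‖sqrtAbsOp R y‖ := by
      rw [← Real.sqrt_sq (norm_nonneg (sqrtAbsOp R' y)),
        ← Real.sqrt_sq (norm_nonneg (sqrtAbsOp R y)),
        ← Real.sqrt_mul (by norm_num)]
      exact Real.sqrt_le_sqrt e2
    rw [hXdef, _root_.smul_apply, map_smul, norm_smul, Complex.norm_real, _root_.sub_apply,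
      Real.norm_of_nonneg (by norm_num)]
    calc 1 / 2 * ‖sqrtAbsOp R (signOp hR y - signOp hR' y)‖
        ≤ 1 / 2 * (ε * (Real.sqrt 2 * ‖sqrtAbsOp R y‖)) := by gcongr; exact e1.trans (by gcongr)
      _ = _ := by ring
  have hκ : 0 < Real.sqrt 2 / 2 * ε := by positivity
  have hfin := scaleSq_apply_le_of_half hR hinj (X := X)
    (C := ENNReal.ofReal ((Real.sqrt 2 / 2 * ε) ^ 2)) ENNReal.ofReal_ne_top (fun y => by
      rw [scaleSq_neg_half hR hinj, scaleSq_neg_half hR hinj, ← ENNReal.ofReal_mul (sq_nonneg _),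
        ← mul_pow]
      exact ENNReal.ofReal_le_ofReal (pow_le_pow_left₀ (norm_nonneg _) (hb y) 2))
    (scaleSq_half_apply_le hR hinj hXsa hκ hb) hs x
  rw [hX]
  refine hfin.trans (le_of_eq ?_)
  rw [← ENNReal.ofReal_ofNat, ← ENNReal.ofReal_mul (by norm_num)]
  congr 2
  rw [mul_pow, div_pow, Real.sq_sqrt (by norm_num)]
  ring

end Scale

/-! ### Bessel norms of Schwartz functions -/

section Schwartz

open scoped LineDeriv FourierTransform
open FourierTransform

variable {n : ℕ} {F : Type*} [NormedAddCommGroup F] [InnerProductSpace ℂ F] [FiniteDimensional ℂ F]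

/-- The map `f ↦ Λˢ f` from the Schwartz space to `L²(ℝⁿ; F)`, where `Λˢ` is the Fourier multiplier
with symbol `(1 + |ξ|²)^(s/2)`. -/
def besselMap (s : ℝ) : 𝓢(EuclideanSpace ℝ (Fin n), F) →ₗ[ℂ]
    Lp F 2 (volume : Measure (EuclideanSpace ℝ (Fin n))) :=
  (SchwartzMap.toLpCLM ℂ F 2 (volume : Measure (EuclideanSpace ℝ (Fin n)))).toLinearMap ∘ₗ
    (SchwartzMap.fourierMultiplierCLM F
      (fun ξ : EuclideanSpace ℝ (Fin n) => (((1 + ‖ξ‖ ^ 2) ^ (s / 2) : ℝ) : ℂ))).toLinearMap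

/-- The norm `‖Λˢ f‖` in `L²(ℝⁿ; F)` of a Schwartz function. -/
def besselNorm (s : ℝ) (f : 𝓢(EuclideanSpace ℝ (Fin n), F)) : ℝ :=
  ‖besselMap s f‖

theorem besselMap_apply (s : ℝ) (f : 𝓢(EuclideanSpace ℝ (Fin n), F)) :
    besselMap s f = (SchwartzMap.fourierMultiplierCLM F
      (fun ξ : EuclideanSpace ℝ (Fin n) => (((1 + ‖ξ‖ ^ 2) ^ (s / 2) : ℝ) : ℂ)) f).toLp 2
        (volume : Measure (EuclideanSpace ℝ (Fin n))) := rfl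

theorem besselNorm_nonneg (s : ℝ) (f : 𝓢(EuclideanSpace ℝ (Fin n), F)) : 0 ≤ besselNorm s f :=
  norm_nonneg _

theorem besselNorm_add_le (s : ℝ) (f g : 𝓢(EuclideanSpace ℝ (Fin n), F)) :
    besselNorm s (f + g) ≤ besselNorm s f + besselNorm s g := by
  simp only [besselNorm, LinearMap.map_add]
  exact norm_add_le _ _

theorem besselNorm_sum_le {ι : Type*} (t : Finset ι) (s : ℝ)
    (f : ι → 𝓢(EuclideanSpace ℝ (Fin n), F)) :
    besselNorm s (∑ i ∈ t, f i) ≤ ∑ i ∈ t, besselNorm s (f i) := by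
  simp only [besselNorm, map_sum]
  exact norm_sum_le _ _

theorem fourier_fourierMultiplierCLM_apply {g : EuclideanSpace ℝ (Fin n) → ℂ}
    (hg : g.HasTemperateGrowth) (f : 𝓢(EuclideanSpace ℝ (Fin n), F))
    (ξ : EuclideanSpace ℝ (Fin n)) :
    𝓕 (SchwartzMap.fourierMultiplierCLM F g f) ξ = g ξ • 𝓕 f ξ := by
  rw [SchwartzMap.fourierMultiplierCLM_apply, fourier_fourierInv_eq,
    SchwartzMap.smulLeftCLM_apply_apply hg]

theorem hasTemperateGrowth_bessel (s : ℝ) :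
    (fun ξ : EuclideanSpace ℝ (Fin n) =>
      (((1 + ‖ξ‖ ^ 2) ^ (s / 2) : ℝ) : ℂ)).HasTemperateGrowth :=
  Function.HasTemperateGrowth.comp (Function.RCLike.hasTemperateGrowth_ofReal (𝕜 := ℂ))
    (Function.hasTemperateGrowth_one_add_norm_sq_rpow (EuclideanSpace ℝ (Fin n)) (s / 2))

theorem ofReal_norm_toLp_sq (f : 𝓢(EuclideanSpace ℝ (Fin n), F)) :
    ENNReal.ofReal (‖f.toLp 2 (volume : Measure (EuclideanSpace ℝ (Fin n)))‖ ^ 2) =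
      ∫⁻ x, ENNReal.ofReal (‖f x‖ ^ 2) := by
  have h : ∫ x, ‖f x‖ ^ 2 = ‖f.toLp 2 (volume : Measure (EuclideanSpace ℝ (Fin n)))‖ ^ 2 := by
    have h1 := SchwartzMap.inner_toL2_toL2_eq f f
    rw [inner_self_eq_norm_sq_to_K] at h1
    have h2 : ∀ x, inner ℂ (f x) (f x) = ((‖f x‖ ^ 2 : ℝ) : ℂ) := fun x => by
      rw [inner_self_eq_norm_sq_to_K]; norm_cast
    simp only [h2] at h1
    rw [integral_complex_ofReal] at h1
    apply Complex.ofReal_injective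
    rw [← h1]
    norm_cast
  rw [← h, ofReal_integral_eq_lintegral_ofReal _ (.of_forall fun x => by positivity)]
  exact (f.memLp 2 volume).integrable_norm_pow (by norm_num)

theorem ofReal_besselNorm_sq (s : ℝ) (f : 𝓢(EuclideanSpace ℝ (Fin n), F)) :
    ENNReal.ofReal (besselNorm s f ^ 2) =
      ∫⁻ ξ, ENNReal.ofReal ((1 + ‖ξ‖ ^ 2) ^ s * ‖𝓕 f ξ‖ ^ 2) := by
  rw [besselNorm, besselMap_apply, ← SchwartzMap.norm_fourier_toL2_eq,
    ofReal_norm_toLp_sq]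
  refine lintegral_congr fun ξ => ?_
  rw [fourier_fourierMultiplierCLM_apply (hasTemperateGrowth_bessel s), norm_smul, mul_pow,
    Complex.norm_real, Real.norm_of_nonneg (by positivity), ← Real.rpow_mul_natCast (by positivity)]
  norm_num

theorem ofReal_besselNorm_zero_sq (f : 𝓢(EuclideanSpace ℝ (Fin n), F)) :
    ENNReal.ofReal (besselNorm 0 f ^ 2) = ∫⁻ x, ENNReal.ofReal (‖f x‖ ^ 2) := by
  rw [ofReal_besselNorm_sq, ← ofReal_norm_toLp_sq, ← SchwartzMap.norm_fourier_toL2_eq,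
    ofReal_norm_toLp_sq]
  simp

theorem besselNorm_zero_eq (f : 𝓢(EuclideanSpace ℝ (Fin n), F)) :
    besselNorm 0 f = (eLpNorm f 2 volume).toReal := by
  rw [← SchwartzMap.norm_toLp, ← sq_eq_sq₀ (besselNorm_nonneg _ _) (norm_nonneg _),
    ← ENNReal.ofReal_eq_ofReal_iff (by positivity) (by positivity), ofReal_besselNorm_zero_sq,
    ofReal_norm_toLp_sq]

theorem besselNorm_le_of_fourier {s t : ℝ} {f : 𝓢(EuclideanSpace ℝ (Fin n), F)} {C : ℝ}
    (hC : 0 ≤ C) {g : 𝓢(EuclideanSpace ℝ (Fin n), F)}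
    (h : ∀ ξ, (1 + ‖ξ‖ ^ 2) ^ s * ‖𝓕 f ξ‖ ^ 2 ≤ C ^ 2 * ((1 + ‖ξ‖ ^ 2) ^ t * ‖𝓕 g ξ‖ ^ 2)) :
    besselNorm s f ≤ C * besselNorm t g := by
  refine le_of_sq_le_sq ?_ (mul_nonneg hC (besselNorm_nonneg _ _))
  rw [← ENNReal.ofReal_le_ofReal_iff (sq_nonneg _), mul_pow, ENNReal.ofReal_mul (sq_nonneg _),
    ofReal_besselNorm_sq, ofReal_besselNorm_sq, ← lintegral_const_mul' _ _ ENNReal.ofReal_ne_top]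
  refine lintegral_mono fun ξ => ?_
  rw [← ENNReal.ofReal_mul (sq_nonneg _)]
  exact ENNReal.ofReal_le_ofReal (h ξ)

theorem besselNorm_mono {s t : ℝ} (hst : s ≤ t) (f : 𝓢(EuclideanSpace ℝ (Fin n), F)) :
    besselNorm s f ≤ besselNorm t f := by
  rw [← one_mul (besselNorm t f)]
  refine besselNorm_le_of_fourier zero_le_one fun ξ => ?_
  rw [one_pow, one_mul]
  gcongr
  linarith [sq_nonneg ‖ξ‖]

theorem norm_fourier_lineDeriv (f : 𝓢(EuclideanSpace ℝ (Fin n), F)) (j : Fin n)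
    (ξ : EuclideanSpace ℝ (Fin n)) :
    ‖𝓕 (∂_{EuclideanSpace.single j (1 : ℝ)} f) ξ‖ = 2 * Real.pi * |ξ j| * ‖𝓕 f ξ‖ := by
  rw [SchwartzMap.fourier_lineDerivOp_eq, _root_.smul_apply,
    SchwartzMap.smulLeftCLM_apply_apply (by fun_prop), norm_smul, norm_smul]
  simp [EuclideanSpace.inner_single_right, abs_of_pos Real.pi_pos]
  ring

theorem abs_apply_le_norm (ξ : EuclideanSpace ℝ (Fin n)) (j : Fin n) : |ξ j| ≤ ‖ξ‖ := by
  simpa using PiLp.norm_apply_le ξ j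

theorem besselNorm_lineDeriv_le (s : ℝ) (f : 𝓢(EuclideanSpace ℝ (Fin n), F)) (j : Fin n) :
    besselNorm s (∂_{EuclideanSpace.single j (1 : ℝ)} f) ≤
      2 * Real.pi * besselNorm (s + 1) f := by
  refine besselNorm_le_of_fourier (by positivity) fun ξ => ?_
  rw [norm_fourier_lineDeriv, Real.rpow_add_one (by positivity)]
  have h1 : |ξ j| ^ 2 ≤ 1 + ‖ξ‖ ^ 2 := by
    have := pow_le_pow_left₀ (abs_nonneg _) (abs_apply_le_norm ξ j) 2
    linarith
  calc (1 + ‖ξ‖ ^ 2) ^ s * (2 * Real.pi * |ξ j| * ‖𝓕 f ξ‖) ^ 2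
      = (2 * Real.pi) ^ 2 * ((1 + ‖ξ‖ ^ 2) ^ s * |ξ j| ^ 2 * ‖𝓕 f ξ‖ ^ 2) := by ring
    _ ≤ _ := by gcongr

/-- Plancherel and the Cauchy–Schwarz inequality: the norms of orders `-s` and `s` are dual. -/
theorem norm_integral_inner_le (s : ℝ) (f g : 𝓢(EuclideanSpace ℝ (Fin n), F)) :
    ‖∫ x, inner ℂ (f x) (g x)‖ ≤ besselNorm (-s) f * besselNorm s g := by
  refine le_trans (le_of_eq ?_) (norm_inner_le_norm (𝕜 := ℂ) (besselMap (-s) f) (besselMap s g))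
  refine Eq.trans ?_ (congrArg norm (SchwartzMap.inner_toL2_toL2_eq
    (SchwartzMap.fourierMultiplierCLM F
      (fun ξ : EuclideanSpace ℝ (Fin n) => (((1 + ‖ξ‖ ^ 2) ^ (-s / 2) : ℝ) : ℂ)) f)
    (SchwartzMap.fourierMultiplierCLM F
      (fun ξ : EuclideanSpace ℝ (Fin n) => (((1 + ‖ξ‖ ^ 2) ^ (s / 2) : ℝ) : ℂ)) g)).symm)
  rw [← SchwartzMap.integral_inner_fourier_fourier f g,
    ← SchwartzMap.integral_inner_fourier_fourier (SchwartzMap.fourierMultiplierCLM F _ f) _]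
  congr 2
  funext ξ
  rw [fourier_fourierMultiplierCLM_apply (hasTemperateGrowth_bessel _),
    fourier_fourierMultiplierCLM_apply (hasTemperateGrowth_bessel _), inner_smul_left,
    inner_smul_right, Complex.conj_ofReal, ← mul_assoc, ← Complex.ofReal_mul,
    ← Real.rpow_add (by positivity)]
  simp [neg_div]

theorem besselNorm_zero_le_sum {ι : Type*} (t : Finset ι) {h : 𝓢(EuclideanSpace ℝ (Fin n), F)}
    {f : ι → 𝓢(EuclideanSpace ℝ (Fin n), F)} {c : ι → ℝ} (hc : ∀ i, 0 ≤ c i)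
    (hle : ∀ x, ‖h x‖ ≤ ∑ i ∈ t, c i * ‖f i x‖) :
    besselNorm 0 h ≤ ∑ i ∈ t, c i * besselNorm 0 (f i) := by
  have h1 : eLpNorm h 2 volume ≤ ∑ i ∈ t, ENNReal.ofReal (c i) * eLpNorm (f i) 2 volume := by
    calc eLpNorm h 2 volume ≤ eLpNorm (∑ i ∈ t, fun x => c i * ‖f i x‖) 2 volume := by
          refine eLpNorm_mono_real fun x => ?_
          simpa using hle x
      _ ≤ ∑ i ∈ t, eLpNorm (fun x => c i * ‖f i x‖) 2 volume :=
          eLpNorm_sum_le (fun i _ => (continuous_const.mul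
            (f i).continuous.norm).aestronglyMeasurable) (by norm_num)
      _ = _ := by
          refine Finset.sum_congr rfl fun i _ => ?_
          have : (fun x => c i * ‖f i x‖) = c i • fun x => ‖f i x‖ := rfl
          rw [this, eLpNorm_const_smul, eLpNorm_norm, Real.enorm_of_nonneg (hc i)]
  have hfin : ∀ i ∈ t, ENNReal.ofReal (c i) * eLpNorm (f i) 2 volume ≠ ⊤ := fun i _ =>
    ENNReal.mul_ne_top ENNReal.ofReal_ne_top ((f i).memLp 2 volume).eLpNorm_ne_top
  have h2 := ENNReal.toReal_mono (ENNReal.sum_ne_top.2 hfin) h1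
  rw [ENNReal.toReal_sum hfin] at h2
  simpa [besselNorm_zero_eq, ENNReal.toReal_mul, ENNReal.toReal_ofReal, hc] using h2

theorem besselNorm_zero_le {h f : 𝓢(EuclideanSpace ℝ (Fin n), F)} {c : ℝ} (hc : 0 ≤ c)
    (hle : ∀ x, ‖h x‖ ≤ c * ‖f x‖) : besselNorm 0 h ≤ c * besselNorm 0 f := by
  simpa using besselNorm_zero_le_sum (Finset.univ : Finset Unit) (f := fun _ => f)
    (c := fun _ => c) (fun _ => hc) (by simpa using hle)

theorem sq_besselNorm_le_of_fourier {s : ℝ} {f : 𝓢(EuclideanSpace ℝ (Fin n), F)} {ι : Type*}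
    (t : Finset ι) (g : ι → 𝓢(EuclideanSpace ℝ (Fin n), F)) {c : ι → ℝ} (hc : ∀ i, 0 ≤ c i)
    (h : ∀ ξ, (1 + ‖ξ‖ ^ 2) ^ s * ‖𝓕 f ξ‖ ^ 2 ≤ ∑ i ∈ t, c i ^ 2 * ‖𝓕 (g i) ξ‖ ^ 2) :
    besselNorm s f ≤ ∑ i ∈ t, c i * besselNorm 0 (g i) := by
  have h0 : ∀ i ∈ t, 0 ≤ c i * besselNorm 0 (g i) := fun i _ =>
    mul_nonneg (hc i) (besselNorm_nonneg _ _)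
  have h1 : besselNorm s f ^ 2 ≤ ∑ i ∈ t, (c i * besselNorm 0 (g i)) ^ 2 := by
    rw [← ENNReal.ofReal_le_ofReal_iff (Finset.sum_nonneg fun _ _ => sq_nonneg _),
      ENNReal.ofReal_sum_of_nonneg fun _ _ => sq_nonneg _, ofReal_besselNorm_sq]
    have e : ∀ i, ENNReal.ofReal ((c i * besselNorm 0 (g i)) ^ 2) =
        ∫⁻ ξ, ENNReal.ofReal (c i ^ 2 * ‖𝓕 (g i) ξ‖ ^ 2) := by
      intro i
      rw [mul_pow, ENNReal.ofReal_mul (sq_nonneg _), ofReal_besselNorm_sq,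
        ← lintegral_const_mul' _ _ ENNReal.ofReal_ne_top]
      refine lintegral_congr fun ξ => ?_
      rw [← ENNReal.ofReal_mul (sq_nonneg _), Real.rpow_zero, one_mul]
    simp only [e]
    rw [← lintegral_finsetSum]
    · refine lintegral_mono fun ξ => ?_
      rw [← ENNReal.ofReal_sum_of_nonneg fun _ _ => by positivity]
      exact ENNReal.ofReal_le_ofReal (h ξ)
    · intro i _
      exact (ENNReal.continuous_ofReal.comp
        (continuous_const.mul ((𝓕 (g i)).continuous.norm.pow 2))).measurable
  exact le_of_sq_le_sq (h1.trans (Finset.sum_sq_le_sq_sum_of_nonneg h0)) (Finset.sum_nonneg h0)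

theorem besselNorm_one_le (f : 𝓢(EuclideanSpace ℝ (Fin n), F)) :
    besselNorm 1 f ≤ besselNorm 0 f +
      ∑ j : Fin n, (2 * Real.pi)⁻¹ * besselNorm 0 (∂_{EuclideanSpace.single j (1 : ℝ)} f) := by
  have h := sq_besselNorm_le_of_fourier (s := 1) (f := f) (Finset.univ : Finset (Option (Fin n)))
    (fun i => i.elim f fun j => ∂_{EuclideanSpace.single j (1 : ℝ)} f)
    (c := fun i => i.elim 1 fun _ => (2 * Real.pi)⁻¹)
    (fun i => by cases i <;> simp [Real.pi_pos.le]) (fun ξ => by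
      simp only [Fintype.sum_option, Option.elim_none, Option.elim_some, norm_fourier_lineDeriv]
      rw [EuclideanSpace.norm_sq_eq, Real.rpow_one, add_mul, Finset.sum_mul]
      refine le_of_eq ?_
      congr 1
      · simp
      · refine Finset.sum_congr rfl fun j _ => ?_
        rw [Real.norm_eq_abs]
        field_simp)
  simpa [Fintype.sum_option] using h

theorem fourier_postcompCLM_apply (L : F →L[ℂ] F) (f : 𝓢(EuclideanSpace ℝ (Fin n), F))
    (ξ : EuclideanSpace ℝ (Fin n)) : 𝓕 (SchwartzMap.postcompCLM L f) ξ = L (𝓕 f ξ) := by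
  rw [SchwartzMap.fourier_coe, SchwartzMap.fourier_coe, Real.fourier_eq, Real.fourier_eq,
    ← ContinuousLinearMap.integral_comp_comm]
  · refine integral_congr_ae (.of_forall fun x => ?_)
    simp [Circle.smul_def]
  · exact (Real.fourierIntegral_convergent_iff _).2 f.integrable

/-- The a priori estimate for homogeneous elliptic operators with constant coefficients. -/
theorem besselNorm_one_le_of_elliptic {a : Fin n → F →L[ℂ] F} {κ : ℝ} (hκ : 0 < κ)
    (ha : ∀ (ξ : EuclideanSpace ℝ (Fin n)) v, κ * ‖ξ‖ * ‖v‖ ≤ ‖∑ j, (ξ j : ℂ) • a j v‖)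
    (f : 𝓢(EuclideanSpace ℝ (Fin n), F)) :
    besselNorm 1 f ≤ besselNorm 0 f + (2 * Real.pi * κ)⁻¹ * besselNorm 0
      (∑ j, SchwartzMap.postcompCLM (a j) (∂_{EuclideanSpace.single j (1 : ℝ)} f)) := by
  set g := ∑ j, SchwartzMap.postcompCLM (a j) (∂_{EuclideanSpace.single j (1 : ℝ)} f) with hg
  have hgξ : ∀ ξ, 2 * Real.pi * κ * ‖ξ‖ * ‖𝓕 f ξ‖ ≤ ‖𝓕 g ξ‖ := by
    intro ξ
    have e : 𝓕 g ξ = (2 * Real.pi * Complex.I) • ∑ j, (ξ j : ℂ) • a j (𝓕 f ξ) := by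
      have e1 : 𝓕 g = ∑ j, 𝓕 (SchwartzMap.postcompCLM (a j)
          (∂_{EuclideanSpace.single j (1 : ℝ)} f)) := by
        rw [hg]
        exact map_sum (fourierCLM ℂ 𝓢(EuclideanSpace ℝ (Fin n), F)) _ _
      rw [e1, _root_.sum_apply, Finset.smul_sum]
      refine Finset.sum_congr rfl fun j _ => ?_
      rw [fourier_postcompCLM_apply, SchwartzMap.fourier_lineDerivOp_eq, _root_.smul_apply,
        SchwartzMap.smulLeftCLM_apply_apply (by fun_prop), map_smul]
      congr 1
      simp [EuclideanSpace.inner_single_right]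
    rw [e, norm_smul]
    calc 2 * Real.pi * κ * ‖ξ‖ * ‖𝓕 f ξ‖ = 2 * Real.pi * (κ * ‖ξ‖ * ‖𝓕 f ξ‖) := by ring
      _ ≤ 2 * Real.pi * ‖∑ j, (ξ j : ℂ) • a j (𝓕 f ξ)‖ := by gcongr; exact ha _ _
      _ = _ := by simp [abs_of_pos Real.pi_pos]
  have h := sq_besselNorm_le_of_fourier (s := 1) (f := f) (Finset.univ : Finset (Option Unit))
    (fun i => i.elim f fun _ => g) (c := fun i => i.elim 1 fun _ => (2 * Real.pi * κ)⁻¹)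
    (fun i => by cases i <;> simp only [Option.elim_none, Option.elim_some] <;> positivity)
    (fun ξ => by
      simp only [Fintype.sum_option, Option.elim_none, Option.elim_some, Finset.univ_unique,
        Finset.sum_singleton]
      rw [Real.rpow_one, add_mul, one_pow]
      refine add_le_add le_rfl ?_
      have h2 := pow_le_pow_left₀ (by positivity) (hgξ ξ) 2
      calc ‖ξ‖ ^ 2 * ‖𝓕 f ξ‖ ^ 2
          = (2 * Real.pi * κ)⁻¹ ^ 2 * (2 * Real.pi * κ * ‖ξ‖ * ‖𝓕 f ξ‖) ^ 2 := by field_simp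
        _ ≤ _ := by gcongr)
  simpa [Fintype.sum_option] using h

theorem exists_bound_of_hasCompactSupport {X Y : Type*} [TopologicalSpace X]
    [NormedAddCommGroup Y] {M : X → Y} (hM : Continuous M) (hc : HasCompactSupport M) :
    ∃ C : ℝ, 0 ≤ C ∧ ∀ x, ‖M x‖ ≤ C := by
  obtain ⟨C, hC⟩ := hM.bounded_above_of_compact_support hc
  exact ⟨max C 0, le_max_right _ _, fun x => (hC x).trans (le_max_left _ _)⟩

theorem fderiv_clm_apply_of_complex {X : Type*} [NormedAddCommGroup X] [NormedSpace ℝ X]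
    {M : X → F →L[ℂ] F} {f : X → F} {x : X} (hM : DifferentiableAt ℝ M x)
    (hf : DifferentiableAt ℝ f x) (v : X) :
    fderiv ℝ (fun y => M y (f y)) x v = M x (fderiv ℝ f x v) + fderiv ℝ M x v (f x) := by
  have h1 := ((ContinuousLinearMap.restrictScalarsL ℂ F F ℝ ℝ).hasFDerivAt.comp x
    hM.hasFDerivAt).clm_apply hf.hasFDerivAt
  have h2 : HasFDerivAt (fun y => M y (f y)) _ x := h1
  rw [h2.fderiv]
  simp

/-- Multiplication by a smooth compactly supported matrix is bounded in the norm of order `1`. -/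
theorem exists_besselNorm_one_mul_le {M : EuclideanSpace ℝ (Fin n) → F →L[ℂ] F}
    (hM : ContDiff ℝ ∞ M) (hc : HasCompactSupport M) :
    ∃ C : ℝ, 0 ≤ C ∧ ∀ f g : 𝓢(EuclideanSpace ℝ (Fin n), F), (∀ x, g x = M x (f x)) →
      besselNorm 1 g ≤ C * besselNorm 1 f := by
  obtain ⟨C₀, hC₀, h₀⟩ := exists_bound_of_hasCompactSupport hM.continuous hc
  obtain ⟨C₁, hC₁, h₁⟩ := exists_bound_of_hasCompactSupport
    (hM.continuous_fderiv (by simp)) (hc.fderiv ℝ)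
  refine ⟨C₀ + ∑ _j : Fin n, (2 * Real.pi)⁻¹ * (C₁ + C₀ * (2 * Real.pi)), by positivity,
    fun f g hg => ?_⟩
  have e0 : besselNorm 0 g ≤ C₀ * besselNorm 1 f := by
    refine (besselNorm_zero_le hC₀ fun x => ?_).trans
      (mul_le_mul_of_nonneg_left (besselNorm_mono zero_le_one f) hC₀)
    rw [hg]
    exact (M x).le_of_opNorm_le (h₀ x) _
  have e1 : ∀ j : Fin n, besselNorm 0 (∂_{EuclideanSpace.single j (1 : ℝ)} g) ≤
      (C₁ + C₀ * (2 * Real.pi)) * besselNorm 1 f := by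
    intro j
    have hle : ∀ x, ‖∂_{EuclideanSpace.single j (1 : ℝ)} g x‖ ≤
        ∑ i : Bool, (bif i then C₁ else C₀) *
          ‖(bif i then f else ∂_{EuclideanSpace.single j (1 : ℝ)} f) x‖ := by
      intro x
      have e : ⇑g = fun y => M y (f y) := funext hg
      rw [SchwartzMap.lineDerivOp_apply_eq_fderiv, e, fderiv_clm_apply_of_complex
        (hM.differentiable (by simp) x) f.differentiableAt]
      simp only [Fintype.sum_bool, cond_true, cond_false]
      rw [add_comm]
      refine (norm_add_le _ _).trans (add_le_add ?_ ((M x).le_of_opNorm_le (h₀ x) _))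
      refine ContinuousLinearMap.le_of_opNorm_le _ ?_ _
      refine ((fderiv ℝ M x).le_of_opNorm_le (h₁ x) _).trans ?_
      simp
    have := besselNorm_zero_le_sum _ (fun i => by cases i <;> simp [hC₁, hC₀]) hle
    simp only [Fintype.sum_bool, cond_true, cond_false] at this
    refine this.trans ?_
    have h2 := besselNorm_lineDeriv_le 0 f j
    rw [zero_add] at h2
    have h3 := besselNorm_mono zero_le_one f
    calc _ ≤ C₁ * besselNorm 1 f + C₀ * (2 * Real.pi * besselNorm 1 f) := by gcongr
      _ = _ := by ring
  refine (besselNorm_one_le g).trans ?_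
  rw [add_mul, Finset.sum_mul]
  refine add_le_add e0 (Finset.sum_le_sum fun j _ => ?_)
  rw [mul_assoc]
  exact mul_le_mul_of_nonneg_left (e1 j) (by positivity)

end Schwartz

/-! ### Comparison of the two scales -/

section BesselScale

open scoped FourierTransform
open FourierTransform

variable {n : ℕ} {F : Type*} [NormedAddCommGroup F] [InnerProductSpace ℂ F] [FiniteDimensional ℂ F]
  {ι : Type*} [Fintype ι]

theorem ofNat_mul_ofReal (k : ℕ) [k.AtLeastTwo] (x : ℝ) :
    (ofNat(k) : ℝ≥0∞) * ENNReal.ofReal x = ENNReal.ofReal (ofNat(k) * x) := by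
  rw [ENNReal.ofReal_mul (Nat.ofNat_nonneg k), ENNReal.ofReal_ofNat]

theorem measurable_ofReal_norm_fourier_sq (f : 𝓢(EuclideanSpace ℝ (Fin n), F)) :
    Measurable fun ξ => ENNReal.ofReal (‖𝓕 f ξ‖ ^ 2) :=
  (ENNReal.continuous_ofReal.comp ((𝓕 f).continuous.norm.pow 2)).measurable

/-- The measure `∑ᵢ |f̂ᵢ(ξ)|² dξ` of a finite family of Schwartz functions. -/
def besselMeasure (f : ι → 𝓢(EuclideanSpace ℝ (Fin n), F)) :
    Measure (EuclideanSpace ℝ (Fin n)) :=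
  volume.withDensity fun ξ => ∑ i, ENNReal.ofReal (‖𝓕 (f i) ξ‖ ^ 2)

/-- The sum of the squares of the norms of order `s` of a finite family of Schwartz functions. -/
def besselSq (s : ℝ) (f : ι → 𝓢(EuclideanSpace ℝ (Fin n), F)) : ℝ≥0∞ :=
  ∑ i, ENNReal.ofReal (besselNorm s (f i) ^ 2)

instance (f : ι → 𝓢(EuclideanSpace ℝ (Fin n), F)) : SFinite (besselMeasure f) := by
  unfold besselMeasure
  infer_instance

theorem lintegral_besselMeasure {φ : EuclideanSpace ℝ (Fin n) → ℝ≥0∞} (hφ : Measurable φ)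
    (f : ι → 𝓢(EuclideanSpace ℝ (Fin n), F)) :
    ∫⁻ ξ, φ ξ ∂(besselMeasure f) = ∑ i, ∫⁻ ξ, φ ξ * ENNReal.ofReal (‖𝓕 (f i) ξ‖ ^ 2) := by
  rw [besselMeasure, lintegral_withDensity_eq_lintegral_mul _
    (Finset.measurable_fun_sum _ fun i _ => measurable_ofReal_norm_fourier_sq (f i)) hφ,
    ← lintegral_finsetSum (f := fun i ξ => φ ξ * ENNReal.ofReal (‖𝓕 (f i) ξ‖ ^ 2)) _ fun i _ =>
      hφ.mul (measurable_ofReal_norm_fourier_sq (f i))]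
  refine lintegral_congr fun ξ => ?_
  rw [Pi.mul_apply, mul_comm, Finset.mul_sum]

theorem lintegral_rpow_besselMeasure (s : ℝ) (f : ι → 𝓢(EuclideanSpace ℝ (Fin n), F)) :
    ∫⁻ ξ, ENNReal.ofReal ((1 + ‖ξ‖ ^ 2) ^ s) ∂(besselMeasure f) = besselSq s f := by
  rw [lintegral_besselMeasure (by fun_prop), besselSq]
  refine Finset.sum_congr rfl fun i _ => ?_
  rw [ofReal_besselNorm_sq]
  refine lintegral_congr fun ξ => ?_
  rw [ENNReal.ofReal_mul (by positivity)]

/-- For every decomposition `a + b`, the `K`-functional is bounded by the norms of `a` and `b`. -/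
theorem kFunctional_besselMeasure_add_le (l : ℝ) (a b : ι → 𝓢(EuclideanSpace ℝ (Fin n), F)) :
    ∫⁻ ξ, ENNReal.ofReal (min (l / (1 + ‖ξ‖ ^ 2)) (1 + ‖ξ‖ ^ 2)) ∂(besselMeasure (a + b)) ≤
      2 * (ENNReal.ofReal l * besselSq (-1) a + besselSq 1 b) := by
  rw [lintegral_besselMeasure (by fun_prop), besselSq, besselSq, Finset.mul_sum,
    ← Finset.sum_add_distrib, Finset.mul_sum]
  refine Finset.sum_le_sum fun i _ => ?_
  rw [ofReal_besselNorm_sq, ofReal_besselNorm_sq, ← lintegral_const_mul' _ _ ENNReal.ofReal_ne_top,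
    ← lintegral_add_left', ← lintegral_const_mul' _ _ (by simp)]
  · refine lintegral_mono fun ξ => ?_
    have e : 𝓕 ((a + b) i) ξ = 𝓕 (a i) ξ + 𝓕 (b i) ξ := by
      rw [Pi.add_apply, FourierTransform.fourier_add, _root_.add_apply]
    have hw : (0 : ℝ) < 1 + ‖ξ‖ ^ 2 := by positivity
    have h2 : ‖𝓕 (a i) ξ + 𝓕 (b i) ξ‖ ^ 2 ≤ 2 * ‖𝓕 (a i) ξ‖ ^ 2 + 2 * ‖𝓕 (b i) ξ‖ ^ 2 := by
      have := pow_le_pow_left₀ (norm_nonneg _) (norm_add_le (𝓕 (a i) ξ) (𝓕 (b i) ξ)) 2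
      nlinarith [sq_nonneg (‖𝓕 (a i) ξ‖ - ‖𝓕 (b i) ξ‖)]
    rcases le_or_gt l 0 with hl | hl
    · rw [ENNReal.ofReal_of_nonpos ((min_le_left _ _).trans
        (div_nonpos_of_nonpos_of_nonneg hl hw.le)),
        zero_mul]
      exact bot_le
    rw [e, ← ENNReal.ofReal_mul (le_min (by positivity) hw.le), ← ENNReal.ofReal_mul hl.le,
      ← ENNReal.ofReal_add (by positivity) (by positivity), ofNat_mul_ofReal]
    refine ENNReal.ofReal_le_ofReal ?_
    rw [Real.rpow_one, Real.rpow_neg_one]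
    have hm : 0 ≤ min (l / (1 + ‖ξ‖ ^ 2)) (1 + ‖ξ‖ ^ 2) := le_min (by positivity) hw.le
    calc _ ≤ min (l / (1 + ‖ξ‖ ^ 2)) (1 + ‖ξ‖ ^ 2) *
          (2 * ‖𝓕 (a i) ξ‖ ^ 2 + 2 * ‖𝓕 (b i) ξ‖ ^ 2) := by gcongr
      _ = 2 * (min (l / (1 + ‖ξ‖ ^ 2)) (1 + ‖ξ‖ ^ 2) * ‖𝓕 (a i) ξ‖ ^ 2 +
          min (l / (1 + ‖ξ‖ ^ 2)) (1 + ‖ξ‖ ^ 2) * ‖𝓕 (b i) ξ‖ ^ 2) := by ring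
      _ ≤ 2 * (l / (1 + ‖ξ‖ ^ 2) * ‖𝓕 (a i) ξ‖ ^ 2 + (1 + ‖ξ‖ ^ 2) * ‖𝓕 (b i) ξ‖ ^ 2) := by
          gcongr
          · exact min_le_left _ _
          · exact min_le_right _ _
      _ = _ := by rw [div_eq_mul_inv]; ring
  · refine AEMeasurable.const_mul (Measurable.aemeasurable ?_) _
    have := (𝓕 (a i)).continuous
    exact ENNReal.measurable_ofReal.comp (Measurable.mul (by fun_prop)
      (this.norm.pow 2).measurable)

/-- A smooth frequency cutoff realizes, up to a constant, the `K`-functional between the norms of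
orders `-1` and `1`. -/
theorem exists_add_eq_kFunctional_besselMeasure {l : ℝ} (hl : 0 < l)
    (f : ι → 𝓢(EuclideanSpace ℝ (Fin n), F)) :
    ∃ a b, a + b = f ∧ ENNReal.ofReal l * besselSq (-1) a + besselSq 1 b ≤
      5 * ∫⁻ ξ, ENNReal.ofReal (min (l / (1 + ‖ξ‖ ^ 2)) (1 + ‖ξ‖ ^ 2)) ∂(besselMeasure f) := by
  -- a multiplier which is `1` where `1 + |ξ|² ≤ √l` and `0` where `1 + |ξ|² ≥ 2 √l`
  obtain ⟨m, hm, hm0, hm1, hm2, hm3⟩ : ∃ m : EuclideanSpace ℝ (Fin n) → ℝ, m.HasTemperateGrowth ∧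
      (∀ ξ, 0 ≤ m ξ) ∧ (∀ ξ, m ξ ≤ 1) ∧ (∀ ξ, (1 + ‖ξ‖ ^ 2) ^ 2 < l → m ξ = 1) ∧
      ∀ ξ, 4 * l ≤ (1 + ‖ξ‖ ^ 2) ^ 2 → m ξ = 0 := by
    rcases le_or_gt l 1 with h1 | h1
    · refine ⟨fun _ => 0, by fun_prop, fun _ => le_rfl, fun _ => zero_le_one, fun ξ h => ?_,
        fun _ _ => rfl⟩
      nlinarith [sq_nonneg ‖ξ‖]
    · have hs : 1 < √l := by rwa [Real.lt_sqrt zero_le_one, one_pow]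
      have hsq : √l ^ 2 = l := Real.sq_sqrt hl.le
      let β : ContDiffBump (0 : EuclideanSpace ℝ (Fin n)) :=
        { rIn := √(√l - 1), rOut := √(2 * √l - 1), rIn_pos := Real.sqrt_pos.2 (by linarith)
          rIn_lt_rOut := Real.sqrt_lt_sqrt (by linarith) (by linarith) }
      refine ⟨β, β.hasCompactSupport.hasTemperateGrowth β.contDiff, fun _ => β.nonneg,
        fun _ => β.le_one, fun ξ h => β.one_of_mem_closedBall ?_, fun ξ h => β.zero_of_le_dist ?_⟩
      · rw [mem_closedBall_zero_iff]
        refine Real.le_sqrt_of_sq_le ?_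
        have := abs_lt_of_sq_lt_sq (h.trans_le hsq.ge) (by linarith)
        linarith [(abs_lt.1 this).2]
      · rw [dist_zero_right]
        refine Real.sqrt_le_iff.2 ⟨norm_nonneg _, ?_⟩
        have : (2 * √l) ^ 2 ≤ (1 + ‖ξ‖ ^ 2) ^ 2 := by rw [mul_pow, hsq]; linarith
        have := le_of_sq_le_sq this (by positivity)
        linarith
  have hmc : (fun ξ => ((m ξ : ℝ) : ℂ)).HasTemperateGrowth :=
    Function.HasTemperateGrowth.comp (Function.RCLike.hasTemperateGrowth_ofReal (𝕜 := ℂ)) hm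
  set b : ι → 𝓢(EuclideanSpace ℝ (Fin n), F) := fun i =>
    SchwartzMap.fourierMultiplierCLM F (fun ξ => ((m ξ : ℝ) : ℂ)) (f i) with hb
  have hbξ : ∀ i ξ, 𝓕 (b i) ξ = (m ξ : ℂ) • 𝓕 (f i) ξ := fun i ξ =>
    fourier_fourierMultiplierCLM_apply hmc _ _
  refine ⟨f - b, b, sub_add_cancel _ _, ?_⟩
  rw [lintegral_besselMeasure (by fun_prop), besselSq, besselSq, Finset.mul_sum,
    ← Finset.sum_add_distrib, Finset.mul_sum]
  refine Finset.sum_le_sum fun i _ => ?_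
  rw [ofReal_besselNorm_sq, ofReal_besselNorm_sq, ← lintegral_const_mul' _ _ ENNReal.ofReal_ne_top,
    ← lintegral_add_left', ← lintegral_const_mul' _ _ (by simp)]
  · refine lintegral_mono fun ξ => ?_
    have e : 𝓕 ((f - b) i) ξ = ((1 - m ξ : ℝ) : ℂ) • 𝓕 (f i) ξ := by
      have e1 : 𝓕 ((f - b) i) = 𝓕 (f i) - 𝓕 (b i) :=
        map_sub (fourierCLM ℂ 𝓢(EuclideanSpace ℝ (Fin n), F)) (f i) (b i)
      rw [e1, _root_.sub_apply, hbξ]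
      push_cast
      module
    rw [e, hbξ, norm_smul, norm_smul, Complex.norm_real, Complex.norm_real,
      Real.norm_of_nonneg (hm0 ξ), Real.norm_of_nonneg (sub_nonneg.2 (hm1 ξ))]
    have hw : (0 : ℝ) < 1 + ‖ξ‖ ^ 2 := by positivity
    rw [← ENNReal.ofReal_mul (le_min (by positivity) hw.le), ← ENNReal.ofReal_mul hl.le,
      ← ENNReal.ofReal_add (by positivity) (by positivity), ofNat_mul_ofReal]
    refine ENNReal.ofReal_le_ofReal ?_
    rw [Real.rpow_one, Real.rpow_neg_one, mul_pow, mul_pow]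
    have key : l / (1 + ‖ξ‖ ^ 2) * (1 - m ξ) ^ 2 + (1 + ‖ξ‖ ^ 2) * m ξ ^ 2 ≤
        5 * min (l / (1 + ‖ξ‖ ^ 2)) (1 + ‖ξ‖ ^ 2) := by
      have hm2 := hm2 ξ
      have hm3 := hm3 ξ
      have hm0 := hm0 ξ
      have hm1 := hm1 ξ
      generalize m ξ = μ at hm0 hm1 hm2 hm3
      generalize 1 + ‖ξ‖ ^ 2 = w at hw hm2 hm3
      rcases lt_or_ge (w ^ 2) l with h | h
      · have h1 : w ≤ l / w := by rw [le_div_iff₀ hw]; linarith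
        rw [hm2 h, min_eq_right h1]
        linarith
      · have h1 : l / w ≤ w := by rw [div_le_iff₀ hw]; linarith
        have h0 : 0 < l / w := by positivity
        rw [min_eq_left h1]
        have h2 : (1 - μ) ^ 2 ≤ 1 := by nlinarith
        have h3 : w * μ ^ 2 ≤ 4 * (l / w) := by
          rcases le_or_gt (4 * l) (w ^ 2) with h4 | h4
          · rw [hm3 h4]
            linarith
          · have h5 : w ≤ 4 * (l / w) := by rw [← mul_div_assoc, le_div_iff₀ hw]; linarith
            exact (mul_le_of_le_one_right hw.le (by nlinarith)).trans h5
        nlinarith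
    calc _ = (l / (1 + ‖ξ‖ ^ 2) * (1 - m ξ) ^ 2 + (1 + ‖ξ‖ ^ 2) * m ξ ^ 2) * ‖𝓕 (f i) ξ‖ ^ 2 := by
          rw [div_eq_mul_inv]; ring
      _ ≤ 5 * min (l / (1 + ‖ξ‖ ^ 2)) (1 + ‖ξ‖ ^ 2) * ‖𝓕 (f i) ξ‖ ^ 2 := by gcongr
      _ = _ := by ring
  · refine AEMeasurable.const_mul (Measurable.aemeasurable ?_) _
    have := (𝓕 ((f - b) i)).continuous
    exact ENNReal.measurable_ofReal.comp (Measurable.mul (by fun_prop)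
      (this.norm.pow 2).measurable)

end BesselScale

section NormEquivalence

variable {n : ℕ} {F : Type*} [NormedAddCommGroup F] [InnerProductSpace ℂ F] [FiniteDimensional ℂ F]
  {ι : Type*} [Fintype ι] {H : Type*} [NormedAddCommGroup H] [InnerProductSpace ℂ H]
  [CompleteSpace H] {R : H →L[ℂ] H} (hR : IsSelfAdjoint R)

/-- The upper half of the comparison of the scales: a bounded synthesis map between the endpoints
`-1` and `1` is bounded in between. -/
theorem scaleSq_le_besselSq (hinj : Function.Injective R)
    (S : (ι → 𝓢(EuclideanSpace ℝ (Fin n), F)) →+ H) {C : ℝ≥0∞} (hC : C ≠ ⊤)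
    (h1 : ∀ f, ENNReal.ofReal (‖R (S f)‖ ^ 2) ≤ C * besselSq (-1) f)
    (h2 : ∀ f, ∃ y, R y = S f ∧ ENNReal.ofReal (‖y‖ ^ 2) ≤ C * besselSq 1 f)
    {s : ℝ} (hs : |s| < 1) (f : ι → 𝓢(EuclideanSpace ℝ (Fin n), F)) :
    scaleSq hR s (S f) ≤ 10 * C * besselSq s f := by
  have h := lintegral_rpow_le_of_kFunctional_le ((spectralPVM hR).scalarMeasure (S f))
    (besselMeasure f) (w := fun t => |t|⁻¹ ^ (2 * (1 : ℝ))) (w' := fun ξ => 1 + ‖ξ‖ ^ 2)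
    (by fun_prop) (by fun_prop)
    ((ae_abs_inv_pos hR hinj _).mono fun t ht => Real.rpow_pos_of_pos ht _)
    (.of_forall fun ξ => by positivity) hs (C := 10 * C) (ENNReal.mul_ne_top (by simp) hC)
    (fun l hl => by
      obtain ⟨a, b, hab, hK⟩ := exists_add_eq_kFunctional_besselMeasure hl f
      have e := kFunctional_add_le hR (r := 1) l (S a) (S b)
      rw [← map_add, hab] at e
      refine e.trans ?_
      obtain ⟨y, hy, hy2⟩ := h2 b
      rw [scaleSq_neg_one hR hinj, ← hy, scaleSq_apply hR hinj, sub_self, scaleSq_zero]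
      calc 2 * (ENNReal.ofReal l * ENNReal.ofReal (‖R (S a)‖ ^ 2) + ENNReal.ofReal (‖y‖ ^ 2))
          ≤ 2 * (ENNReal.ofReal l * (C * besselSq (-1) a) + C * besselSq 1 b) := by
            gcongr; exact h1 a
        _ = 2 * C * (ENNReal.ofReal l * besselSq (-1) a + besselSq 1 b) := by ring
        _ ≤ 2 * C * (5 * _) := by gcongr
        _ = _ := by ring)
  rw [lintegral_rpow_besselMeasure] at h
  refine le_trans (le_of_eq ?_) h
  refine lintegral_congr fun t => ?_
  rw [← Real.rpow_mul (by positivity), mul_one]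

/-- The lower half of the comparison of the scales. The spectral cutoff leaves the space `V`, and is
approximated there in the graph norm. -/
theorem besselSq_le_scaleSq (hinj : Function.Injective R) {V : Type*} [AddCommGroup V] [Module ℂ V]
    (j : V →ₗ[ℂ] H) (A : V →ₗ[ℂ] V) (hRA : ∀ v, R (j (A v)) = j v)
    (hd : DenseRange fun v => j (A v))
    (J : V →+ (ι → 𝓢(EuclideanSpace ℝ (Fin n), F))) {C : ℝ≥0∞} (hC : C ≠ ⊤)
    (h3 : ∀ v, besselSq (-1) (J v) ≤ C * ENNReal.ofReal (‖R (j v)‖ ^ 2))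
    (h4 : ∀ v, besselSq 1 (J v) ≤ C * ENNReal.ofReal (‖j (A v)‖ ^ 2))
    {s : ℝ} (hs : |s| < 1) (u : V) :
    besselSq s (J u) ≤ 2 * C * scaleSq hR s (j u) := by
  have h := lintegral_rpow_le_of_kFunctional_le (besselMeasure (J u))
    ((spectralPVM hR).scalarMeasure (j u)) (w' := fun t => |t|⁻¹ ^ (2 * (1 : ℝ)))
    (w := fun ξ => 1 + ‖ξ‖ ^ 2) (by fun_prop) (by fun_prop) (.of_forall fun ξ => by positivity)
    ((ae_abs_inv_pos hR hinj _).mono fun t ht => Real.rpow_pos_of_pos ht _)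
    hs (C := 2 * C) (ENNReal.mul_ne_top (by simp) hC)
    (fun l hl => by
      set S : Set ℝ := {t | |t|⁻¹ ^ (2 * (1 : ℝ)) ≤ l / |t|⁻¹ ^ (2 * (1 : ℝ))} with hS
      have hSm : MeasurableSet S := measurableSet_le (by fun_prop) (by fun_prop)
      set x₀ := (spectralPVM hR).proj Sᶜ (j u) with hx₀
      set x₁ := (spectralPVM hR).proj S (j u) with hx₁
      have hx : x₀ + x₁ = j u := proj_compl_add_proj hR hSm _
      rw [← kFunctional_eq_cutoff hR hl]
      obtain ⟨y, hy⟩ : ∃ y, R y = x₁ := by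
        refine exists_eq_apply_of_lintegral_lt_top hR hinj x₁ ?_
        have h6 : scaleSq hR 1 x₁ ≤ ENNReal.ofReal l * scaleSq hR (-1) (j u) := by
          refine (le_add_self.trans (kFunctional_eq_cutoff hR (r := 1) hl (j u)).le).trans ?_
          rw [scaleSq, ← lintegral_const_mul _ (by fun_prop)]
          refine lintegral_mono fun t => ?_
          have h0 : 0 ≤ |t|⁻¹ := by positivity
          rw [← ENNReal.ofReal_mul' (by positivity), mul_neg, Real.rpow_neg h0, ← div_eq_mul_inv]
          exact ENNReal.ofReal_le_ofReal (min_le_left _ _)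
        refine lt_of_le_of_lt (le_trans (le_of_eq ?_) h6) ?_
        · refine lintegral_congr fun t => ?_
          rw [mul_one, Real.rpow_two, inv_pow, inv_pow, sq_abs]
        · rw [scaleSq_neg_one hR hinj]
          exact ENNReal.mul_lt_top ENNReal.ofReal_lt_top ENNReal.ofReal_lt_top
      have e1 : scaleSq hR 1 x₁ = ENNReal.ofReal (‖y‖ ^ 2) := by
        rw [← hy, scaleSq_apply hR hinj, sub_self, scaleSq_zero]
      rw [← hS, ← hx₀, ← hx₁, e1, scaleSq_neg_one hR hinj]
      obtain ⟨v, hv⟩ : ∃ v : ℕ → V, Tendsto (fun k => j (A (v k))) atTop (𝓝 y) := by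
        obtain ⟨z, hz, hz'⟩ := mem_closure_iff_seq_limit.1 (hd y)
        choose v hv using hz
        exact ⟨v, by simpa only [hv] using hz'⟩
      have hv' : Tendsto (fun k => j (u - v k)) atTop (𝓝 x₀) := by
        have := (tendsto_const_nhds (x := j u)).sub ((R.continuous.tendsto y).comp hv)
        rw [hy, ← hx, add_sub_cancel_right] at this
        refine this.congr fun k => ?_
        rw [Function.comp, hRA, map_sub, hx]
      have hlim : Tendsto (fun k => 2 * C * (ENNReal.ofReal l *
          ENNReal.ofReal (‖R (j (u - v k))‖ ^ 2) + ENNReal.ofReal (‖j (A (v k))‖ ^ 2))) atTop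
          (𝓝 (2 * C * (ENNReal.ofReal l * ENNReal.ofReal (‖R x₀‖ ^ 2) +
            ENNReal.ofReal (‖y‖ ^ 2)))) := by
        refine ENNReal.Tendsto.const_mul (Tendsto.add (ENNReal.Tendsto.const_mul
          (ENNReal.tendsto_ofReal ((((R.continuous.tendsto _).comp hv').norm).pow 2))
          (Or.inr ENNReal.ofReal_ne_top)) (ENNReal.tendsto_ofReal (hv.norm.pow 2)))
          (Or.inr (ENNReal.mul_ne_top (by simp) hC))
      refine ge_of_tendsto' hlim fun k => ?_
      have e := kFunctional_besselMeasure_add_le l (J (u - v k)) (J (v k))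
      rw [← map_add, sub_add_cancel] at e
      refine e.trans ?_
      calc 2 * (ENNReal.ofReal l * besselSq (-1) (J (u - v k)) + besselSq 1 (J (v k)))
          ≤ 2 * (ENNReal.ofReal l * (C * ENNReal.ofReal (‖R (j (u - v k))‖ ^ 2)) +
              C * ENNReal.ofReal (‖j (A (v k))‖ ^ 2)) := by gcongr; exacts [h3 _, h4 _]
        _ = _ := by ring)
  rw [lintegral_rpow_besselMeasure] at h
  refine h.trans (le_of_eq ?_)
  congr 1
  refine lintegral_congr fun t => ?_
  rw [← Real.rpow_mul (by positivity), mul_one]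

end NormEquivalence

/-! ### Smooth cutoff functions and sections in local coordinates -/

section Euclidean

variable {X : Type*} [NormedAddCommGroup X] [InnerProductSpace ℝ X] [FiniteDimensional ℝ X]

theorem contDiff_of_contDiffOn_of_tsupport {Y : Type*} [NormedAddCommGroup Y] [NormedSpace ℝ Y]
    {f : X → Y} {U : Set X} (hU : IsOpen U) (hf : ContDiffOn ℝ ∞ f U) (h : tsupport f ⊆ U) :
    ContDiff ℝ ∞ f := by
  rw [contDiff_iff_contDiffAt]
  intro y
  by_cases hy : y ∈ U
  · exact hf.contDiffAt (hU.mem_nhds hy)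
  · exact contDiffAt_const.congr_of_eventuallyEq
      (notMem_tsupport_iff_eventuallyEq.1 fun h' => hy (h h'))

/-- A smooth cutoff function which is `1` on a compact set and supported in a given open
neighbourhood of it. -/
theorem exists_smooth_cutoff {K U : Set X} (hK : IsCompact K) (hU : IsOpen U) (hKU : K ⊆ U) :
    ∃ χ : X → ℝ, ContDiff ℝ ∞ χ ∧ HasCompactSupport χ ∧ tsupport χ ⊆ U ∧ (∀ x, χ x ∈ Icc 0 1) ∧
      ∀ x ∈ K, χ x = 1 := by
  obtain ⟨L, hL, hKL, hLU⟩ := exists_compact_between hK hU hKU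
  obtain ⟨f, hf0, hf1, hf⟩ := exists_contMDiffMap_zero_one_nhds_of_isClosed 𝓘(ℝ, X) (n := ⊤)
    (isOpen_interior (s := L)).isClosed_compl hK.isClosed
    (disjoint_compl_left_iff_subset.2 hKL)
  have hs : tsupport f ⊆ L := by
    refine (closure_minimal ?_ hL.isClosed)
    intro x hx
    by_contra hxL
    exact hx (hf0.self_of_nhdsSet x fun h => hxL (interior_subset h))
  exact ⟨f, f.contMDiff.contDiff, HasCompactSupport.of_support_subset_isCompact hL
    (subset_closure.trans hs), hs.trans hLU, hf, fun x hx => hf1.self_of_nhdsSet x hx⟩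

/-- A finite smooth partition of unity on a compact set, subordinate to neighbourhoods of its
points. -/
theorem exists_finite_smooth_partition {K : Set X} (hK : IsCompact K) {U : X → Set X}
    (hU : ∀ x ∈ K, U x ∈ 𝓝 x) :
    ∃ (t : Finset X) (χ : X → X → ℝ), (∀ y ∈ t, y ∈ K) ∧ (∀ y ∈ t, ContDiff ℝ ∞ (χ y)) ∧
      (∀ y ∈ t, tsupport (χ y) ⊆ U y) ∧ ∀ x ∈ K, ∑ y ∈ t, χ y x = 1 := by
  classical
  obtain ⟨t, htK, ht⟩ := hK.elim_nhds_subcover (fun x => interior (U x))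
    fun x hx => interior_mem_nhds.2 (hU x hx)
  obtain ⟨f, hf⟩ := SmoothPartitionOfUnity.exists_isSubordinate 𝓘(ℝ, X) hK.isClosed
    (fun y : t => interior (U y)) (fun _ => isOpen_interior) (fun x hx => by
      obtain ⟨y, hy, hxy⟩ := mem_iUnion₂.1 (ht hx)
      exact mem_iUnion.2 ⟨⟨y, hy⟩, hxy⟩)
  refine ⟨t, fun y => if h : y ∈ t then f ⟨y, h⟩ else 0, htK, fun y hy => ?_, fun y hy => ?_,
    fun x hx => ?_⟩
  · simp only [hy, dif_pos]
    exact (f ⟨y, hy⟩).contMDiff.contDiff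
  · simp only [hy, dif_pos]
    exact (hf ⟨y, hy⟩).trans interior_subset
  · have h1 := f.sum_eq_one hx
    rw [finsum_eq_sum_of_fintype] at h1
    rw [← h1, ← Finset.sum_coe_sort t]
    refine Finset.sum_congr rfl fun y _ => ?_
    simp

end Euclidean

section Geometry

variable {n : ℕ} {N : Type*} [TopologicalSpace N] [ChartedSpace (EuclideanSpace ℝ (Fin n)) N]
  {F : Type*} [NormedAddCommGroup F] [InnerProductSpace ℂ F]
  {E : N → Type*} [TopologicalSpace (TotalSpace F E)] [∀ x, NormedAddCommGroup (E x)]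
  [∀ x, InnerProductSpace ℂ (E x)] [FiberBundle F E] [IsManifold (𝓡 n) ∞ N] [VectorBundle ℂ F E]
  [ContMDiffVectorBundle ∞ F E (𝓡 n)]

theorem localRep_add {p : N} {y : EuclideanSpace ℝ (Fin n)} (hy : y ∈ localDomain n F E p)
    (u v : ∀ x, E x) :
    localRep n F E p (u + v) y = localRep n F E p u y + localRep n F E p v y :=
  (Trivialization.linear ℂ (trivializationAt F E p) hy.2).map_add _ _

theorem localRep_smul {p : N} {y : EuclideanSpace ℝ (Fin n)} (hy : y ∈ localDomain n F E p)
    (c : ℂ) (u : ∀ x, E x) : localRep n F E p (c • u) y = c • localRep n F E p u y :=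
  (Trivialization.linear ℂ (trivializationAt F E p) hy.2).map_smul _ _

theorem symm_localRep {p : N} {y : EuclideanSpace ℝ (Fin n)} (hy : y ∈ localDomain n F E p)
    (u : ∀ x, E x) :
    (trivializationAt F E p).symm ((chartAt (EuclideanSpace ℝ (Fin n)) p).symm y)
      (localRep n F E p u y) = u ((chartAt (EuclideanSpace ℝ (Fin n)) p).symm y) :=
  (trivializationAt F E p).symm_apply_apply_mk hy.2 _

variable (n F E) in
/-- The Gram operator of the Hermitian metric in the chart and the trivialization at `p`: the metric
reads `⟨v, w⟩ = ⟨g(y) v, w⟩_F` there. -/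
def gram [FiniteDimensional ℂ F] (p : N) (y : EuclideanSpace ℝ (Fin n)) : F →L[ℂ] F :=
  ∑ a, ∑ b, (inner ℂ
      ((trivializationAt F E p).symm ((chartAt (EuclideanSpace ℝ (Fin n)) p).symm y)
        (stdOrthonormalBasis ℂ F a))
      ((trivializationAt F E p).symm ((chartAt (EuclideanSpace ℝ (Fin n)) p).symm y)
        (stdOrthonormalBasis ℂ F b))) •
    (innerSL ℂ (stdOrthonormalBasis ℂ F b)).smulRight (stdOrthonormalBasis ℂ F a)

theorem inner_gram_right [FiniteDimensional ℂ F] {p : N} {y : EuclideanSpace ℝ (Fin n)}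
    (hy : y ∈ localDomain n F E p) (v w : F) :
    inner ℂ v (gram n F E p y w) =
      inner ℂ ((trivializationAt F E p).symm ((chartAt (EuclideanSpace ℝ (Fin n)) p).symm y) v)
        ((trivializationAt F E p).symm ((chartAt (EuclideanSpace ℝ (Fin n)) p).symm y) w) := by
  set x := (chartAt (EuclideanSpace ℝ (Fin n)) p).symm y
  set β := stdOrthonormalBasis ℂ F with hβ
  have hsum : ∀ v, (trivializationAt F E p).symm x v =
      ∑ a, inner ℂ (β a) v • (trivializationAt F E p).symm x (β a) := by
    intro v
    rw [← Trivialization.symmₗ_apply (R := ℂ) _ hy.2]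
    conv_lhs => rw [← β.sum_repr' v]
    simp only [map_sum, map_smul]
    refine Finset.sum_congr rfl fun a _ => ?_
    rw [Trivialization.symmₗ_apply (R := ℂ) _ hy.2]
  rw [hsum v, hsum w, sum_inner]
  simp only [gram, ← hβ, _root_.sum_apply, inner_sum, inner_smul_left, inner_smul_right,
    _root_.smul_apply, ContinuousLinearMap.smulRight_apply, innerSL_apply_apply, inner_conj_symm]
  refine Finset.sum_congr rfl fun a _ => Finset.sum_congr rfl fun b _ => ?_
  ring

theorem inner_gram_localRep [FiniteDimensional ℂ F] {p : N} {y : EuclideanSpace ℝ (Fin n)}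
    (hy : y ∈ localDomain n F E p) (u v : ∀ x, E x) :
    inner ℂ (localRep n F E p u y) (gram n F E p y (localRep n F E p v y)) =
      inner ℂ (u ((chartAt (EuclideanSpace ℝ (Fin n)) p).symm y))
        (v ((chartAt (EuclideanSpace ℝ (Fin n)) p).symm y)) := by
  rw [inner_gram_right hy, symm_localRep hy, symm_localRep hy]

variable [CompactSpace N] [T2Space N] [IsSmoothHermitian n F E]

/-- A constant local section, extended to a smooth section of the bundle. -/
theorem exists_section_eq_symm (p : N) {x₀ : N} (hx₀ : x₀ ∈ (trivializationAt F E p).baseSet)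
    (v : F) : ∃ u : SmoothSections n F E,
      ∀ᶠ x in 𝓝 x₀, u x = (trivializationAt F E p).symm x v := by
  set e := trivializationAt F E p
  obtain ⟨θ, h0, h1, -⟩ := exists_contMDiffMap_zero_one_nhds_of_isClosed (𝓡 n) (n := ⊤)
    e.open_baseSet.isClosed_compl (isClosed_singleton (x := x₀))
    (disjoint_singleton_right.2 fun h => h hx₀)
  have hs : tsupport θ ⊆ e.baseSet := by
    intro x hx
    by_contra hxe
    have h2 : ∀ᶠ z in 𝓝 x, θ z = 0 := (nhds_le_nhdsSet (s := e.baseSetᶜ) hxe) h0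
    exact (notMem_tsupport_iff_eventuallyEq.2 h2) hx
  have hsec : ContMDiffOn (𝓡 n) ((𝓡 n).prod 𝓘(ℝ, F)) ∞
      (fun x => TotalSpace.mk' F x (e.symm x v)) e.baseSet := by
    rw [e.contMDiffOn_section_baseSet_iff]
    refine (contMDiffOn_const (c := v)).congr fun x hx => ?_
    rw [e.apply_mk_symm hx]
  refine ⟨⟨(θ : N → ℝ) • fun x => e.symm x v,
    ContMDiffOn.smul_section_of_tsupport θ.contMDiff.contMDiffOn e.open_baseSet hs hsec⟩, ?_⟩
  rw [nhdsSet_singleton] at h1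
  filter_upwards [h1] with x hx
  change θ x • e.symm x v = _
  rw [hx, one_smul]

theorem contDiffOn_gram [FiniteDimensional ℂ F] (p : N) :
    ContDiffOn ℝ ∞ (gram n F E p) (localDomain n F E p) := by
  unfold gram
  refine ContDiffOn.sum fun a _ => ContDiffOn.sum fun b _ => ContDiffOn.fun_smul ?_ contDiffOn_const
  intro y hy
  obtain ⟨u, hu⟩ := exists_section_eq_symm (n := n) p hy.2 (stdOrthonormalBasis ℂ F a)
  obtain ⟨v, hv⟩ := exists_section_eq_symm (n := n) p hy.2 (stdOrthonormalBasis ℂ F b)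
  have h1 : ContDiffOn ℝ ∞ (fun y => inner ℂ (u ((chartAt (EuclideanSpace ℝ (Fin n)) p).symm y))
      (v ((chartAt (EuclideanSpace ℝ (Fin n)) p).symm y))) (localDomain n F E p) := by
    rw [← contMDiffOn_iff_contDiffOn]
    have h2 : ContMDiffOn (𝓡 n) (𝓡 n) ∞ (chartAt (EuclideanSpace ℝ (Fin n)) p).symm
      (chartAt (EuclideanSpace ℝ (Fin n)) p).target := contMDiffOn_chart_symm
    exact (IsSmoothHermitian.contMDiff_inner u v).comp_contMDiffOn (h2.mono inter_subset_left)
  refine ((h1.contDiffAt ((isOpen_localDomain n F E p).mem_nhds hy)).congr_of_eventuallyEq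
    ?_).contDiffWithinAt
  have hc : Tendsto (chartAt (EuclideanSpace ℝ (Fin n)) p).symm (𝓝 y)
      (𝓝 ((chartAt (EuclideanSpace ℝ (Fin n)) p).symm y)) :=
    (chartAt (EuclideanSpace ℝ (Fin n)) p).continuousAt_symm hy.1
  filter_upwards [hc.eventually hu, hc.eventually hv] with z hz1 hz2
  rw [hz1, hz2]

end Geometry

section ChangeOfVariables

variable {n : ℕ} {N : Type*} [TopologicalSpace N] [ChartedSpace (EuclideanSpace ℝ (Fin n)) N]
  [MeasurableSpace N] [BorelSpace N] (μ : Measure N) [IsSmoothDensity n μ]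

/-- The density of a smooth measure in the chart at `p`. -/
def chartDensity (p : N) : EuclideanSpace ℝ (Fin n) → ℝ :=
  (IsSmoothDensity.exists_density (n := n) (μ := μ) p).choose

theorem contDiffOn_chartDensity (p : N) :
    ContDiffOn ℝ ∞ (chartDensity (n := n) μ p) (chartAt (EuclideanSpace ℝ (Fin n)) p).target :=
  (IsSmoothDensity.exists_density (n := n) (μ := μ) p).choose_spec.1

theorem chartDensity_pos {p : N} {y : EuclideanSpace ℝ (Fin n)}
    (hy : y ∈ (chartAt (EuclideanSpace ℝ (Fin n)) p).target) : 0 < chartDensity (n := n) μ p y :=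
  (IsSmoothDensity.exists_density (n := n) (μ := μ) p).choose_spec.2.1 y hy

theorem setIntegral_comp_chart (p : N) {k : EuclideanSpace ℝ (Fin n) → ℂ}
    (hk : ContinuousOn k (chartAt (EuclideanSpace ℝ (Fin n)) p).target) :
    ∫ x in (chartAt (EuclideanSpace ℝ (Fin n)) p).source,
        k (chartAt (EuclideanSpace ℝ (Fin n)) p x) ∂μ =
      ∫ y in (chartAt (EuclideanSpace ℝ (Fin n)) p).target, chartDensity (n := n) μ p y • k y := by
  set φ := chartAt (EuclideanSpace ℝ (Fin n)) p with hφ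
  have hmap : (μ.restrict φ.source).map φ = (volume.restrict φ.target).withDensity
      fun y => ENNReal.ofReal (chartDensity (n := n) μ p y) :=
    (IsSmoothDensity.exists_density (n := n) (μ := μ) p).choose_spec.2.2
  have hm : AEMeasurable φ (μ.restrict φ.source) :=
    φ.continuousOn.aemeasurable φ.open_source.measurableSet
  have hk' : AEStronglyMeasurable k ((μ.restrict φ.source).map φ) := by
    rw [hmap]
    exact (hk.aestronglyMeasurable φ.open_target.measurableSet).mono_ac
      (withDensity_absolutelyContinuous _ _)
  rw [← integral_map hm hk', hmap, integral_withDensity_eq_integral_toReal_smul₀]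
  · refine setIntegral_congr_fun φ.open_target.measurableSet fun y hy => ?_
    simp only [ENNReal.toReal_ofReal (chartDensity_pos μ hy).le]
  · exact ((contDiffOn_chartDensity μ p).continuousOn.aemeasurable
      φ.open_target.measurableSet).ennreal_ofReal
  · exact .of_forall fun _ => ENNReal.ofReal_lt_top

end ChangeOfVariables

/-! ### Local coefficients -/

section LocalCoefficient

variable {n : ℕ} {N : Type*} [TopologicalSpace N] [ChartedSpace (EuclideanSpace ℝ (Fin n)) N]
  {F : Type*} [NormedAddCommGroup F] [InnerProductSpace ℂ F] [FiniteDimensional ℂ F]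
  (E : N → Type*) [TopologicalSpace (TotalSpace F E)] [∀ x, NormedAddCommGroup (E x)]
  [∀ x, InnerProductSpace ℂ (E x)] [FiberBundle F E] [IsManifold (𝓡 n) ∞ N] [VectorBundle ℂ F E]
  [ContMDiffVectorBundle ∞ F E (𝓡 n)]

/-- A smooth matrix-valued function with compact support in the coordinate domain at `p`. -/
structure IsLocalCoefficient (p : N) (G : EuclideanSpace ℝ (Fin n) → F →L[ℂ] F) : Prop where
  contDiff : ContDiff ℝ ∞ G
  hasCompactSupport : HasCompactSupport G
  tsupport_subset : tsupport G ⊆ localDomain n F E p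

variable {E}

namespace IsLocalCoefficient

variable {p : N} {G G' : EuclideanSpace ℝ (Fin n) → F →L[ℂ] F}

theorem of_eq_zero {K : Set (EuclideanSpace ℝ (Fin n))} (hK : IsCompact K)
    (hKp : K ⊆ localDomain n F E p) (hG : ContDiffOn ℝ ∞ G (localDomain n F E p))
    (h : ∀ y ∉ K, G y = 0) : IsLocalCoefficient E p G := by
  have hs : tsupport G ⊆ K := closure_minimal (fun y hy => by
    by_contra hyK
    exact hy (h y hyK)) hK.isClosed
  exact ⟨contDiff_of_contDiffOn_of_tsupport (isOpen_localDomain n F E p) hG (hs.trans hKp),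
    HasCompactSupport.of_support_subset_isCompact hK (subset_closure.trans hs), hs.trans hKp⟩

theorem eq_zero_of_notMem (hG : IsLocalCoefficient E p G) {y : EuclideanSpace ℝ (Fin n)}
    (hy : y ∉ localDomain n F E p) : G y = 0 :=
  image_eq_zero_of_notMem_tsupport fun h => hy (hG.tsupport_subset h)

theorem of_bilinear (hG : IsLocalCoefficient E p G) (hG' : ContDiffOn ℝ ∞ G' (localDomain n F E p))
    (h : ∀ y, G y = 0 → G' y = 0) : IsLocalCoefficient E p G' :=
  of_eq_zero hG.hasCompactSupport hG.tsupport_subset hG' fun y hy =>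
    h y (image_eq_zero_of_notMem_tsupport hy)

theorem mul_right (hG : IsLocalCoefficient E p G) {a : EuclideanSpace ℝ (Fin n) → F →L[ℂ] F}
    (ha : ContDiffOn ℝ ∞ a (localDomain n F E p)) : IsLocalCoefficient E p fun y => G y * a y :=
  hG.of_bilinear (hG.contDiff.contDiffOn.mul ha) fun y hy => by rw [hy, zero_mul]

theorem mul_left (hG : IsLocalCoefficient E p G) {a : EuclideanSpace ℝ (Fin n) → F →L[ℂ] F}
    (ha : ContDiffOn ℝ ∞ a (localDomain n F E p)) : IsLocalCoefficient E p fun y => a y * G y :=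
  hG.of_bilinear (ha.mul hG.contDiff.contDiffOn) fun y hy => by rw [hy, mul_zero]

theorem add (hG : IsLocalCoefficient E p G) (hG' : IsLocalCoefficient E p G') :
    IsLocalCoefficient E p fun y => G y + G' y := by
  refine of_eq_zero (hG.hasCompactSupport.union hG'.hasCompactSupport)
    (union_subset hG.tsupport_subset hG'.tsupport_subset)
    (hG.contDiff.contDiffOn.add hG'.contDiff.contDiffOn) fun y hy => ?_
  rw [mem_union, not_or] at hy
  rw [image_eq_zero_of_notMem_tsupport hy.1, image_eq_zero_of_notMem_tsupport hy.2, add_zero]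

theorem neg (hG : IsLocalCoefficient E p G) : IsLocalCoefficient E p fun y => -G y :=
  hG.of_bilinear hG.contDiff.contDiffOn.neg fun y hy => by rw [hy, neg_zero]

theorem zero : IsLocalCoefficient E p (fun _ : EuclideanSpace ℝ (Fin n) => (0 : F →L[ℂ] F)) :=
  of_eq_zero isCompact_empty (empty_subset _) contDiffOn_const fun _ _ => rfl

theorem sum {κ : Type*} (t : Finset κ) {G : κ → EuclideanSpace ℝ (Fin n) → F →L[ℂ] F}
    (hG : ∀ i ∈ t, IsLocalCoefficient E p (G i)) :
    IsLocalCoefficient E p fun y => ∑ i ∈ t, G i y := by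
  classical
  induction t using Finset.induction_on with
  | empty => simpa using zero
  | insert i t hi ih =>
    simp only [Finset.sum_insert hi]
    exact (hG i (Finset.mem_insert_self i t)).add
      (ih fun k hk => hG k (Finset.mem_insert_of_mem hk))

theorem fderiv_apply (hG : IsLocalCoefficient E p G) (v : EuclideanSpace ℝ (Fin n)) :
    IsLocalCoefficient E p fun y => fderiv ℝ G y v := by
  refine of_eq_zero hG.hasCompactSupport hG.tsupport_subset
    ((hG.contDiff.fderiv_right (m := ∞) (by simp)).clm_apply contDiff_const).contDiffOn
    fun y hy => ?_
  rw [image_eq_zero_of_notMem_tsupport (fun h => hy (tsupport_fderiv_subset ℝ h))]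
  rfl

theorem of_scalar {χ : EuclideanSpace ℝ (Fin n) → ℝ}
    {K : Set (EuclideanSpace ℝ (Fin n))} (hK : IsCompact K) (hKp : K ⊆ localDomain n F E p)
    (hχ : ContDiffOn ℝ ∞ χ (localDomain n F E p)) (h : ∀ y ∉ K, χ y = 0)
    (hG : ContDiffOn ℝ ∞ G (localDomain n F E p)) :
    IsLocalCoefficient E p fun y => χ y • G y :=
  of_eq_zero hK hKp (hχ.fun_smul hG) fun y hy => by rw [h y hy, zero_smul]

theorem exists_bound (hG : IsLocalCoefficient E p G) : ∃ C : ℝ, 0 ≤ C ∧ ∀ y, ‖G y‖ ≤ C :=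
  exists_bound_of_hasCompactSupport hG.contDiff.continuous hG.hasCompactSupport

theorem contDiff_apply_localRep (hG : IsLocalCoefficient E p G) (u : SmoothSections n F E) :
    ContDiff ℝ ∞ fun y => G y (localRep n F E p u y) := by
  refine contDiff_of_contDiffOn_of_tsupport (isOpen_localDomain n F E p)
    (((ContinuousLinearMap.restrictScalarsL ℂ F F ℝ ℝ).contDiff.comp_contDiffOn
      hG.contDiff.contDiffOn).clm_apply (contDiffOn_localRep n F E p u))
    ((closure_mono fun y hy => ?_).trans hG.tsupport_subset)
  intro h0
  exact hy (by simp [h0])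

theorem hasCompactSupport_apply_localRep (hG : IsLocalCoefficient E p G) (u : ∀ x, E x) :
    HasCompactSupport fun y => G y (localRep n F E p u y) :=
  hG.hasCompactSupport.mono fun y hy h0 => hy (by simp [h0])

/-- The map `u ↦ G u` from smooth sections to Schwartz functions, in the coordinates at `p`. -/
def cut (hG : IsLocalCoefficient E p G) :
    SmoothSections n F E →ₗ[ℂ] 𝓢(EuclideanSpace ℝ (Fin n), F) where
  toFun u := (hG.hasCompactSupport_apply_localRep u).toSchwartzMap (hG.contDiff_apply_localRep u)
  map_add' u v := by
    ext y
    change G y (localRep n F E p (⇑u + ⇑v) y) = G y _ + G y _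
    by_cases hy : y ∈ localDomain n F E p
    · rw [localRep_add hy, map_add]
    · simp [hG.eq_zero_of_notMem hy]
  map_smul' c u := by
    ext y
    change G y (localRep n F E p (c • ⇑u) y) = c • G y _
    by_cases hy : y ∈ localDomain n F E p
    · rw [localRep_smul hy, map_smul]
    · simp [hG.eq_zero_of_notMem hy]

theorem cut_apply (hG : IsLocalCoefficient E p G) (u : SmoothSections n F E)
    (y : EuclideanSpace ℝ (Fin n)) : hG.cut u y = G y (localRep n F E p u y) := rfl

theorem lineDeriv_cut (hG : IsLocalCoefficient E p G) (u : SmoothSections n F E)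
    {y : EuclideanSpace ℝ (Fin n)} (hy : y ∈ localDomain n F E p) (v : EuclideanSpace ℝ (Fin n)) :
    fderiv ℝ (hG.cut u) y v = G y (fderiv ℝ (localRep n F E p u) y v) +
      fderiv ℝ G y v (localRep n F E p u y) :=
  fderiv_clm_apply_of_complex (hG.contDiff.differentiable (by simp) y)
    (((contDiffOn_localRep n F E p u).contDiffAt
      ((isOpen_localDomain n F E p).mem_nhds hy)).differentiableAt (by simp)) v

theorem fderiv_cut_eq_zero (hG : IsLocalCoefficient E p G) (u : SmoothSections n F E)
    {y : EuclideanSpace ℝ (Fin n)} (hy : y ∉ tsupport G) : fderiv ℝ (hG.cut u) y = 0 := by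
  refine image_eq_zero_of_notMem_tsupport fun h => hy (closure_mono ?_ (tsupport_fderiv_subset ℝ h))
  intro z hz h0
  exact hz (by rw [cut_apply, h0]; rfl)

end IsLocalCoefficient

end LocalCoefficient

section LocalPairing

variable {n : ℕ} {N : Type*} [TopologicalSpace N] [ChartedSpace (EuclideanSpace ℝ (Fin n)) N]
  {F : Type*} [NormedAddCommGroup F] [InnerProductSpace ℂ F] [FiniteDimensional ℂ F]
  {E : N → Type*} [TopologicalSpace (TotalSpace F E)] [∀ x, NormedAddCommGroup (E x)]
  [∀ x, InnerProductSpace ℂ (E x)] [FiberBundle F E] [IsManifold (𝓡 n) ∞ N] [VectorBundle ℂ F E]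
  [ContMDiffVectorBundle ∞ F E (𝓡 n)] [CompactSpace N] [T2Space N] [IsSmoothHermitian n F E]
  [MeasurableSpace N] [BorelSpace N] (μ : Measure N) [IsSmoothDensity n μ]

variable (E) in
/-- The coefficient `χ ρ g`, where `ρ` is the density of the measure and `g` the Gram operator. -/
theorem isLocalCoefficient_gram {p : N} {χ : EuclideanSpace ℝ (Fin n) → ℝ}
    {K : Set (EuclideanSpace ℝ (Fin n))} (hK : IsCompact K) (hKp : K ⊆ localDomain n F E p)
    (hχ : ContDiffOn ℝ ∞ χ (localDomain n F E p)) (h : ∀ y ∉ K, χ y = 0) :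
    IsLocalCoefficient E p fun y => χ y • (chartDensity (n := n) μ p y • gram n F E p y) :=
  .of_scalar hK hKp hχ h (((contDiffOn_chartDensity μ p).mono inter_subset_left).fun_smul
    (contDiffOn_gram p))

theorem setIntegral_mul_inner {p : N} {χ : EuclideanSpace ℝ (Fin n) → ℝ}
    {K : Set (EuclideanSpace ℝ (Fin n))} (hKp : K ⊆ localDomain n F E p)
    (hχ : ContinuousOn χ (chartAt (EuclideanSpace ℝ (Fin n)) p).target) (h : ∀ y ∉ K, χ y = 0)
    (u v : SmoothSections n F E) :
    ∫ x in (chartAt (EuclideanSpace ℝ (Fin n)) p).source,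
        (χ (chartAt (EuclideanSpace ℝ (Fin n)) p x) : ℂ) * inner ℂ (u x) (v x) ∂μ =
      ∫ y, inner ℂ (localRep n F E p u y)
        ((χ y • (chartDensity (n := n) μ p y • gram n F E p y)) (localRep n F E p v y)) := by
  set φ := chartAt (EuclideanSpace ℝ (Fin n)) p with hφ
  have h1 := setIntegral_comp_chart (n := n) μ p
    (k := fun y => (χ y : ℂ) * inner ℂ (u (φ.symm y)) (v (φ.symm y)))
    ((Complex.continuous_ofReal.comp_continuousOn hχ).mul
      ((continuous_inner_sections u v).comp_continuousOn φ.continuousOn_symm))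
  have h2 : ∫ x in φ.source, (χ (φ x) : ℂ) * inner ℂ (u x) (v x) ∂μ =
      ∫ x in φ.source, (χ (φ x) : ℂ) * inner ℂ (u (φ.symm (φ x))) (v (φ.symm (φ x))) ∂μ := by
    refine setIntegral_congr_fun φ.open_source.measurableSet fun x hx => ?_
    exact congrArg (fun z => (χ (φ x) : ℂ) * inner ℂ (u z) (v z)) (φ.left_inv hx).symm
  rw [h2, h1]
  refine Eq.trans ?_ (setIntegral_eq_integral_of_forall_compl_eq_zero (s := φ.target) ?_)
  · refine setIntegral_congr_fun φ.open_target.measurableSet fun y _ => ?_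
    by_cases hy : y ∈ localDomain n F E p
    · change (chartDensity (n := n) μ p y) • ((χ y : ℂ) * inner ℂ (u (φ.symm y)) (v (φ.symm y))) =
        inner ℂ _ (χ y • (chartDensity (n := n) μ p y • gram n F E p y (localRep n F E p v y)))
      rw [← inner_gram_localRep hy, inner_smul_right_eq_smul, inner_smul_right_eq_smul]
      simp only [Complex.real_smul]
      ring
    · have h0 : χ y = 0 := h y fun hyK => hy (hKp hyK)
      simp [h0]
  · intro y hy
    have h0 : χ y = 0 := h y fun hyK => hy (hKp hyK).1
    simp [h0]

theorem norm_toL2_sq (u : SmoothSections n F E) : ‖toL2 μ u‖ ^ 2 = ∫ x, ‖u x‖ ^ 2 ∂μ := by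
  have h := inner_toL2 μ u u
  rw [inner_self_eq_norm_sq_to_K] at h
  have h2 : ∀ x, inner ℂ (u x) (u x) = ((‖u x‖ ^ 2 : ℝ) : ℂ) := fun x => by
    rw [inner_self_eq_norm_sq_to_K]; norm_cast
  simp only [h2] at h
  rw [integral_complex_ofReal] at h
  apply Complex.ofReal_injective
  rw [← h]
  norm_cast

/-- On compact subsets of the coordinate domain the Gram operator is bounded from below. -/
theorem exists_le_gram {p : N} {K : Set (EuclideanSpace ℝ (Fin n))} (hK : IsCompact K)
    (hKp : K ⊆ localDomain n F E p) :
    ∃ m : ℝ, 0 < m ∧ ∀ y ∈ K, ∀ w : F, m * ‖w‖ ^ 2 ≤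
      RCLike.re (inner ℂ w ((chartDensity (n := n) μ p y • gram n F E p y) w)) := by
  have hc : ContinuousOn (fun q : EuclideanSpace ℝ (Fin n) × F =>
      RCLike.re (inner ℂ q.2 ((chartDensity (n := n) μ p q.1 • gram n F E p q.1) q.2)))
      (K ×ˢ Metric.sphere 0 1) := by
    have h1 : ContinuousOn (fun y => chartDensity (n := n) μ p y • gram n F E p y) K :=
      (((contDiffOn_chartDensity μ p).continuousOn.mono inter_subset_left).smul
        (contDiffOn_gram p).continuousOn).mono hKp
    exact RCLike.continuous_re.comp_continuousOn (continuousOn_snd.inner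
      ((h1.comp continuousOn_fst fun q hq => hq.1).clm_apply continuousOn_snd))
  have hpos : ∀ y ∈ K, ∀ w : F, w ≠ 0 →
      0 < RCLike.re (inner ℂ w ((chartDensity (n := n) μ p y • gram n F E p y) w)) := by
    intro y hy w hw
    have hy' := hKp hy
    rw [_root_.smul_apply, inner_smul_right_eq_smul, RCLike.smul_re, inner_gram_right hy',
      inner_self_eq_norm_sq]
    refine mul_pos (chartDensity_pos μ hy'.1) (pow_pos (norm_pos_iff.2 fun h0 => hw ?_) 2)
    have e1 := (trivializationAt F E p).apply_mk_symm hy'.2 w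
    have e2 := (trivializationAt F E p).apply_mk_symm hy'.2 (0 : F)
    rw [h0] at e1
    rw [← Trivialization.symmₗ_apply (R := ℂ) _ hy'.2, map_zero, e1] at e2
    exact congrArg Prod.snd e2
  obtain ⟨m, hm, hm'⟩ := (hK.prod (isCompact_sphere (0 : F) 1)).exists_forall_le' hc (a := 0)
    fun q hq => hpos q.1 hq.1 q.2 (ne_zero_of_mem_unit_sphere ⟨q.2, hq.2⟩)
  refine ⟨m, hm, fun y hy w => ?_⟩
  rcases eq_or_ne w 0 with rfl | hw
  · simp
  have hw' : 0 < ‖w‖ := norm_pos_iff.2 hw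
  have h1 := hm' (y, ((‖w‖⁻¹ : ℝ) : ℂ) • w) ⟨hy, by
    rw [mem_sphere_zero_iff_norm, norm_smul, Complex.norm_real, norm_inv, norm_norm,
      inv_mul_cancel₀ hw'.ne']⟩
  simp only [map_smul, inner_smul_left, inner_smul_right, Complex.conj_ofReal] at h1
  rw [← mul_assoc, ← Complex.ofReal_mul] at h1
  have h2 : RCLike.re (((‖w‖⁻¹ * ‖w‖⁻¹ : ℝ) : ℂ) *
      inner ℂ w ((chartDensity (n := n) μ p y • gram n F E p y) w)) = (‖w‖⁻¹ * ‖w‖⁻¹) *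
        RCLike.re (inner ℂ w ((chartDensity (n := n) μ p y • gram n F E p y) w)) :=
    Complex.re_ofReal_mul _ _
  rw [h2] at h1
  calc m * ‖w‖ ^ 2 ≤ (‖w‖⁻¹ * ‖w‖⁻¹) *
        RCLike.re (inner ℂ w ((chartDensity (n := n) μ p y • gram n F E p y) w)) * ‖w‖ ^ 2 := by
        gcongr
    _ = _ := by field_simp

/-- The local `L²` norms are bounded by the global one. -/
theorem IsLocalCoefficient.exists_besselNorm_zero_cut_le {p : N}
    {G : EuclideanSpace ℝ (Fin n) → F →L[ℂ] F} (hG : IsLocalCoefficient E p G) :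
    ∃ C : ℝ, 0 ≤ C ∧ ∀ u, besselNorm 0 (hG.cut u) ≤ C * ‖toL2 μ u‖ := by
  obtain ⟨C, hC, hGC⟩ := hG.exists_bound
  obtain ⟨m, hm, hmK⟩ := exists_le_gram (E := E) μ hG.hasCompactSupport hG.tsupport_subset
  obtain ⟨χ, hχ, hχc, hχs, hχ01, hχ1⟩ := exists_smooth_cutoff hG.hasCompactSupport
    (isOpen_localDomain n F E p) hG.tsupport_subset
  have hM := isLocalCoefficient_gram E μ hχc hχs hχ.contDiffOn
    fun y hy => image_eq_zero_of_notMem_tsupport hy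
  set M : EuclideanSpace ℝ (Fin n) → F →L[ℂ] F :=
    fun y => χ y • (chartDensity (n := n) μ p y • gram n F E p y) with hMdef
  refine ⟨C * √m⁻¹, by positivity, fun u => ?_⟩
  set q : EuclideanSpace ℝ (Fin n) → ℂ := fun y =>
    inner ℂ (localRep n F E p u y) (M y (localRep n F E p u y)) with hq
  have hq0 : ∀ y, 0 ≤ RCLike.re (q y) := by
    intro y
    by_cases hy : y ∈ localDomain n F E p
    · have e : q y = χ y • chartDensity (n := n) μ p y •
          inner ℂ (localRep n F E p u y) (gram n F E p y (localRep n F E p u y)) := by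
        rw [← inner_smul_right_eq_smul, ← inner_smul_right_eq_smul]
        rfl
      rw [e, inner_gram_localRep hy, RCLike.smul_re, RCLike.smul_re]
      exact mul_nonneg (hχ01 y).1 (mul_nonneg (chartDensity_pos μ hy.1).le inner_self_nonneg)
    · have e : M y = 0 := hM.eq_zero_of_notMem hy
      simp [hq, e]
  have hqi : Integrable q := by
    have hc : ContDiff ℝ ∞ q := by
      refine contDiff_of_contDiffOn_of_tsupport (isOpen_localDomain n F E p)
        ((contDiffOn_localRep n F E p u).inner ℂ (hM.contDiff_apply_localRep u).contDiffOn)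
        ((closure_mono fun y hy => ?_).trans hM.tsupport_subset)
      intro h0
      exact hy (by simp [hq, h0])
    exact hc.continuous.integrable_of_hasCompactSupport
      (hM.hasCompactSupport.mono fun y hy h0 => hy (by simp [hq, h0]))
  have hpt : ∀ y, ‖hG.cut u y‖ ^ 2 ≤ C ^ 2 * m⁻¹ * RCLike.re (q y) := by
    intro y
    by_cases hy : y ∈ tsupport G
    · have h1 := hmK y hy (localRep n F E p u y)
      have h2 : ‖hG.cut u y‖ ≤ C * ‖localRep n F E p u y‖ := (G y).le_of_opNorm_le (hGC y) _
      have h3 : q y = inner ℂ (localRep n F E p u y)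
          ((chartDensity (n := n) μ p y • gram n F E p y) (localRep n F E p u y)) := by
        simp [hq, hMdef, hχ1 y hy]
      rw [h3]
      calc ‖hG.cut u y‖ ^ 2 ≤ (C * ‖localRep n F E p u y‖) ^ 2 := by gcongr
        _ = C ^ 2 * m⁻¹ * (m * ‖localRep n F E p u y‖ ^ 2) := by field_simp
        _ ≤ _ := by gcongr
    · rw [IsLocalCoefficient.cut_apply, image_eq_zero_of_notMem_tsupport hy]
      rw [_root_.zero_apply, norm_zero, zero_pow two_ne_zero]
      exact mul_nonneg (by positivity) (hq0 y)
  have hint : ∫ y, RCLike.re (q y) ≤ ‖toL2 μ u‖ ^ 2 := by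
    have hfin := IsSmoothDensity.isFiniteMeasure (n := n) μ
    have e1 : ∫ y, RCLike.re (q y) = RCLike.re (∫ y, q y) := integral_re hqi
    rw [e1, hq, hMdef, ← setIntegral_mul_inner μ hχs hχ.continuous.continuousOn
      (fun y hy => image_eq_zero_of_notMem_tsupport hy), norm_toL2_sq]
    have hi : Integrable (fun x => ‖u x‖ ^ 2) μ := by
      refine (integrable_inner_sections μ u u).norm.congr (.of_forall fun x => ?_)
      simp only [inner_self_eq_norm_sq_to_K]
      norm_cast
      simp
    refine (RCLike.re_le_norm _).trans ((norm_integral_le_of_norm_le hi.integrableOn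
      (.of_forall fun x => ?_)).trans (setIntegral_le_integral hi
        (.of_forall fun x => sq_nonneg _)))
    rw [norm_mul, Complex.norm_real, Real.norm_of_nonneg (hχ01 _).1]
    refine (mul_le_of_le_one_left (norm_nonneg _) (hχ01 _).2).trans ?_
    rw [inner_self_eq_norm_sq_to_K]
    norm_cast
    simp
  refine le_of_sq_le_sq ?_ (by positivity)
  rw [← ENNReal.ofReal_le_ofReal_iff (by positivity), ofReal_besselNorm_zero_sq]
  calc ∫⁻ y, ENNReal.ofReal (‖hG.cut u y‖ ^ 2)
      ≤ ∫⁻ y, ENNReal.ofReal (C ^ 2 * m⁻¹ * RCLike.re (q y)) :=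
        lintegral_mono fun y => ENNReal.ofReal_le_ofReal (hpt y)
    _ = ENNReal.ofReal (∫ y, C ^ 2 * m⁻¹ * RCLike.re (q y)) :=
        (ofReal_integral_eq_lintegral_ofReal (hqi.re.const_mul _) (.of_forall fun y =>
          mul_nonneg (by positivity) (hq0 y))).symm
    _ ≤ _ := by
        refine ENNReal.ofReal_le_ofReal ?_
        rw [integral_const_mul, mul_pow, mul_pow, Real.sq_sqrt (by positivity)]
        gcongr

end LocalPairing

/-! ### Elliptic estimates -/

section Elliptic

open scoped LineDeriv

variable {n : ℕ} {N : Type*} [TopologicalSpace N] [ChartedSpace (EuclideanSpace ℝ (Fin n)) N]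
  {F : Type*} [NormedAddCommGroup F] [InnerProductSpace ℂ F] [FiniteDimensional ℂ F]
  {E : N → Type*} [TopologicalSpace (TotalSpace F E)] [∀ x, NormedAddCommGroup (E x)]
  [∀ x, InnerProductSpace ℂ (E x)] [FiberBundle F E] [IsManifold (𝓡 n) ∞ N] [VectorBundle ℂ F E]
  [ContMDiffVectorBundle ∞ F E (𝓡 n)] [CompactSpace N] [T2Space N] [IsSmoothHermitian n F E]
  [MeasurableSpace N] [BorelSpace N] (μ : Measure N) [IsSmoothDensity n μ]
  {A : SmoothSections n F E →ₗ[ℂ] SmoothSections n F E} {p : N}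
  {a : Fin n → EuclideanSpace ℝ (Fin n) → F →L[ℂ] F} {b : EuclideanSpace ℝ (Fin n) → F →L[ℂ] F}

theorem HasCoefficients.sub_smul (hA : HasCoefficients n F E A p a b) (c : ℂ) :
    HasCoefficients n F E (A - c • LinearMap.id) p a fun y => b y - c • 1 := by
  refine ⟨hA.1, hA.2.1.sub contDiffOn_const, fun u y hy => ?_⟩
  have e : ⇑((A - c • LinearMap.id : SmoothSections n F E →ₗ[ℂ] SmoothSections n F E) u) =
      ⇑(A u) + (-c) • ⇑u := by
    funext x
    change A u x - c • u x = A u x + (-c) • u x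
    rw [neg_smul, sub_eq_add_neg]
  rw [e, localRep_add hy, localRep_smul hy, hA.2.2 u y hy, _root_.sub_apply, _root_.smul_apply,
    one_apply_eq_self]
  module

theorem IsFirstOrderElliptic.sub_smul (hA : IsFirstOrderElliptic n F E A) (c : ℂ) :
    IsFirstOrderElliptic n F E (A - c • LinearMap.id) := fun p => by
  obtain ⟨a, b, h1, h2⟩ := hA p
  exact ⟨a, _, h1.sub_smul c, h2⟩

/-- Operators of first order are bounded from `L²` to the (local) Sobolev spaces of order `-1`: the
derivatives are moved to the left of the coefficients. -/
theorem HasCoefficients.exists_besselNorm_neg_one_cut_le (hA : HasCoefficients n F E A p a b)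
    {G : EuclideanSpace ℝ (Fin n) → F →L[ℂ] F} (hG : IsLocalCoefficient E p G) :
    ∃ C : ℝ, 0 ≤ C ∧ ∀ u, besselNorm (-1) (hG.cut (A u)) ≤ C * ‖toL2 μ u‖ := by
  have h1 : ∀ j, IsLocalCoefficient E p fun y => G y * a j y := fun j => hG.mul_right (hA.1 j)
  have h2 : IsLocalCoefficient E p fun y => G y * b y +
      -∑ j, fderiv ℝ (fun y => G y * a j y) y (EuclideanSpace.single j 1) :=
    (hG.mul_right hA.2.1).add
      (IsLocalCoefficient.sum _ fun j _ => (h1 j).fderiv_apply _).neg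
  choose C hC hCle using fun j => (h1 j).exists_besselNorm_zero_cut_le μ
  obtain ⟨D, hD, hDle⟩ := h2.exists_besselNorm_zero_cut_le μ
  refine ⟨∑ j, 2 * Real.pi * C j + D, add_nonneg (Finset.sum_nonneg fun j _ =>
    mul_nonneg (by positivity) (hC j)) hD, fun u => ?_⟩
  have key : hG.cut (A u) = ∑ j, ∂_{EuclideanSpace.single j (1 : ℝ)} ((h1 j).cut u) + h2.cut u := by
    ext y
    rw [_root_.add_apply, _root_.sum_apply]
    simp only [SchwartzMap.lineDerivOp_apply_eq_fderiv]
    by_cases hy : y ∈ localDomain n F E p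
    · simp only [(h1 _).lineDeriv_cut u hy, IsLocalCoefficient.cut_apply, hA.2.2 u y hy, map_add,
        map_sum, _root_.add_apply, _root_.neg_apply, _root_.sum_apply, mul_apply_eq_comp,
        Finset.sum_add_distrib]
      abel
    · have e : ∀ j, fderiv ℝ ((h1 j).cut u) y = 0 := fun j =>
        (h1 j).fderiv_cut_eq_zero u fun h => hy ((h1 j).tsupport_subset h)
      have e2 : h2.cut u y = 0 := by
        rw [IsLocalCoefficient.cut_apply, h2.eq_zero_of_notMem hy, _root_.zero_apply]
      rw [e2, IsLocalCoefficient.cut_apply, hG.eq_zero_of_notMem hy]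
      simp only [e, _root_.zero_apply, Finset.sum_const_zero, add_zero]
  rw [key, add_mul, Finset.sum_mul]
  refine (besselNorm_add_le _ _ _).trans (add_le_add ((besselNorm_sum_le _ _ _).trans
    (Finset.sum_le_sum fun j _ => ?_)) ((besselNorm_mono (by norm_num) _).trans (hDle u)))
  have h3 := besselNorm_lineDeriv_le (-1) ((h1 j).cut u) j
  rw [neg_add_cancel] at h3
  exact h3.trans ((mul_le_mul_of_nonneg_left (hCle j u) (by positivity)).trans_eq
    (mul_assoc _ _ _).symm)

/-- Invertibility of the symbol is uniform, by compactness of the unit spheres. -/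
theorem exists_elliptic_bound {a : Fin n → F →L[ℂ] F}
    (ha : ∀ ξ : Fin n → ℝ, ξ ≠ 0 → IsUnit (∑ j, (ξ j : ℂ) • a j)) :
    ∃ κ : ℝ, 0 < κ ∧ ∀ (ξ : EuclideanSpace ℝ (Fin n)) v,
      κ * ‖ξ‖ * ‖v‖ ≤ ‖∑ j, (ξ j : ℂ) • a j v‖ := by
  have hc : Continuous fun q : EuclideanSpace ℝ (Fin n) × F => ‖∑ j, (q.1 j : ℂ) • a j q.2‖ := by
    fun_prop
  have hpos : ∀ (ξ : EuclideanSpace ℝ (Fin n)) (v : F), ξ ≠ 0 → v ≠ 0 →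
      0 < ‖∑ j, (ξ j : ℂ) • a j v‖ := by
    intro ξ v hξ hv
    obtain ⟨T, hT⟩ := ha ξ fun h0 => hξ (by ext j; exact congrFun h0 j)
    rw [norm_pos_iff]
    intro h0
    have h1 : (T : F →L[ℂ] F) v = 0 := by rw [hT]; simpa using h0
    have h2 : ((T⁻¹ : (F →L[ℂ] F)ˣ) : F →L[ℂ] F) ((T : F →L[ℂ] F) v) = v := by
      rw [← mul_apply_eq_comp, T.inv_mul, one_apply_eq_self]
    rw [h1, map_zero] at h2
    exact hv h2.symm
  obtain ⟨κ, hκ, hκ'⟩ := ((isCompact_sphere (0 : EuclideanSpace ℝ (Fin n)) 1).prod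
    (isCompact_sphere (0 : F) 1)).exists_forall_le' hc.continuousOn (a := 0)
    fun q hq => hpos q.1 q.2 (ne_zero_of_mem_unit_sphere ⟨q.1, hq.1⟩)
      (ne_zero_of_mem_unit_sphere ⟨q.2, hq.2⟩)
  refine ⟨κ, hκ, fun ξ v => ?_⟩
  rcases eq_or_ne ξ 0 with rfl | hξ
  · simp
  rcases eq_or_ne v 0 with rfl | hv
  · simp
  have hξ' : 0 < ‖ξ‖ := norm_pos_iff.2 hξ
  have hv' : 0 < ‖v‖ := norm_pos_iff.2 hv
  have h1 := hκ' (‖ξ‖⁻¹ • ξ, ((‖v‖⁻¹ : ℝ) : ℂ) • v) ⟨by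
    rw [mem_sphere_zero_iff_norm, norm_smul, norm_inv, norm_norm, inv_mul_cancel₀ hξ'.ne'], by
    rw [mem_sphere_zero_iff_norm, norm_smul, Complex.norm_real, norm_inv, norm_norm,
      inv_mul_cancel₀ hv'.ne']⟩
  have h2 : ∑ j, ((‖ξ‖⁻¹ • ξ) j : ℂ) • a j (((‖v‖⁻¹ : ℝ) : ℂ) • v) =
      ((‖ξ‖⁻¹ * ‖v‖⁻¹ : ℝ) : ℂ) • ∑ j, (ξ j : ℂ) • a j v := by
    rw [Finset.smul_sum]
    refine Finset.sum_congr rfl fun j _ => ?_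
    rw [PiLp.smul_apply, smul_eq_mul, map_smul]
    push_cast
    module
  simp only [h2] at h1
  rw [norm_smul, Complex.norm_real, Real.norm_of_nonneg (by positivity)] at h1
  calc κ * ‖ξ‖ * ‖v‖ ≤ (‖ξ‖⁻¹ * ‖v‖⁻¹ * ‖∑ j, (ξ j : ℂ) • a j v‖) * ‖ξ‖ * ‖v‖ := by gcongr
    _ = _ := by field_simp

/-- The elliptic estimate near a point, by freezing the coefficients at this point. -/
theorem HasCoefficients.exists_nhds_besselNorm_one_cut_le (hA : HasCoefficients n F E A p a b)
    {y₀ : EuclideanSpace ℝ (Fin n)} (hy₀ : y₀ ∈ localDomain n F E p)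
    (hell : ∀ ξ : Fin n → ℝ, ξ ≠ 0 → IsUnit (∑ j, (ξ j : ℂ) • a j y₀)) :
    ∃ U ∈ 𝓝 y₀, ∀ (χ : EuclideanSpace ℝ (Fin n) → ℝ)
      (hG : IsLocalCoefficient E p fun y => χ y • (1 : F →L[ℂ] F)),
      tsupport (fun y => χ y • (1 : F →L[ℂ] F)) ⊆ U →
      ∃ C : ℝ, 0 ≤ C ∧ ∀ u, besselNorm 1 (hG.cut u) ≤ C * (‖toL2 μ (A u)‖ + ‖toL2 μ u‖) := by
  obtain ⟨κ, hκ, hκle⟩ := exists_elliptic_bound hell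
  set δ : ℝ := κ / (2 * (n + 1)) with hδ
  have hδ0 : 0 < δ := by positivity
  refine ⟨{y | ∀ j, ‖a j y₀ - a j y‖ < δ}, ?_, fun χ hG hU => ?_⟩
  · have h1 : ∀ j, ∀ᶠ y in 𝓝 y₀, ‖a j y₀ - a j y‖ < δ := by
      intro j
      have hc : ContinuousAt (a j) y₀ :=
        ((hA.1 j).contDiffAt ((isOpen_localDomain n F E p).mem_nhds hy₀)).continuousAt
      have h2 : Tendsto (fun y => ‖a j y₀ - a j y‖) (𝓝 y₀) (𝓝 0) := by
        have h3 : Tendsto (fun y => ‖a j y₀ - a j y‖) (𝓝 y₀) (𝓝 ‖a j y₀ - a j y₀‖) :=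
          (tendsto_const_nhds.sub hc).norm
        simpa using h3
      exact h2.eventually_lt_const hδ0
    exact eventually_all.2 h1
  set G : EuclideanSpace ℝ (Fin n) → F →L[ℂ] F := fun y => χ y • (1 : F →L[ℂ] F) with hGdef
  have h2 : IsLocalCoefficient E p fun y => -(G y * b y) +
      ∑ j, a j y * fderiv ℝ G y (EuclideanSpace.single j 1) :=
    (hG.mul_right hA.2.1).neg.add
      (IsLocalCoefficient.sum _ fun j _ => (hG.fderiv_apply _).mul_left (hA.1 j))
  obtain ⟨C, hC, hCle⟩ := hG.exists_besselNorm_zero_cut_le μ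
  obtain ⟨D, hD, hDle⟩ := h2.exists_besselNorm_zero_cut_le μ
  refine ⟨2 * (C + (2 * Real.pi * κ)⁻¹ * (C + D)), by positivity, fun u => ?_⟩
  set f := hG.cut u with hf
  have h3 := besselNorm_one_le_of_elliptic hκ hκle f
  set h := ∑ j, SchwartzMap.postcompCLM (a j y₀) (∂_{EuclideanSpace.single j (1 : ℝ)} f) with hh
  have hpt : ∀ y, ‖h y‖ ≤ ∑ i : Option (Option (Fin n)), (i.elim 1 fun i => i.elim 1 fun _ => δ) *
      ‖(i.elim (hG.cut (A u)) fun i => i.elim (h2.cut u) fun j =>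
        ∂_{EuclideanSpace.single j (1 : ℝ)} f) y‖ := by
    intro y
    have e0 : h y = ∑ j, a j y₀ (fderiv ℝ f y (EuclideanSpace.single j 1)) := by
      rw [hh, _root_.sum_apply]
      rfl
    by_cases hy : y ∈ tsupport G
    · have hyp := hG.tsupport_subset hy
      have e1 : h y = hG.cut (A u) y + (h2.cut u y +
          ∑ j, (a j y₀ - a j y) (fderiv ℝ f y (EuclideanSpace.single j 1))) := by
        have e2 : ∀ j, a j y (fderiv ℝ f y (EuclideanSpace.single j 1)) =
            G y (a j y (fderiv ℝ (localRep n F E p u) y (EuclideanSpace.single j 1))) +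
              a j y (fderiv ℝ G y (EuclideanSpace.single j 1) (localRep n F E p u y)) := by
          intro j
          rw [hf, hG.lineDeriv_cut u hyp, map_add]
          congr 1
          simp [hGdef]
        rw [e0]
        simp only [_root_.sub_apply, Finset.sum_sub_distrib, e2, IsLocalCoefficient.cut_apply,
          hA.2.2 u y hyp, map_add, map_sum, _root_.add_apply, _root_.neg_apply, _root_.sum_apply,
          mul_apply_eq_comp, Finset.sum_add_distrib]
        abel
      rw [e1, Fintype.sum_option, Fintype.sum_option]
      simp only [Option.elim_none, Option.elim_some, one_mul]
      refine (norm_add_le _ _).trans (add_le_add le_rfl ((norm_add_le _ _).trans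
        (add_le_add le_rfl ((norm_sum_le _ _).trans (Finset.sum_le_sum fun j _ => ?_)))))
      exact ContinuousLinearMap.le_of_opNorm_le _ (hU hy j).le _
    · have e1 : fderiv ℝ f y = 0 := hG.fderiv_cut_eq_zero u hy
      rw [e0]
      simp only [e1, _root_.zero_apply, map_zero, Finset.sum_const_zero, norm_zero]
      exact Finset.sum_nonneg fun i _ => mul_nonneg (by
        rcases i with _ | _ | i <;> simp [hδ0.le]) (norm_nonneg _)
  have h4 := besselNorm_zero_le_sum _ (fun i => by
    rcases i with _ | _ | i <;> simp [hδ0.le]) hpt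
  rw [Fintype.sum_option, Fintype.sum_option] at h4
  simp only [Option.elim_none, Option.elim_some, one_mul] at h4
  have h5 : ∑ j : Fin n, δ * besselNorm 0 (∂_{EuclideanSpace.single j (1 : ℝ)} f) ≤
      κ * Real.pi * besselNorm 1 f := by
    calc _ ≤ ∑ _j : Fin n, δ * (2 * Real.pi * besselNorm 1 f) := by
          refine Finset.sum_le_sum fun j _ => mul_le_mul_of_nonneg_left ?_ hδ0.le
          have := besselNorm_lineDeriv_le 0 f j
          rwa [zero_add] at this
      _ = (n / (n + 1)) * (κ * Real.pi * besselNorm 1 f) := by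
          rw [Finset.sum_const, Finset.card_univ, Fintype.card_fin, nsmul_eq_mul, hδ]
          field_simp
      _ ≤ _ := by
          refine mul_le_of_le_one_left (mul_nonneg (by positivity) (besselNorm_nonneg _ _)) ?_
          rw [div_le_one (by positivity)]
          linarith
  have h6 : (2 * Real.pi * κ)⁻¹ * besselNorm 0 h ≤ (2 * Real.pi * κ)⁻¹ *
      (besselNorm 0 (hG.cut (A u)) + besselNorm 0 (h2.cut u)) + 1 / 2 * besselNorm 1 f := by
    calc _ ≤ (2 * Real.pi * κ)⁻¹ * (besselNorm 0 (hG.cut (A u)) + (besselNorm 0 (h2.cut u) +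
          κ * Real.pi * besselNorm 1 f)) := by
          refine mul_le_mul_of_nonneg_left (h4.trans ?_) (by positivity)
          gcongr
      _ = _ := by
          have := Real.pi_pos
          field_simp
          ring
  have h7 : besselNorm 1 f ≤ 2 * (besselNorm 0 f + (2 * Real.pi * κ)⁻¹ *
      (besselNorm 0 (hG.cut (A u)) + besselNorm 0 (h2.cut u))) := by linarith
  have n1 := norm_nonneg (toL2 μ (A u))
  have n2 := norm_nonneg (toL2 μ u)
  have h8 : besselNorm 0 f ≤ C * (‖toL2 μ (A u)‖ + ‖toL2 μ u‖) :=
    (hCle u).trans (mul_le_mul_of_nonneg_left (by linarith) hC)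
  have h9 : besselNorm 0 (hG.cut (A u)) + besselNorm 0 (h2.cut u) ≤
      (C + D) * (‖toL2 μ (A u)‖ + ‖toL2 μ u‖) := by
    have := hCle (A u)
    have := hDle u
    nlinarith
  calc besselNorm 1 f ≤ 2 * (C * (‖toL2 μ (A u)‖ + ‖toL2 μ u‖) + (2 * Real.pi * κ)⁻¹ *
        ((C + D) * (‖toL2 μ (A u)‖ + ‖toL2 μ u‖))) := h7.trans (by gcongr)
    _ = _ := by ring

/-- The interior elliptic estimate. -/
theorem IsFirstOrderElliptic.exists_besselNorm_one_cut_le (hA : IsFirstOrderElliptic n F E A)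
    {G : EuclideanSpace ℝ (Fin n) → F →L[ℂ] F} (hG : IsLocalCoefficient E p G) :
    ∃ C : ℝ, 0 ≤ C ∧ ∀ u, besselNorm 1 (hG.cut u) ≤ C * (‖toL2 μ (A u)‖ + ‖toL2 μ u‖) := by
  obtain ⟨a, b, hab, hell⟩ := hA p
  have hU : ∀ y₀ : EuclideanSpace ℝ (Fin n), ∃ U : Set (EuclideanSpace ℝ (Fin n)),
      y₀ ∈ tsupport G → U ∈ 𝓝 y₀ ∧ ∀ (χ : EuclideanSpace ℝ (Fin n) → ℝ)
        (hχ : IsLocalCoefficient E p fun y => χ y • (1 : F →L[ℂ] F)),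
        tsupport (fun y => χ y • (1 : F →L[ℂ] F)) ⊆ U →
        ∃ C : ℝ, 0 ≤ C ∧ ∀ u, besselNorm 1 (hχ.cut u) ≤ C * (‖toL2 μ (A u)‖ + ‖toL2 μ u‖) := by
    intro y₀
    by_cases hy₀ : y₀ ∈ tsupport G
    · obtain ⟨U, hU, hU'⟩ := hab.exists_nhds_besselNorm_one_cut_le μ (hG.tsupport_subset hy₀)
        (hell y₀ (hG.tsupport_subset hy₀))
      exact ⟨U, fun _ => ⟨hU, hU'⟩⟩
    · exact ⟨∅, fun h => absurd h hy₀⟩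
  choose U hU hUC using fun y₀ => hU y₀
  have hB : ∀ y₀ : EuclideanSpace ℝ (Fin n), ∃ B : Set (EuclideanSpace ℝ (Fin n)),
      y₀ ∈ tsupport G → B ∈ 𝓝 y₀ ∧ IsCompact B ∧ B ⊆ localDomain n F E p := by
    intro y₀
    by_cases hy₀ : y₀ ∈ tsupport G
    · obtain ⟨r, hr, hr'⟩ := Metric.nhds_basis_closedBall.mem_iff.1
        ((isOpen_localDomain n F E p).mem_nhds (hG.tsupport_subset hy₀))
      exact ⟨_, fun _ => ⟨Metric.closedBall_mem_nhds _ hr, isCompact_closedBall _ _, hr'⟩⟩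
    · exact ⟨∅, fun h => absurd h hy₀⟩
  choose B hB using hB
  obtain ⟨t, χ, htK, hχ, hχs, hχ1⟩ := exists_finite_smooth_partition hG.hasCompactSupport
    (U := fun y => U y ∩ B y) fun y hy => inter_mem (hU y hy) (hB y hy).1
  have hloc : ∀ y ∈ t, IsLocalCoefficient E p fun z => χ y z • (1 : F →L[ℂ] F) := fun y hy =>
    .of_scalar (hB y (htK y hy)).2.1 (hB y (htK y hy)).2.2 (hχ y hy).contDiffOn
      (fun z hz => image_eq_zero_of_notMem_tsupport fun h => hz (hχs y hy h).2) contDiffOn_const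
  have hest : ∀ y : t, ∃ C : ℝ, 0 ≤ C ∧ ∀ u, besselNorm 1 ((hloc y y.2).cut u) ≤
      C * (‖toL2 μ (A u)‖ + ‖toL2 μ u‖) := fun y =>
    hUC y (htK y y.2) (χ y) (hloc y y.2) fun z hz => (hχs y y.2
      (closure_mono (s := Function.support fun z => χ y z • (1 : F →L[ℂ] F))
        (t := Function.support (χ y))
        (fun w hw h0 => Function.mem_support.1 hw (by simp [h0])) hz)).1
  choose C hC hCle using hest
  obtain ⟨D, hD, hDle⟩ := exists_besselNorm_one_mul_le hG.contDiff hG.hasCompactSupport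
  have hloc' : ∀ y : t, IsLocalCoefficient E p fun z => G z * (χ y z • (1 : F →L[ℂ] F)) :=
    fun y => (hloc y y.2).mul_left hG.contDiff.contDiffOn
  refine ⟨∑ y : t, D * C y, Finset.sum_nonneg fun y _ => mul_nonneg hD (hC y), fun u => ?_⟩
  have key : hG.cut u = ∑ y : t, (hloc' y).cut u := by
    ext z
    rw [_root_.sum_apply]
    simp only [IsLocalCoefficient.cut_apply]
    by_cases hz : z ∈ tsupport G
    · have h1 : ∑ y : t, χ y z = 1 := by
        rw [← hχ1 z hz, ← Finset.sum_coe_sort t]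
      rw [← _root_.sum_apply, ← Finset.mul_sum, ← Finset.sum_smul, h1, one_smul, mul_one]
    · simp [image_eq_zero_of_notMem_tsupport hz]
  rw [key, Finset.sum_mul]
  refine (besselNorm_sum_le _ _ _).trans (Finset.sum_le_sum fun y _ => ?_)
  refine (hDle ((hloc y y.2).cut u) _ fun z => ?_).trans ?_
  · rfl
  · rw [mul_assoc]
    exact mul_le_mul_of_nonneg_left (hCle y u) hD

end Elliptic

/-! ### Riesz representation and the localized inner product -/

section Riesz

variable {H : Type*} [NormedAddCommGroup H] [InnerProductSpace ℂ H] [CompleteSpace H]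
  {V : Type*} [AddCommGroup V] [Module ℂ V] {e : V →ₗ[ℂ] H}

theorem eq_of_forall_inner_eq (hd : DenseRange e) {x y : H}
    (h : ∀ v, inner ℂ x (e v) = inner ℂ y (e v)) : x = y := by
  refine ext_inner_right ℂ fun z => ?_
  have hc : (fun z => inner ℂ x z) = fun z => inner ℂ y z :=
    hd.equalizer (by fun_prop) (by fun_prop) (funext h)
  exact congrFun hc z

theorem norm_le_of_forall_norm_inner_le (hd : DenseRange e) {x : H} {C : ℝ} (hC : 0 ≤ C)
    (h : ∀ v, ‖inner ℂ x (e v)‖ ≤ C * ‖e v‖) : ‖x‖ ≤ C := by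
  have h1 : ∀ z, ‖inner ℂ x z‖ ≤ C * ‖z‖ := fun z =>
    hd.induction_on (p := fun z => ‖inner ℂ x z‖ ≤ C * ‖z‖) z
      (isClosed_le (by fun_prop) (by fun_prop)) h
  rcases (norm_nonneg x).eq_or_lt with h0 | h0
  · exact h0 ▸ hC
  · have h2 := h1 x
    rw [inner_self_eq_norm_sq_to_K] at h2
    have h3 : ‖((‖x‖ : ℂ)) ^ 2‖ = ‖x‖ * ‖x‖ := by simp [sq]
    exact le_of_mul_le_mul_right (h3 ▸ h2) h0

/-- The Riesz representation of a functional given on a dense subspace. -/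
theorem exists_inner_eq (hd : DenseRange e) (l : V →ₗ[ℂ] ℂ) {C : ℝ} (hC : 0 ≤ C)
    (h : ∀ v, ‖l v‖ ≤ C * ‖e v‖) : ∃ x : H, (∀ v, inner ℂ x (e v) = l v) ∧ ‖x‖ ≤ C := by
  refine ⟨(InnerProductSpace.toDual ℂ H).symm (LinearMap.extendOfNorm l e), fun v => ?_, ?_⟩
  · rw [InnerProductSpace.toDual_symm_apply, LinearMap.extendOfNorm_eq hd ⟨C, h⟩]
  · rw [LinearIsometryEquiv.norm_map]
    exact LinearMap.opNorm_extendOfNorm_le hd hC h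

end Riesz

section BesselBounds

variable {n : ℕ} {F : Type*} [NormedAddCommGroup F] [InnerProductSpace ℂ F] [FiniteDimensional ℂ F]
  {ι : Type*} [Fintype ι]

theorem ofReal_sq_le_besselSq {s x : ℝ} (hx : 0 ≤ x) {C : ι → ℝ}
    {f : ι → 𝓢(EuclideanSpace ℝ (Fin n), F)} (h : x ≤ ∑ i, C i * besselNorm s (f i)) :
    ENNReal.ofReal (x ^ 2) ≤ ENNReal.ofReal (∑ i, C i ^ 2) * besselSq s f := by
  rw [besselSq, ← ENNReal.ofReal_sum_of_nonneg fun _ _ => sq_nonneg _,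
    ← ENNReal.ofReal_mul (Finset.sum_nonneg fun _ _ => sq_nonneg _)]
  exact ENNReal.ofReal_le_ofReal ((pow_le_pow_left₀ hx h 2).trans
    (Finset.sum_mul_sq_le_sq_mul_sq _ _ _))

theorem besselSq_le_ofReal_sq {s x : ℝ} {C : ι → ℝ} {f : ι → 𝓢(EuclideanSpace ℝ (Fin n), F)}
    (h : ∀ i, besselNorm s (f i) ≤ C i * x) :
    besselSq s f ≤ ENNReal.ofReal (∑ i, C i ^ 2) * ENNReal.ofReal (x ^ 2) := by
  rw [besselSq, ← ENNReal.ofReal_sum_of_nonneg fun _ _ => sq_nonneg _,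
    ← ENNReal.ofReal_mul (Finset.sum_nonneg fun _ _ => sq_nonneg _), Finset.sum_mul]
  refine ENNReal.ofReal_le_ofReal (Finset.sum_le_sum fun i _ => ?_)
  rw [← mul_pow]
  exact pow_le_pow_left₀ (besselNorm_nonneg _ _) (h i) 2

end BesselBounds

section Cover

variable {n : ℕ} {N : Type*} [TopologicalSpace N] [ChartedSpace (EuclideanSpace ℝ (Fin n)) N]
  {F : Type*} [NormedAddCommGroup F] [InnerProductSpace ℂ F] [FiniteDimensional ℂ F]
  {E : N → Type*} [TopologicalSpace (TotalSpace F E)] [∀ x, NormedAddCommGroup (E x)]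
  [∀ x, InnerProductSpace ℂ (E x)] [FiberBundle F E] [IsManifold (𝓡 n) ∞ N] [VectorBundle ℂ F E]
  [ContMDiffVectorBundle ∞ F E (𝓡 n)] [CompactSpace N] [T2Space N]

namespace LocalizingCover

variable (K : LocalizingCover n F E)

/-- The `i`-th cutoff function in coordinates, extended by zero. -/
def coordCutoff (i : Fin K.card) : EuclideanSpace ℝ (Fin n) → ℝ :=
  (localDomain n F E (K.center i)).indicator fun y =>
    K.cutoff i ((chartAt (EuclideanSpace ℝ (Fin n)) (K.center i)).symm y)

theorem coordCutoff_of_mem (i : Fin K.card) {y : EuclideanSpace ℝ (Fin n)}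
    (hy : y ∈ localDomain n F E (K.center i)) : K.coordCutoff i y =
      K.cutoff i ((chartAt (EuclideanSpace ℝ (Fin n)) (K.center i)).symm y) :=
  indicator_of_mem hy _

theorem coordCutoff_eq_zero (i : Fin K.card) {y : EuclideanSpace ℝ (Fin n)}
    (hy : y ∉ K.pieceSupport i) : K.coordCutoff i y = 0 := by
  by_cases h : y ∈ localDomain n F E (K.center i)
  · rw [K.coordCutoff_of_mem i h, image_eq_zero_of_notMem_tsupport (f := K.cutoff i)
      (fun hx => hy ⟨_, hx, (chartAt _ _).right_inv h.1⟩)]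
  · exact indicator_of_notMem h _

theorem contDiffOn_coordCutoff (i : Fin K.card) :
    ContDiffOn ℝ ∞ (K.coordCutoff i) (localDomain n F E (K.center i)) := by
  have h : ContDiffOn ℝ ∞
      (fun y => K.cutoff i ((chartAt (EuclideanSpace ℝ (Fin n)) (K.center i)).symm y))
      (localDomain n F E (K.center i)) := by
    rw [← contMDiffOn_iff_contDiffOn]
    have h2 : ContMDiffOn (𝓡 n) (𝓡 n) ∞ (chartAt (EuclideanSpace ℝ (Fin n)) (K.center i)).symm
      (chartAt (EuclideanSpace ℝ (Fin n)) (K.center i)).target := contMDiffOn_chart_symm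
    exact (K.cutoff i).contMDiff.comp_contMDiffOn (h2.mono inter_subset_left)
  exact h.congr fun y hy => K.coordCutoff_of_mem i hy

theorem continuous_coordCutoff (i : Fin K.card) : Continuous (K.coordCutoff i) :=
  (contDiff_of_contDiffOn_of_tsupport (isOpen_localDomain n F E (K.center i))
    (K.contDiffOn_coordCutoff i) ((closure_minimal (fun y hy => by
      by_contra h
      exact hy (K.coordCutoff_eq_zero i h)) (K.isCompact_pieceSupport i).isClosed).trans
        (K.pieceSupport_subset i))).continuous

theorem coordCutoff_chart (i : Fin K.card) {x : N}
    (hx : x ∈ (chartAt (EuclideanSpace ℝ (Fin n)) (K.center i)).source) :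
    K.coordCutoff i (chartAt (EuclideanSpace ℝ (Fin n)) (K.center i) x) = K.cutoff i x := by
  by_cases h : x ∈ (trivializationAt F E (K.center i)).baseSet
  · have h1 : chartAt (EuclideanSpace ℝ (Fin n)) (K.center i) x ∈
        localDomain n F E (K.center i) := by
      refine ⟨(chartAt _ _).map_source hx, ?_⟩
      rw [mem_preimage, (chartAt _ _).left_inv hx]
      exact h
    rw [K.coordCutoff_of_mem i h1, (chartAt _ _).left_inv hx]
  · rw [image_eq_zero_of_notMem_tsupport (f := K.cutoff i) fun h' => h (K.subordinate i h').2,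
      coordCutoff, indicator_of_notMem]
    intro h'
    have := h'.2
    rw [mem_preimage, (chartAt _ _).left_inv hx] at this
    exact h this

theorem isLocalCoefficient_coordCutoff (i : Fin K.card) :
    IsLocalCoefficient E (K.center i) fun y => K.coordCutoff i y • (1 : F →L[ℂ] F) :=
  .of_scalar (K.isCompact_pieceSupport i) (K.pieceSupport_subset i) (K.contDiffOn_coordCutoff i)
    (fun _ hy => K.coordCutoff_eq_zero i hy) contDiffOn_const

theorem localize_eq_cut (i : Fin K.card) (u : SmoothSections n F E) :
    K.localize i u = (K.isLocalCoefficient_coordCutoff i).cut u := by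
  ext y
  change K.piece i u y = K.coordCutoff i y • localRep n F E (K.center i) u y
  by_cases hy : y ∈ localDomain n F E (K.center i)
  · rw [K.coordCutoff_of_mem i hy, piece, indicator_of_mem hy]
  · rw [piece, coordCutoff, indicator_of_notMem hy, indicator_of_notMem hy, zero_smul]

/-- The family of all localized pieces of a section. -/
def localizeAll : SmoothSections n F E →ₗ[ℂ] Fin K.card → 𝓢(EuclideanSpace ℝ (Fin n), F) :=
  LinearMap.pi K.localize

theorem besselSq_localizeAll (s : ℝ) (u : SmoothSections n F E) :
    besselSq s (K.localizeAll u) = ENNReal.ofReal (K.sobolevNorm s u ^ 2) := by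
  rw [sobolevNorm, PiLp.norm_sq_eq_of_L2, ENNReal.ofReal_sum_of_nonneg fun _ _ => sq_nonneg _]
  rfl

variable [IsSmoothHermitian n F E] [MeasurableSpace N] [BorelSpace N] (μ : Measure N)
  [IsSmoothDensity n μ]

/-- The coefficients `ψᵢ ρᵢ gᵢ` with cutoff functions `ψᵢ` which are `1` on the supports of the
cutoff functions `χᵢ` express the `L²` inner product through the localized pieces. -/
theorem exists_coefficients_inner_eq :
    ∃ (M : Fin K.card → EuclideanSpace ℝ (Fin n) → F →L[ℂ] F)
      (hM : ∀ i, IsLocalCoefficient E (K.center i) (M i)), ∀ u v,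
      inner ℂ (toL2 μ u) (toL2 μ v) = ∑ i, ∫ y, inner ℂ (K.localize i u y) ((hM i).cut v y) := by
  choose ψ hψ hψc hψs _ hψ1 using fun i => exists_smooth_cutoff (K.isCompact_pieceSupport i)
    (isOpen_localDomain n F E (K.center i)) (K.pieceSupport_subset i)
  refine ⟨_, fun i => isLocalCoefficient_gram E μ (hψc i) (hψs i) (hψ i).contDiffOn
    fun y hy => image_eq_zero_of_notMem_tsupport hy, fun u v => ?_⟩
  have h1 : ∀ i, ∫ x, (K.cutoff i x : ℂ) * inner ℂ (u x) (v x) ∂μ = ∫ y,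
      inner ℂ (K.localize i u y) ((isLocalCoefficient_gram E μ (hψc i) (hψs i) (hψ i).contDiffOn
        fun y hy => image_eq_zero_of_notMem_tsupport hy).cut v y) := by
    intro i
    have h2 := setIntegral_mul_inner (n := n) (E := E) μ (K.pieceSupport_subset i)
      (K.continuous_coordCutoff i).continuousOn (fun _ hy => K.coordCutoff_eq_zero i hy) u v
    rw [← setIntegral_eq_integral_of_forall_compl_eq_zero
      (s := (chartAt (EuclideanSpace ℝ (Fin n)) (K.center i)).source)]
    · refine Eq.trans ?_ (h2.trans ?_)
      · refine setIntegral_congr_fun (chartAt _ _).open_source.measurableSet fun x hx => ?_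
        simp only [K.coordCutoff_chart i hx]
      · refine integral_congr_ae (.of_forall fun y => ?_)
        simp only [localize_eq_cut, IsLocalCoefficient.cut_apply]
        by_cases hy : y ∈ K.pieceSupport i
        · simp only [hψ1 i y hy, one_smul, _root_.smul_apply, one_apply_eq_self,
            inner_smul_right_eq_smul, inner_smul_left_eq_smul]
          exact smul_comm _ _ _
        · simp [K.coordCutoff_eq_zero i hy]
    · intro x hx
      rw [image_eq_zero_of_notMem_tsupport (f := K.cutoff i) fun h => hx (K.subordinate i h).1]
      simp
  simp only [← h1]
  rw [← integral_finsetSum, inner_toL2]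
  · refine integral_congr_ae (.of_forall fun x => ?_)
    simp only [← Finset.sum_mul]
    have h3 := K.cutoff.sum_eq_one (mem_univ x)
    rw [finsum_eq_sum_of_fintype] at h3
    rw [← Complex.ofReal_sum, h3, Complex.ofReal_one, one_mul]
  · intro i _
    have hfin := IsSmoothDensity.isFiniteMeasure (n := n) μ
    rw [← integrableOn_univ]
    exact ((Complex.continuous_ofReal.comp (K.cutoff i).contMDiff.continuous).mul
      (continuous_inner_sections u v)).continuousOn.integrableOn_compact isCompact_univ

end LocalizingCover

end Cover

/-! ### Sobolev norms and the scale of an elliptic operator -/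

section Comparison

variable {n : ℕ} {N : Type*} [TopologicalSpace N] [ChartedSpace (EuclideanSpace ℝ (Fin n)) N]
  {F : Type*} [NormedAddCommGroup F] [InnerProductSpace ℂ F] [FiniteDimensional ℂ F]
  {E : N → Type*} [TopologicalSpace (TotalSpace F E)] [∀ x, NormedAddCommGroup (E x)]
  [∀ x, InnerProductSpace ℂ (E x)] [FiberBundle F E] [IsManifold (𝓡 n) ∞ N] [VectorBundle ℂ F E]
  [ContMDiffVectorBundle ∞ F E (𝓡 n)] [CompactSpace N] [T2Space N] [IsSmoothHermitian n F E]
  [MeasurableSpace N] [BorelSpace N] (μ : Measure N) [IsSmoothDensity n μ]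

theorem denseRange_toL2 : DenseRange (toL2 (n := n) (F := F) (E := E) μ) :=
  UniformSpace.Completion.denseRange_coe (α := L2Pre n F E μ)

namespace LocalizingCover

variable (K : LocalizingCover n F E) {M : Fin K.card → EuclideanSpace ℝ (Fin n) → F →L[ℂ] F}
  (hM : ∀ i, IsLocalCoefficient E (K.center i) (M i))

/-- The functional `v ↦ ∑ᵢ ⟨fᵢ, Mᵢ v⟩` on smooth sections, for a tuple `f` of Schwartz functions. -/
def coordPairing (f : Fin K.card → 𝓢(EuclideanSpace ℝ (Fin n), F)) :
    SmoothSections n F E →ₗ[ℂ] ℂ :=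
  ∑ i, (innerSL ℂ (SchwartzMap.toLpCLM ℂ F 2 volume (f i))).toLinearMap ∘ₗ
    (SchwartzMap.toLpCLM ℂ F 2 (volume : Measure (EuclideanSpace ℝ (Fin n)))).toLinearMap ∘ₗ
      (hM i).cut

theorem coordPairing_apply (f : Fin K.card → 𝓢(EuclideanSpace ℝ (Fin n), F))
    (v : SmoothSections n F E) :
    K.coordPairing hM f v = ∑ i, ∫ y, inner ℂ (f i y) ((hM i).cut v y) := by
  simp only [coordPairing, LinearMap.sum_apply]
  exact Finset.sum_congr rfl fun i _ => SchwartzMap.inner_toL2_toL2_eq (f i) ((hM i).cut v) volume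

theorem coordPairing_add (f g : Fin K.card → 𝓢(EuclideanSpace ℝ (Fin n), F)) :
    K.coordPairing hM (f + g) = K.coordPairing hM f + K.coordPairing hM g := by
  simp only [coordPairing, Pi.add_apply, map_add, ← Finset.sum_add_distrib]
  rfl

theorem norm_coordPairing_le {s x : ℝ} {D : Fin K.card → ℝ}
    (f : Fin K.card → 𝓢(EuclideanSpace ℝ (Fin n), F)) {v : SmoothSections n F E}
    (h : ∀ i, besselNorm s ((hM i).cut v) ≤ D i * x) :
    ‖K.coordPairing hM f v‖ ≤ (∑ i, D i * besselNorm (-s) (f i)) * x := by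
  rw [coordPairing_apply, Finset.sum_mul]
  refine (norm_sum_le _ _).trans (Finset.sum_le_sum fun i _ => ?_)
  refine (norm_integral_inner_le s (f i) ((hM i).cut v)).trans ?_
  calc _ ≤ besselNorm (-s) (f i) * (D i * x) :=
        mul_le_mul_of_nonneg_left (h i) (besselNorm_nonneg _ _)
    _ = _ := by ring

/-- The map from tuples of Schwartz functions to `L²` which is adjoint to the cut-off maps. -/
theorem exists_synthesis : ∃ S : (Fin K.card → 𝓢(EuclideanSpace ℝ (Fin n), F)) →+ L2 n F E μ,
    ∀ f v, inner ℂ (S f) (toL2 μ v) = K.coordPairing hM f v := by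
  choose D hD hDle using fun i => (hM i).exists_besselNorm_zero_cut_le μ
  have h : ∀ f, ∃ x : L2 n F E μ, ∀ v, inner ℂ x (toL2 μ v) = K.coordPairing hM f v := fun f =>
    (exists_inner_eq (denseRange_toL2 μ) (K.coordPairing hM f) (Finset.sum_nonneg fun i _ =>
      mul_nonneg (hD i) (besselNorm_nonneg (-0) (f i))) fun v =>
        K.norm_coordPairing_le hM f fun i => hDle i v).imp fun _ h => h.1
  choose S hS using h
  refine ⟨AddMonoidHom.mk' S fun f g => eq_of_forall_inner_eq (denseRange_toL2 μ) fun v => ?_, hS⟩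
  rw [inner_add_left, hS, hS, hS, coordPairing_add, LinearMap.add_apply]

end LocalizingCover

variable {μ} {A : SmoothSections n F E →ₗ[ℂ] SmoothSections n F E}
  {R : L2 n F E μ →L[ℂ] L2 n F E μ}

/-- The elliptic estimate for an operator with a bounded inverse. -/
theorem IsFirstOrderElliptic.exists_besselNorm_one_cut_le_of_inverse
    (hA : IsFirstOrderElliptic n F E A) (hRA : ∀ v, R (toL2 μ (A v)) = toL2 μ v) {p : N}
    {G : EuclideanSpace ℝ (Fin n) → F →L[ℂ] F} (hG : IsLocalCoefficient E p G) :
    ∃ C : ℝ, 0 ≤ C ∧ ∀ u, besselNorm 1 (hG.cut u) ≤ C * ‖toL2 μ (A u)‖ := by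
  obtain ⟨C, hC, hCle⟩ := hA.exists_besselNorm_one_cut_le μ hG
  refine ⟨C * (1 + ‖R‖), by positivity, fun u => (hCle u).trans ?_⟩
  rw [mul_assoc]
  refine mul_le_mul_of_nonneg_left ?_ hC
  have := R.le_opNorm (toL2 μ (A u))
  rw [hRA] at this
  linarith

/-- The `L²` estimate of order `-1` for the inverse of an elliptic operator. -/
theorem IsFirstOrderElliptic.exists_besselNorm_neg_one_cut_le_of_inverse
    (hA : IsFirstOrderElliptic n F E A) (hRA : ∀ v, R (toL2 μ (A v)) = toL2 μ v)
    (hd : DenseRange fun v => toL2 μ (A v)) {p : N}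
    {G : EuclideanSpace ℝ (Fin n) → F →L[ℂ] F} (hG : IsLocalCoefficient E p G) :
    ∃ C : ℝ, 0 ≤ C ∧ ∀ u, besselNorm (-1) (hG.cut u) ≤ C * ‖R (toL2 μ u)‖ := by
  obtain ⟨a, b, hab, -⟩ := hA p
  obtain ⟨C, hC, hCle⟩ := hab.exists_besselNorm_neg_one_cut_le μ hG
  obtain ⟨D, hD, hDle⟩ := hG.exists_besselNorm_zero_cut_le μ
  refine ⟨C, hC, fun u => ?_⟩
  obtain ⟨z, hz, hzl⟩ := mem_closure_iff_seq_limit.1 (hd (toL2 μ u))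
  choose v hv using hz
  have h1 : Tendsto (fun k => D * ‖toL2 μ u - z k‖ + C * ‖R (z k)‖) atTop
      (𝓝 (D * ‖toL2 μ u - toL2 μ u‖ + C * ‖R (toL2 μ u)‖)) :=
    ((tendsto_const_nhds.sub hzl).norm.const_mul D).add
      (((R.continuous.tendsto _).comp hzl).norm.const_mul C)
  rw [sub_self, norm_zero, mul_zero, zero_add] at h1
  refine ge_of_tendsto' h1 fun k => ?_
  have h2 : hG.cut u = hG.cut (u - A (v k)) + hG.cut (A (v k)) := by
    rw [← map_add, sub_add_cancel]
  rw [h2]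
  refine (besselNorm_add_le _ _ _).trans (add_le_add ?_ ?_)
  · rw [← hv, ← map_sub]
    exact (besselNorm_mono (by norm_num) _).trans (hDle _)
  · rw [← hv]
    simp only [hRA]
    exact hCle _

/-- The Sobolev norms of orders between `-1` and `1` are equivalent to the norms in the scale of an
elliptic self-adjoint operator with a bounded inverse. -/
theorem LocalizingCover.exists_scaleSq_equiv (K : LocalizingCover n F E)
    (hA : IsFirstOrderElliptic n F E A) (hR : IsSelfAdjoint R) (hinj : Function.Injective R)
    (hRA : ∀ v, R (toL2 μ (A v)) = toL2 μ v) (hd : DenseRange fun v => toL2 μ (A v)) :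
    ∃ C : ℝ, 0 ≤ C ∧ ∀ s : ℝ, |s| < 1 → ∀ u,
      scaleSq hR s (toL2 μ u) ≤ ENNReal.ofReal (C * K.sobolevNorm s u ^ 2) ∧
      ENNReal.ofReal (K.sobolevNorm s u ^ 2) ≤ ENNReal.ofReal C * scaleSq hR s (toL2 μ u) := by
  have hdι := denseRange_toL2 (n := n) (F := F) (E := E) μ
  have hdA : DenseRange (toL2 μ ∘ₗ A) := hd
  have hRs : ∀ x y, inner ℂ (R x) y = inner ℂ x (R y) :=
    ContinuousLinearMap.isSelfAdjoint_iff_isSymmetric.1 hR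
  obtain ⟨M, hM, hMeq⟩ := K.exists_coefficients_inner_eq μ
  obtain ⟨S, hS⟩ := K.exists_synthesis μ hM
  have hSJ : ∀ u, S (K.localizeAll u) = toL2 μ u := fun u => eq_of_forall_inner_eq hdι fun v => by
    rw [hS, K.coordPairing_apply, hMeq]
    rfl
  choose C₁ hC₁ hC₁le using fun i => hA.exists_besselNorm_one_cut_le_of_inverse hRA (hM i)
  choose a b hab _ using id hA
  choose C₂ hC₂ hC₂le using fun i =>
    (hab (K.center i)).exists_besselNorm_neg_one_cut_le μ (hM i)
  choose C₃ hC₃ hC₃le using fun i => hA.exists_besselNorm_neg_one_cut_le_of_inverse hRA hd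
    (K.isLocalCoefficient_coordCutoff i)
  choose C₄ hC₄ hC₄le using fun i => hA.exists_besselNorm_one_cut_le_of_inverse hRA
    (K.isLocalCoefficient_coordCutoff i)
  have H1 : ∀ f, ENNReal.ofReal (‖R (S f)‖ ^ 2) ≤
      ENNReal.ofReal (∑ i, C₁ i ^ 2) * besselSq (-1) f := fun f => by
    refine ofReal_sq_le_besselSq (norm_nonneg _) ?_
    refine norm_le_of_forall_norm_inner_le hdA (Finset.sum_nonneg fun i _ =>
      mul_nonneg (hC₁ i) (besselNorm_nonneg _ _)) fun v => ?_
    rw [hRs, LinearMap.comp_apply, hRA, hS]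
    exact K.norm_coordPairing_le hM f fun i => hC₁le i v
  have H2 : ∀ f, ∃ y, R y = S f ∧ ENNReal.ofReal (‖y‖ ^ 2) ≤
      ENNReal.ofReal (∑ i, C₂ i ^ 2) * besselSq 1 f := fun f => by
    obtain ⟨y, hy, hyle⟩ := exists_inner_eq hdι (K.coordPairing hM f ∘ₗ A)
      (C := ∑ i, C₂ i * besselNorm (- -1) (f i))
      (Finset.sum_nonneg fun i _ => mul_nonneg (hC₂ i) (besselNorm_nonneg _ _)) fun v =>
        K.norm_coordPairing_le hM f fun i => hC₂le i v
    refine ⟨y, eq_of_forall_inner_eq hdA fun v => ?_, ofReal_sq_le_besselSq (norm_nonneg _) ?_⟩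
    · rw [hRs, LinearMap.comp_apply, hRA, hy, hS]
      rfl
    · rwa [neg_neg] at hyle
  have H3 : ∀ v, besselSq (-1) (K.localizeAll v) ≤
      ENNReal.ofReal (∑ i, C₃ i ^ 2) * ENNReal.ofReal (‖R (toL2 μ v)‖ ^ 2) := fun v =>
    besselSq_le_ofReal_sq fun i =>
      (congrArg (besselNorm _) (K.localize_eq_cut i v)).trans_le (hC₃le i v)
  have H4 : ∀ v, besselSq 1 (K.localizeAll v) ≤
      ENNReal.ofReal (∑ i, C₄ i ^ 2) * ENNReal.ofReal (‖toL2 μ (A v)‖ ^ 2) := fun v =>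
    besselSq_le_ofReal_sq fun i =>
      (congrArg (besselNorm _) (K.localize_eq_cut i v)).trans_le (hC₄le i v)
  set D : ℝ := ∑ i, C₁ i ^ 2 + ∑ i, C₂ i ^ 2 + ∑ i, C₃ i ^ 2 + ∑ i, C₄ i ^ 2 with hD
  have hp : ∀ c : Fin K.card → ℝ, 0 ≤ ∑ i, c i ^ 2 := fun c =>
    Finset.sum_nonneg fun _ _ => sq_nonneg _
  have p1 := hp C₁
  have p2 := hp C₂
  have p3 := hp C₃
  have p4 := hp C₄
  have hD0 : 0 ≤ D := by positivity
  have hDle : ∀ {x}, x ≤ D → ∀ z : ℝ≥0∞, ENNReal.ofReal x * z ≤ ENNReal.ofReal D * z :=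
    fun h z => mul_le_mul_left (ENNReal.ofReal_le_ofReal h) z
  refine ⟨10 * D, by positivity, fun s hs u => ⟨?_, ?_⟩⟩
  · have h := scaleSq_le_besselSq hR hinj S (C := ENNReal.ofReal D) ENNReal.ofReal_ne_top
      (fun f => (H1 f).trans (hDle (by linarith) _))
      (fun f => (H2 f).imp fun y hy => ⟨hy.1, hy.2.trans (hDle (by linarith) _)⟩) hs
      (K.localizeAll u)
    rw [hSJ, K.besselSq_localizeAll, ofNat_mul_ofReal, ← ENNReal.ofReal_mul (by positivity)] at h
    exact h
  · have h := besselSq_le_scaleSq hR hinj (toL2 μ) A hRA hd K.localizeAll.toAddMonoidHom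
      (C := ENNReal.ofReal D) ENNReal.ofReal_ne_top
      (fun v => (H3 v).trans (hDle (by linarith) _))
      (fun v => (H4 v).trans (hDle (by linarith) _)) hs u
    refine ((K.besselSq_localizeAll s u).symm.le.trans h).trans ?_
    rw [ofNat_mul_ofReal]
    exact mul_le_mul_left (ENNReal.ofReal_le_ofReal (by linarith)) _

/-- The elliptic estimate for the global Sobolev norm. -/
theorem LocalizingCover.exists_sobolevNorm_one_le (K : LocalizingCover n F E)
    (hA : IsFirstOrderElliptic n F E A) (hRA : ∀ v, R (toL2 μ (A v)) = toL2 μ v) :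
    ∃ C : ℝ, 0 ≤ C ∧ ∀ u, K.sobolevNorm 1 u ≤ C * ‖toL2 μ (A u)‖ := by
  choose C hC hCle using fun i => hA.exists_besselNorm_one_cut_le_of_inverse hRA
    (K.isLocalCoefficient_coordCutoff i)
  refine ⟨√(∑ i, C i ^ 2), Real.sqrt_nonneg _, fun u => ?_⟩
  have hp : 0 ≤ ∑ i, C i ^ 2 := Finset.sum_nonneg fun _ _ => sq_nonneg _
  have h := besselSq_le_ofReal_sq (f := K.localizeAll u)
    fun i => (congrArg (besselNorm _) (K.localize_eq_cut i u)).trans_le (hCle i u)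
  rw [K.besselSq_localizeAll, ← ENNReal.ofReal_mul hp,
    ENNReal.ofReal_le_ofReal_iff (by positivity)] at h
  refine abs_le_of_sq_le_sq' ?_ (by positivity) |>.2
  rwa [mul_pow, Real.sq_sqrt hp]

end Comparison

/-! ### Closures of symmetric operators and induced operators -/

section Closure

variable {H : Type*} [NormedAddCommGroup H] [InnerProductSpace ℂ H] [CompleteSpace H]
  {V : Type*} [AddCommGroup V] [Module ℂ V] {e : V →ₗ[ℂ] H} {B : V →ₗ[ℂ] V}

/-- Pairs in the closure of the graph of a symmetric operator satisfy the symmetry relation. -/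
theorem inner_eq_of_mem_closure_graph
    (hB : ∀ u v, inner ℂ (e (B u)) (e v) = inner ℂ (e u) (e (B v))) {x y : H × H}
    (hx : x ∈ (LinearMap.range (e.prod (e ∘ₗ B))).topologicalClosure)
    (hy : y ∈ (LinearMap.range (e.prod (e ∘ₗ B))).topologicalClosure) :
    inner ℂ x.2 y.1 = inner ℂ x.1 y.2 := by
  have hx' : x ∈ closure (range (e.prod (e ∘ₗ B))) := hx
  have hy' : y ∈ closure (range (e.prod (e ∘ₗ B))) := hy
  have h1 : ∀ v, inner ℂ x.2 (e v) = inner ℂ x.1 (e (B v)) := fun v =>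
    closure_minimal (t := {x : H × H | inner ℂ x.2 (e v) = inner ℂ x.1 (e (B v))})
      (by rintro _ ⟨u, rfl⟩; exact hB u v) (isClosed_eq (by fun_prop) (by fun_prop)) hx'
  exact closure_minimal (t := {y : H × H | inner ℂ x.2 y.1 = inner ℂ x.1 y.2})
    (by rintro _ ⟨v, rfl⟩; exact h1 v) (isClosed_eq (by fun_prop) (by fun_prop)) hy'

theorem graph_toLinearPMap_closure (he : DenseRange e)
    (hB : ∀ u v, inner ℂ (e (B u)) (e v) = inner ℂ (e u) (e (B v))) :
    (LinearMap.range (e.prod (e ∘ₗ B))).topologicalClosure.toLinearPMap.graph =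
      (LinearMap.range (e.prod (e ∘ₗ B))).topologicalClosure := by
  refine Submodule.toLinearPMap_graph_eq _ fun x hx hx1 => ?_
  refine eq_of_forall_inner_eq he fun v => ?_
  have h := inner_eq_of_mem_closure_graph hB hx
    (Submodule.le_topologicalClosure _ (LinearMap.mem_range_self (e.prod (e ∘ₗ B)) v))
  rw [hx1, inner_zero_left] at h
  rw [inner_zero_left]
  exact h

/-- The inverse `R` of `B - c`, for the closure of a symmetric operator `B` and a real number `c`
outside of its spectrum: `(B - c) V` is dense, and `R` determines the spectral projection. -/
theorem exists_inverse_sub_smul (he : DenseRange e)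
    (hB : ∀ u v, inner ℂ (e (B u)) (e v) = inner ℂ (e u) (e (B v))) {c : ℝ}
    (hc : (c : ℂ) ∉ unboundedSpectrum
      (LinearMap.range (e.prod (e ∘ₗ B))).topologicalClosure.toLinearPMap) :
    ∃ (R : H →L[ℂ] H) (hR : IsSelfAdjoint R), Function.Injective R ∧
      (∀ v, R (e ((B - (c : ℂ) • (LinearMap.id : V →ₗ[ℂ] V)) v)) = e v) ∧
      (DenseRange fun v => e ((B - (c : ℂ) • (LinearMap.id : V →ₗ[ℂ] V)) v)) ∧
      IsSpectralProjection (LinearMap.range (e.prod (e ∘ₗ B))).topologicalClosure.toLinearPMap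
        (Ici c) (posProj hR) := by
  set G := (LinearMap.range (e.prod (e ∘ₗ B))).topologicalClosure with hG
  have hgraph : G.toLinearPMap.graph = G := graph_toLinearPMap_closure he hB
  have hmem : ∀ x : G.toLinearPMap.domain, ((x : H), G.toLinearPMap x) ∈ G := fun x =>
    hgraph.le (LinearPMap.mem_graph _ x)
  obtain ⟨R, hR, hinj, hdom, hT⟩ := exists_resolvent
    (fun x y => inner_eq_of_mem_closure_graph hB (hmem x) (hmem y)) hc
  refine ⟨R, hR, hinj, fun v => ?_, fun g => ?_, isSpectralProjection_posProj hR hinj hdom hT⟩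
  · have hv : (e v, e (B v)) ∈ G := Submodule.le_topologicalClosure _ ⟨v, rfl⟩
    rw [← hgraph, LinearPMap.mem_graph_iff] at hv
    obtain ⟨a, ha, ha'⟩ := hv
    obtain ⟨z, hz⟩ := (hdom a).1 a.2
    have h := hT a z hz
    simp only at ha ha'
    rw [ha', hz, ha] at h
    rw [LinearMap.sub_apply, LinearMap.smul_apply, LinearMap.id_apply, map_sub, map_smul, h,
      add_sub_cancel_right, hz, ha]
  · have h := hmem ⟨R g, (hdom _).2 ⟨g, rfl⟩⟩
    rw [hT _ g rfl] at h
    have h' : (R g, g + (c : ℂ) • R g) ∈ closure (range (e.prod (e ∘ₗ B))) := h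
    have hcont : Continuous fun x : H × H => x.2 - (c : ℂ) • x.1 := by fun_prop
    have h2 := map_mem_closure
      (t := range fun v => e ((B - (c : ℂ) • (LinearMap.id : V →ₗ[ℂ] V)) v)) hcont h' (by
      rintro _ ⟨v, rfl⟩
      exact ⟨v, by simp⟩)
    simpa using h2

end Closure

section Extension

variable {H : Type*} [NormedAddCommGroup H] [InnerProductSpace ℂ H] [CompleteSpace H]
  {V : Type*} [AddCommGroup V] [Module ℂ V] {e : V →ₗ[ℂ] H} {A A' : V →ₗ[ℂ] V}
  {R R' : H →L[ℂ] H} (hR : IsSelfAdjoint R) {L : Type*} [NormedAddCommGroup L] [NormedSpace ℂ L]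
  [CompleteSpace L] {τ : V →ₗ[ℂ] L} {C s : ℝ}

/-- The operator `G = |R|^{1 - s}`, whose norm is that of order `s` after the application of `R`. -/
theorem exists_norm_sq_eq_scaleSq_apply (hinj : Function.Injective R) (hs : s < 1) :
    ∃ G : H →L[ℂ] H, ∀ y, ENNReal.ofReal (‖G y‖ ^ 2) = scaleSq hR s (R y) := by
  have hs' : 0 < 1 - s := by linarith
  have hc : Continuous fun t : ℝ => |t| ^ (1 - s) :=
    continuous_abs.rpow_const fun _ => Or.inr hs'.le
  refine ⟨cfc (fun t : ℝ => |t| ^ (1 - s)) R, fun y => ?_⟩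
  rw [lintegral_scalarMeasure_sq hR hc, scaleSq_apply hR hinj, scaleSq]
  refine lintegral_congr fun t => ?_
  congr 1
  rw [Real.inv_rpow (abs_nonneg t), ← Real.rpow_neg (abs_nonneg t), ← Real.rpow_mul_natCast
    (abs_nonneg t)]
  congr 1
  push_cast
  ring

/-- If the norm of order `s` in the scale of `R` is equivalent to the norm of `L`, then the inverse
`R` induces a bounded operator from `H` to `L`. -/
theorem exists_extension (hinj : Function.Injective R) (hRA : ∀ v, R (e (A v)) = e v)
    (hd : DenseRange fun v => e (A v)) (hs : s < 1) (hC : 0 ≤ C)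
    (h : ∀ u, ENNReal.ofReal (‖τ u‖ ^ 2) ≤ ENNReal.ofReal C * scaleSq hR s (e u)) :
    ∃ Θ : H →L[ℂ] L, (∀ v, Θ (e (A v)) = τ v) ∧
      ∀ y, ENNReal.ofReal (‖Θ y‖ ^ 2) ≤ ENNReal.ofReal C * scaleSq hR s (R y) := by
  have hdA : DenseRange (e ∘ₗ A) := hd
  obtain ⟨G, hG⟩ := exists_norm_sq_eq_scaleSq_apply hR hinj hs
  have h1 : ∀ v, ‖τ v‖ ^ 2 ≤ C * ‖G (e (A v))‖ ^ 2 := fun v => by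
    have := h v
    rwa [← hRA v, ← hG, ← ENNReal.ofReal_mul hC, ENNReal.ofReal_le_ofReal_iff (by positivity)]
      at this
  have h2 : ∀ v, ‖τ v‖ ≤ (√C * ‖G‖) * ‖(e ∘ₗ A) v‖ := fun v => by
    have h3 : ‖τ v‖ ≤ √C * ‖G (e (A v))‖ := by
      refine abs_le_of_sq_le_sq' ?_ (by positivity) |>.2
      rw [mul_pow, Real.sq_sqrt hC]
      exact h1 v
    refine h3.trans ?_
    rw [mul_assoc]
    gcongr
    exact G.le_opNorm _
  have h4 : ∀ v, LinearMap.extendOfNorm τ (e ∘ₗ A) (e (A v)) = τ v := fun v =>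
    LinearMap.extendOfNorm_eq hdA ⟨_, h2⟩ v
  refine ⟨LinearMap.extendOfNorm τ (e ∘ₗ A), h4, fun y => ?_⟩
  rw [← hG, ← ENNReal.ofReal_mul hC]
  refine ENNReal.ofReal_le_ofReal ?_
  refine hd.induction_on (p := fun y => ‖LinearMap.extendOfNorm τ (e ∘ₗ A) y‖ ^ 2 ≤ C * ‖G y‖ ^ 2) y
    (isClosed_le (by fun_prop) (by fun_prop)) fun v => ?_
  rw [h4]
  exact h1 v

theorem apply_posProj (y : H) : R (posProj hR y) = posProj hR (R y) :=
  congrArg (fun S : H →L[ℂ] H => S y) (commute_spectralPVM hR (Commute.refl R) _).eq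

theorem scaleSq_posProj_le (x : H) : scaleSq hR s (posProj hR x) ≤ scaleSq hR s x :=
  scaleSq_proj_le hR s measurableSet_Ici x

/-- The operator on `L` which is induced by the positive spectral projection of `R`. -/
theorem exists_induced_posProj (hRA : ∀ v, R (e (A v)) = e v) (hτ : DenseRange τ) (hC : 0 ≤ C)
    {Θ : H →L[ℂ] L} (hΘ : ∀ y, ENNReal.ofReal (‖Θ y‖ ^ 2) ≤ ENNReal.ofReal C * scaleSq hR s (R y))
    (h : ∀ u, scaleSq hR s (e u) ≤ ENNReal.ofReal (C * ‖τ u‖ ^ 2)) :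
    ∃ P : L →L[ℂ] L, ∀ u, P (τ u) = Θ (posProj hR (e (A u))) := by
  refine ⟨LinearMap.extendOfNorm (Θ.toLinearMap ∘ₗ (posProj hR).toLinearMap ∘ₗ e ∘ₗ A) τ,
    LinearMap.extendOfNorm_eq hτ ⟨C, fun u => ?_⟩⟩
  change ‖Θ (posProj hR (e (A u)))‖ ≤ _
  have h1 := hΘ (posProj hR (e (A u)))
  rw [apply_posProj, hRA] at h1
  replace h1 := h1.trans (mul_le_mul_right ((scaleSq_posProj_le hR _).trans (h u)) _)
  rw [← ENNReal.ofReal_mul hC, ENNReal.ofReal_le_ofReal_iff (by positivity)] at h1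
  refine abs_le_of_sq_le_sq' ?_ (by positivity) |>.2
  linarith

/-- The pair `(Θ y, R y)` is a limit of pairs `(τ v, e v)`. -/
theorem mem_closure_range_of_extension (hRA : ∀ v, R (e (A v)) = e v)
    (hd : DenseRange fun v => e (A v)) {Θ : H →L[ℂ] L} (hΘA : ∀ v, Θ (e (A v)) = τ v) (y : H) :
    (Θ y, R y) ∈ closure (range fun u => (τ u, e u)) := by
  refine map_mem_closure (f := fun y => (Θ y, R y)) (by fun_prop) (hd y) ?_
  rintro _ ⟨v, rfl⟩
  exact ⟨v, by simp only [hΘA, hRA]⟩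

theorem induced_mem_closure_range (hRA : ∀ v, R (e (A v)) = e v)
    (hd : DenseRange fun v => e (A v)) {Θ : H →L[ℂ] L} (hΘA : ∀ v, Θ (e (A v)) = τ v)
    {P : L →L[ℂ] L} (hP : ∀ u, P (τ u) = Θ (posProj hR (e (A u)))) {x : L} {y : H}
    (h : (x, y) ∈ closure (range fun u => (τ u, e u))) :
    (P x, posProj hR y) ∈ closure (range fun u => (τ u, e u)) := by
  rw [← closure_closure]
  refine map_mem_closure (f := fun z : L × H => (P z.1, posProj hR z.2)) (by fun_prop) h ?_
  rintro _ ⟨u, rfl⟩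
  have h1 := mem_closure_range_of_extension hRA hd hΘA (posProj hR (e (A u)))
  rw [apply_posProj, hRA, ← hP] at h1
  exact h1

/-- The induced projections depend continuously on the operator: if `A' - A` is small relative to
`A`, then `A' = (1 + W) A` with a small bounded operator `W`, hence `R - R' = W* R'`, and the
estimate for the difference of the spectral projections applies. -/
theorem norm_induced_sub_le (hinj : Function.Injective R) (hR' : IsSelfAdjoint R')
    (hinj' : Function.Injective R') (hRA : ∀ v, R (e (A v)) = e v)
    (hRA' : ∀ v, R' (e (A' v)) = e v) (hd : DenseRange fun v => e (A v))
    {Θ Θ' : H →L[ℂ] L} (hΘA : ∀ v, Θ (e (A v)) = τ v) (hΘA' : ∀ v, Θ' (e (A' v)) = τ v)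
    (hC : 0 ≤ C) (hs : |s| ≤ 1 / 2)
    (hΘ : ∀ y, ENNReal.ofReal (‖Θ y‖ ^ 2) ≤ ENNReal.ofReal C * scaleSq hR s (R y))
    (h : ∀ u, scaleSq hR s (e u) ≤ ENNReal.ofReal (C * ‖τ u‖ ^ 2)) {ε : ℝ} (hε : 0 < ε)
    (hε2 : ε ≤ 1 / 2) (hAA' : ∀ v, ‖e ((A' - A) v)‖ ≤ ε * ‖e (A v)‖) (u : V) :
    ‖Θ (posProj hR (e (A u))) - Θ' (posProj hR' (e (A' u)))‖ ≤ C * ε * ‖τ u‖ := by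
  have hdA : DenseRange (e ∘ₗ A) := hd
  set W : H →L[ℂ] H := LinearMap.extendOfNorm (e ∘ₗ (A' - A)) (e ∘ₗ A) with hWdef
  have hW : ∀ v, W (e (A v)) = e (A' v) - e (A v) := fun v => by
    refine (LinearMap.extendOfNorm_eq hdA ⟨ε, hAA'⟩ v).trans ?_
    rw [LinearMap.comp_apply, LinearMap.sub_apply, map_sub]
  have hWn : ‖W‖ ≤ ε := LinearMap.opNorm_extendOfNorm_le hdA hε.le hAA'
  have h1W : ∀ v, (1 + W) (e (A v)) = e (A' v) := fun v => by
    rw [_root_.add_apply, one_apply_eq_self, hW, add_sub_cancel]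
  have hRW : ∀ y, R' ((1 + W) y) = R y := congrFun (hd.equalizer (by fun_prop) (by fun_prop)
    (funext fun v => by simp only [Function.comp, h1W, hRA, hRA']))
  have hΘW : ∀ y, Θ' ((1 + W) y) = Θ y := congrFun (hd.equalizer (by fun_prop) (by fun_prop)
    (funext fun v => by simp only [Function.comp, h1W, hΘA, hΘA']))
  have hsub : ∀ x, R x - R' x = ContinuousLinearMap.adjoint W (R' x) := fun x => by
    have e1 : R = R' * (1 + W) := ContinuousLinearMap.ext fun y => (hRW y).symm
    have e2 := congrArg star e1
    rw [star_mul, hR.star_eq, hR'.star_eq, star_add, star_one, add_mul, one_mul] at e2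
    nth_rewrite 1 [e2]
    rw [_root_.add_apply, add_sub_cancel_left]
    rfl
  have b1 : ∀ x, ‖R x - R' x‖ ≤ ε * ‖R' x‖ := fun x => by
    rw [hsub]
    refine (ContinuousLinearMap.le_opNorm _ _).trans ?_
    rw [LinearIsometryEquiv.norm_map]
    gcongr
  have b2 : ∀ x, ‖R x‖ ≤ 2 * ‖R' x‖ := fun x => by
    have := norm_add_le (R x - R' x) (R' x)
    rw [sub_add_cancel] at this
    nlinarith [b1 x, norm_nonneg (R' x)]
  have b3 : ∀ x, ‖R' x‖ ≤ 2 * ‖R x‖ := fun x => by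
    have := norm_sub_le (R x) (R x - R' x)
    rw [sub_sub_cancel] at this
    nlinarith [b1 x, norm_nonneg (R' x)]
  obtain ⟨z, hz⟩ : ∃ z, (1 + W) z = posProj hR' (e (A' u)) := by
    have hu : IsUnit (1 - -W) := isUnit_one_sub_of_norm_lt_one (by
      rw [norm_neg]
      linarith)
    rw [sub_neg_eq_add] at hu
    obtain ⟨U, hU⟩ := hu.exists_right_inv
    exact ⟨U (posProj hR' (e (A' u))), congrArg (fun S : H →L[ℂ] H => S _) hU⟩
  have hRz : R z = posProj hR' (e u) := by
    rw [← hRW, hz, apply_posProj, hRA']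
  have h1 := hΘ (posProj hR (e (A u)) - z)
  rw [map_sub, map_sub, apply_posProj, hRA, hRz, ← hΘW z, hz] at h1
  replace h1 := h1.trans (mul_le_mul_right ((scaleSq_posProj_sub_le hR hinj hR' hinj' hε b1 b2 b3
    hs _).trans (mul_le_mul_right (h u) _)) _)
  rw [← ENNReal.ofReal_mul (sq_nonneg _), ← ENNReal.ofReal_mul hC,
    ENNReal.ofReal_le_ofReal_iff (by positivity)] at h1
  refine abs_le_of_sq_le_sq' ?_ (by positivity) |>.2
  linarith

end Extension

/-! ### Continuity of the spectral projection -/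

section Main

variable {n : ℕ} {N : Type*} [TopologicalSpace N] [ChartedSpace (EuclideanSpace ℝ (Fin n)) N]
  {F : Type*} [NormedAddCommGroup F] [InnerProductSpace ℂ F] [FiniteDimensional ℂ F]
  {E : N → Type*} [TopologicalSpace (TotalSpace F E)] [∀ x, NormedAddCommGroup (E x)]
  [∀ x, InnerProductSpace ℂ (E x)] [FiberBundle F E] [IsManifold (𝓡 n) ∞ N] [VectorBundle ℂ F E]
  [ContMDiffVectorBundle ∞ F E (𝓡 n)] [CompactSpace N] [T2Space N]

theorem LocalizingCover.denseRange_toSobolev (K : LocalizingCover n F E) (s : ℝ) :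
    DenseRange (K.toSobolev s) :=
  UniformSpace.Completion.denseRange_coe (α := K.SobolevPre s)

theorem LocalizingCover.sobolevNorm_nonneg (K : LocalizingCover n F E) (s : ℝ)
    (u : SmoothSections n F E) : 0 ≤ K.sobolevNorm s u :=
  norm_nonneg _

variable [IsSmoothHermitian n F E] [MeasurableSpace N] [BorelSpace N] {μ : Measure N}
  [IsSmoothDensity n μ] {K : LocalizingCover n F E} {c s : ℝ}

/-- The operator `B - c`. -/
def EllSA.shifted (B : EllSA μ K c) : SmoothSections n F E →ₗ[ℂ] SmoothSections n F E :=
  B.op - (c : ℂ) • LinearMap.id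

theorem EllSA.shifted_sub_shifted (B B' : EllSA μ K c) : B'.shifted - B.shifted = B'.op - B.op :=
  sub_sub_sub_cancel_right _ _ _

/-- The inverse of `B - c`, the operators which it induces between `L²` and `L²ₛ`, and the
constants in the estimates which they satisfy. -/
theorem EllSA.exists_inverse (B : EllSA μ K c) (hs : |s| < 1) :
    ∃ (R : L2 n F E μ →L[ℂ] L2 n F E μ) (hR : IsSelfAdjoint R) (Θ : L2 n F E μ →L[ℂ] K.Sobolev s)
      (P : K.Sobolev s →L[ℂ] K.Sobolev s) (C : ℝ), Function.Injective R ∧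
      (∀ v, R (toL2 μ (B.shifted v)) = toL2 μ v) ∧
      (DenseRange fun v => toL2 μ (B.shifted v)) ∧
      IsSpectralProjection (l2Closure μ B.op) (Ici c) (posProj hR) ∧
      (∀ v, Θ (toL2 μ (B.shifted v)) = K.toSobolev s v) ∧
      (∀ u, P (K.toSobolev s u) =
        Θ (posProj hR (toL2 μ (B.shifted u)))) ∧
      0 < C ∧
      (∀ y, ENNReal.ofReal (‖Θ y‖ ^ 2) ≤ ENNReal.ofReal C * scaleSq hR s (R y)) ∧
      (∀ u, scaleSq hR s (toL2 μ u) ≤ ENNReal.ofReal (C * ‖K.toSobolev s u‖ ^ 2)) ∧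
      (∀ u, K.sobolevNorm 1 u ≤ C * ‖toL2 μ (B.shifted u)‖) ∧
      ∀ u, ‖toL2 μ u‖ ≤ C * K.sobolevNorm 0 u := by
  obtain ⟨R, hR, hinj, hRA, hd, hproj⟩ := exists_inverse_sub_smul (denseRange_toL2 μ)
    (B := B.op) (fun u v => by
      rw [inner_toL2, inner_toL2]
      exact B.selfAdjoint u v) B.notMem_spectrum
  have hA := B.elliptic.sub_smul (c : ℂ)
  obtain ⟨C₁, hC₁, h1⟩ := K.exists_scaleSq_equiv hA hR hinj hRA hd
  obtain ⟨C₂, hC₂, h2⟩ := K.exists_sobolevNorm_one_le hA hRA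
  set C : ℝ := C₁ + C₂ + 1 with hC
  have hC0 : 0 < C := by positivity
  have e1 : ∀ u, scaleSq hR s (toL2 μ u) ≤ ENNReal.ofReal (C * ‖K.toSobolev s u‖ ^ 2) := fun u => by
    refine (h1 s hs u).1.trans (ENNReal.ofReal_le_ofReal ?_)
    rw [K.norm_toSobolev]
    gcongr
    linarith
  have e2 : ∀ u, ENNReal.ofReal (‖K.toSobolev s u‖ ^ 2) ≤
      ENNReal.ofReal C * scaleSq hR s (toL2 μ u) := fun u => by
    rw [K.norm_toSobolev]
    exact (h1 s hs u).2.trans (mul_le_mul_left (ENNReal.ofReal_le_ofReal (by linarith)) _)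
  obtain ⟨Θ, hΘA, hΘ⟩ := exists_extension hR hinj hRA hd (abs_lt.1 hs).2 hC0.le e2
  obtain ⟨P, hP⟩ := exists_induced_posProj hR hRA (K.denseRange_toSobolev s) hC0.le hΘ e1
  refine ⟨R, hR, Θ, P, C, hinj, hRA, hd, hproj, hΘA, hP, hC0, hΘ, e1, fun u => ?_, fun u => ?_⟩
  · exact (h2 u).trans (mul_le_mul_of_nonneg_right (by linarith) (norm_nonneg _))
  · have h3 := (h1 0 (by norm_num) u).1
    have h4 := K.sobolevNorm_nonneg 0 u
    rw [scaleSq_zero, ENNReal.ofReal_le_ofReal_iff (by positivity)] at h3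
    refine abs_le_of_sq_le_sq' (h3.trans ?_) (by positivity) |>.2
    rw [mul_pow]
    gcongr
    nlinarith

/-- Closeness in the distance `‖B - B'‖_{1,0}` as an estimate on smooth sections. -/
theorem EllSA.sobolevNorm_sub_le_of_edist_lt {B B' : EllSA μ K c} {η : ℝ}
    (h : edist B' B < ENNReal.ofReal η) (u : SmoothSections n F E) :
    K.sobolevNorm 0 ((B'.op - B.op) u) ≤ η * K.sobolevNorm 1 u := by
  change K.opENorm 1 0 (B'.op - B.op) < _ at h
  simp only [LocalizingCover.opENorm, iInf_lt_iff] at h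
  obtain ⟨D, hD, hDη⟩ := h
  refine (hD u).trans (mul_le_mul_of_nonneg_right ?_ (K.sobolevNorm_nonneg 1 u))
  by_contra! hlt
  exact absurd hDη (not_lt.2 ((ENNReal.ofReal_le_ofReal hlt.le).trans ENNReal.ofReal_coe_nnreal.le))

end Main

end SpectralCut

theorem proposition4p2 {n : ℕ} {N : Type*} [TopologicalSpace N] [T2Space N] [CompactSpace N]
    [ChartedSpace (EuclideanSpace ℝ (Fin n)) N] [IsManifold (𝓡 n) ∞ N]
    [MeasurableSpace N] [BorelSpace N] (μ : Measure N) [SpectralCut.IsSmoothDensity n μ]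
    {F : Type*} [NormedAddCommGroup F] [InnerProductSpace ℂ F] [FiniteDimensional ℂ F]
    {E : N → Type*} [TopologicalSpace (TotalSpace F E)] [∀ x, NormedAddCommGroup (E x)]
    [∀ x, InnerProductSpace ℂ (E x)] [FiberBundle F E] [VectorBundle ℂ F E]
    [ContMDiffVectorBundle ∞ F E (𝓡 n)] [SpectralCut.IsSmoothHermitian n F E]
    (K : SpectralCut.LocalizingCover n F E) (c s : ℝ) (hs : |s| ≤ 1 / 2) :
    ∃ P : SpectralCut.EllSA μ K c → (K.Sobolev s →L[ℂ] K.Sobolev s),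
      (∀ B, ∃ Q : SpectralCut.L2 n F E μ →L[ℂ] SpectralCut.L2 n F E μ,
        SpectralCut.IsSpectralProjection (SpectralCut.l2Closure μ B.op) (Set.Ici c) Q ∧
          SpectralCut.Induces μ K Q (P B)) ∧
      Continuous P := by
  choose R hR Θ P C hinj hRA hd hproj hΘA hP hC hΘ hscale hone hzero using
    fun B : SpectralCut.EllSA μ K c => B.exists_inverse (s := s) (by linarith)
  refine ⟨P, fun B => ⟨_, hproj B, fun x y hxy =>
    SpectralCut.induced_mem_closure_range (hR B) (hRA B) (hd B) (hΘA B) (hP B) hxy⟩, ?_⟩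
  rw [continuous_iff_continuousAt]
  intro B
  refine (Metric.nhds_basis_eball.tendsto_iff Metric.nhds_basis_ball).2 fun δ hδ => ?_
  have hCB := hC B
  -- `‖P B' - P B‖ ≤ C ε` as soon as `‖(B' - B) u‖ ≤ ε ‖(B - c) u‖`, with `ε ≤ 1/2`
  obtain ⟨ε, hε, hε2, hεδ⟩ : ∃ ε : ℝ, 0 < ε ∧ ε ≤ 1 / 2 ∧ C B * ε < δ := by
    refine ⟨min (1 / 2) (δ / (2 * C B)), by positivity, min_le_left _ _, ?_⟩
    calc C B * min (1 / 2) (δ / (2 * C B)) ≤ C B * (δ / (2 * C B)) := by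
          gcongr
          exact min_le_right _ _
      _ = δ / 2 := by field_simp
      _ < δ := by linarith
  refine ⟨ENNReal.ofReal (ε / (C B * C B)), ENNReal.ofReal_pos.2 (by positivity), fun B' hB' => ?_⟩
  have hle : ∀ v, ‖SpectralCut.toL2 μ ((B'.shifted - B.shifted) v)‖ ≤
        ε * ‖SpectralCut.toL2 μ (B.shifted v)‖ := fun v => by
    rw [B.shifted_sub_shifted]
    calc _ ≤ C B * K.sobolevNorm 0 ((B'.op - B.op) v) := hzero B _
      _ ≤ C B * (ε / (C B * C B) * (C B * ‖SpectralCut.toL2 μ (B.shifted v)‖)) := by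
        gcongr
        refine (SpectralCut.EllSA.sobolevNorm_sub_le_of_edist_lt hB' v).trans ?_
        gcongr
        exact hone B v
      _ = _ := by field_simp
  rw [Metric.mem_ball, dist_comm, dist_eq_norm]
  refine lt_of_le_of_lt (ContinuousLinearMap.opNorm_le_bound _ (by positivity) fun x => ?_) hεδ
  refine (K.denseRange_toSobolev s).induction_on (p := fun x => ‖(P B - P B') x‖ ≤ C B * ε * ‖x‖) x
    (isClosed_le (by fun_prop) (by fun_prop)) fun u => ?_
  rw [_root_.sub_apply, hP, hP]
  exact SpectralCut.norm_induced_sub_le (hR B) (hinj B) (hR B') (hinj B') (hRA B) (hRA B') (hd B)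
    (hΘA B) (hΘA B') (hC B).le hs (hΘ B) (hscale B) hε hε2 hle u

end
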